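/- Notation. Functions are real functions of $r\in(0,\infty)$, taken up to equality almost everywhere, and derivatives in the spaces and energies are weak derivatives. Let $$H=\Big\{u:\int_0^\infty \big[(u')^2+u^2\big]\,r\,dr<\infty\Big\},\qquad X=\Big\{u\in H:\int_0^\infty \frac{u^2}{r^2}\,r\,dr<\infty\Big\}.$$ Fix $g>0$ and $d\in\mathbb Z\setminus\{0\}$. (A) Let $\kappa\in\mathbb R\setminus\{0\}$ and let $\eta\in C^\infty([0,\infty))$ satisfy $\eta=0$ on $[0,1]$, $\eta=1$ on $[2,\infty)$, $0\le\eta\le1$. Put $f_0=\eta$, $S_0=d\,\eta$, $$\mathcal E_{\kappa,g}(f,S,m)=\frac12\int_0^\infty\Big\{(f')^2+\Big[\frac{S'}{r}\Big]^2+(m')^2+\kappa^2 g m^2+\frac{(d-S)^2f^2}{r^2}+\frac{\kappa^2}{2}(1-f^2-m^2)^2\Big\}\,r\,dr,$$ $$I_{\kappa,g}(u,v,m)=\mathcal E_{\kappa,g}(f_0+u,S_0+rv,m)-\mathcal E_{\kappa,g}(f_0,S_0,0),\qquad (u,v,m)\in X\times X\times H .$$ Then the integrand is integrable for every $(u,v,m)\in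 X\times X\times H$; $I_{\kappa,g}$ attains its minimum on $X\times X\times H$; and for every minimizer $(u,v,m)$ the triple $(f,S,m)=(f_0+u,S_0+rv,m)$ has a representative that is $C^\infty$ on $[0,\infty)$ and solves the system $(GL)_{\kappa,g}$: for $r>0$, $$-f''-\frac1r f'+\frac{(d-S)^2}{r^2}f=\kappa^2(1-f^2-m^2)f,\qquad -S''+\frac1rS'=(d-S)f^2,$$ $$-m''-\frac1r m'+\kappa^2 g m=\kappa^2(1-f^2-m^2)m,$$ with $f\ge0$, $f(r),S(r)\to0$ as $r\to0$, $m'(0)=0$, and $f(r)\to1$, $S(r)\to d$, $m(r)\to0$ as $r\to\infty$. (B) There is a positive solution $\tilde f_\infty$ on $(0,\infty)$ of $$-\tilde f_\infty''-\frac1r\tilde f_\infty'+\frac{d^2}{r^2}\tilde f_\infty=(1-\tilde f_\infty^2)\tilde f_\infty,\qquad \tilde f_\infty(r)\to0\ (r\to0),\quad \tilde f_\infty(r)\to1\ (r\to\infty).$$ For every such $\tilde f_\infty$, put $$\mathcal E_{\infty,g}(f,m)=\frac12\int_0^\infty\Big\{(f')^2+(m')^2+gm^2+\frac{d^2}{r^2}\big[f^2-\tilde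 f_\infty^2\big]+\frac12(1-f^2-m^2)^2\Big\}\,r\,dr,$$ $$I_{\infty,g}(u,m)=\mathcal E_{\infty,g}(\tilde f_\infty+u,m)-\mathcal E_{\infty,g}(\tilde f_\infty,0),\qquad (u,m)\in X\times H.$$ Then the integrand is integrable for every $(u,m)\in X\times H$; $I_{\infty,g}$ attains its minimum on $X\times H$; and for every minimizer $(u,m)$ the pair $(f,m)=(\tilde f_\infty+u,m)$ has a representative that is $C^\infty$ on $[0,\infty)$ and solves the system $(GL)_{\infty,g}$: for $r>0$, $$-f''-\frac1r f'+\frac{d^2}{r^2}f=(1-f^2-m^2)f,\qquad -m''-\frac1rm'+gm=(1-f^2-m^2)m,$$ with $f\ge0$, $f(r)\to0$ as $r\to0$, $m'(0)=0$, and $f(r)\to1$, $m(r)\to0$ as $r\to\infty$. -/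

import Mathlib

open MeasureTheory Set Filter Topology
open scoped ContDiff

namespace GLVortex

noncomputable section

/-- The measure `r dr` on `(0, ∞)`. -/
def radialMeasure : Measure ℝ :=
  (volume.restrict (Ioi 0)).withDensity fun r => ENNReal.ofReal r

/-- Smooth test functions with compact support in `(0, ∞)`. -/
def IsTest (φ : ℝ → ℝ) : Prop :=
  ContDiff ℝ ∞ φ ∧ HasCompactSupport φ ∧ tsupport φ ⊆ Ioi 0

/-- `v` is a weak derivative of `u` on `(0, ∞)`. -/
def HasWeakDeriv (u v : ℝ → ℝ) : Prop :=
  LocallyIntegrableOn u (Ioi 0) ∧ LocallyIntegrableOn v (Ioi 0) ∧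
    ∀ φ : ℝ → ℝ, IsTest φ →
      ∫ r in Ioi (0 : ℝ), u r * deriv φ r = -∫ r in Ioi (0 : ℝ), v r * φ r

open Classical in
/-- A weak derivative of `u` on `(0, ∞)`; it is unique up to null sets when it exists
(and `0` by convention when it does not). -/
def wderiv (u : ℝ → ℝ) : ℝ → ℝ :=
  if h : ∃ v, HasWeakDeriv u v then h.choose else 0

/-- The space `H = H^1_r`: both `u` and its weak derivative are square integrable for `r dr`.
Elements are functions on `(0, ∞)` taken up to equality almost everywhere; values at
`r ≤ 0` play no role. -/
def radialH : Set (ℝ → ℝ) :=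
  {u | MemLp u 2 radialMeasure ∧ ∃ v, HasWeakDeriv u v ∧ MemLp v 2 radialMeasure}

/-- The space `X` of all `u ∈ H` with `∫ u² / r² r dr < ∞`. -/
def radialX : Set (ℝ → ℝ) :=
  {u | u ∈ radialH ∧ MemLp (fun r => u r / r) 2 radialMeasure}

/-! ### Finite `κ` -/

/-- The cut-off `η ∈ C^∞([0, ∞))` that fixes the conditions at infinity. -/
structure IsCutoff (η : ℝ → ℝ) : Prop where
  smooth : ContDiffOn ℝ ∞ η (Ici 0)
  eq_zero : ∀ r ∈ Icc (0 : ℝ) 1, η r = 0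
  eq_one : ∀ r ∈ Ici (2 : ℝ), η r = 1
  mem_Icc : ∀ r ∈ Ici (0 : ℝ), η r ∈ Icc (0 : ℝ) 1

/-- The energy density (with respect to `r dr`, without the factor `1/2`). -/
def density (κ g : ℝ) (d : ℤ) (f S m : ℝ → ℝ) (r : ℝ) : ℝ :=
  wderiv f r ^ 2 + (wderiv S r / r) ^ 2 + wderiv m r ^ 2 + κ ^ 2 * g * m r ^ 2
    + (d - S r) ^ 2 * f r ^ 2 / r ^ 2 + κ ^ 2 / 2 * (1 - f r ^ 2 - m r ^ 2) ^ 2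

/-- The energy `𝓔_{κ,g}(f, S, m)`. -/
def energy (κ g : ℝ) (d : ℤ) (f S m : ℝ → ℝ) : ℝ :=
  1 / 2 * ∫ r, density κ g d f S m r ∂radialMeasure

/-- `f = η + u`. -/
def fOf (η u : ℝ → ℝ) : ℝ → ℝ := fun r => η r + u r

/-- `S = d η + r v`. -/
def SOf (d : ℤ) (η v : ℝ → ℝ) : ℝ → ℝ := fun r => d * η r + r * v r

/-- The reduced energy
`I_{κ,g}(u, v, m) = 𝓔_{κ,g}(η + u, d η + r v, m) - 𝓔_{κ,g}(η, d η, 0)`. -/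
def reducedEnergy (κ g : ℝ) (d : ℤ) (η : ℝ → ℝ)
    (p : (ℝ → ℝ) × (ℝ → ℝ) × (ℝ → ℝ)) : ℝ :=
  energy κ g d (fOf η p.1) (SOf d η p.2.1) p.2.2
    - energy κ g d η (fun r => d * η r) 0

/-- `(f, S, m)` is a smooth solution on `[0, ∞)` of the system `(GL)_{κ,g}`, including the
conditions at `0` and at infinity that belong to the system. -/
structure IsSmoothSolution (κ g : ℝ) (d : ℤ) (f S m : ℝ → ℝ) : Prop where
  smooth_f : ContDiffOn ℝ ∞ f (Ici 0)
  smooth_S : ContDiffOn ℝ ∞ S (Ici 0)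
  smooth_m : ContDiffOn ℝ ∞ m (Ici 0)
  eq_f : ∀ r : ℝ, 0 < r →
    -deriv (deriv f) r - 1 / r * deriv f r + (d - S r) ^ 2 / r ^ 2 * f r
      = κ ^ 2 * (1 - f r ^ 2 - m r ^ 2) * f r
  eq_S : ∀ r : ℝ, 0 < r →
    -deriv (deriv S) r + 1 / r * deriv S r = (d - S r) * f r ^ 2
  eq_m : ∀ r : ℝ, 0 < r →
    -deriv (deriv m) r - 1 / r * deriv m r + κ ^ 2 * g * m r
      = κ ^ 2 * (1 - f r ^ 2 - m r ^ 2) * m r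
  f_nonneg : ∀ r : ℝ, 0 ≤ r → 0 ≤ f r
  f_zero : Tendsto f (𝓝[>] 0) (𝓝 0)
  S_zero : Tendsto S (𝓝[>] 0) (𝓝 0)
  m_zero : derivWithin m (Ici 0) 0 = 0
  f_infty : Tendsto f atTop (𝓝 1)
  S_infty : Tendsto S atTop (𝓝 d)
  m_infty : Tendsto m atTop (𝓝 0)

/-! ### The limiting problem `κ = ∞` -/

/-- `F` is a positive solution of the high kappa vortex equation with `F(0) = 0` and
`F(∞) = 1`. -/
structure IsProfile (d : ℤ) (F : ℝ → ℝ) : Prop where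
  contDiffOn : ContDiffOn ℝ 2 F (Ioi 0)
  pos : ∀ r : ℝ, 0 < r → 0 < F r
  eqn : ∀ r : ℝ, 0 < r →
    -deriv (deriv F) r - 1 / r * deriv F r + (d : ℝ) ^ 2 / r ^ 2 * F r = (1 - F r ^ 2) * F r
  zero : Tendsto F (𝓝[>] 0) (𝓝 0)
  infty : Tendsto F atTop (𝓝 1)

/-- The renormalized energy density (with respect to `r dr`, without the factor `1/2`). -/
def densityInf (g : ℝ) (d : ℤ) (F f m : ℝ → ℝ) (r : ℝ) : ℝ :=
  wderiv f r ^ 2 + wderiv m r ^ 2 + g * m r ^ 2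
    + (d : ℝ) ^ 2 / r ^ 2 * (f r ^ 2 - F r ^ 2) + 1 / 2 * (1 - f r ^ 2 - m r ^ 2) ^ 2

/-- The energy `𝓔_{∞,g}(f, m)`. -/
def energyInf (g : ℝ) (d : ℤ) (F f m : ℝ → ℝ) : ℝ :=
  1 / 2 * ∫ r, densityInf g d F f m r ∂radialMeasure

/-- The reduced energy `I_{∞,g}(u, m) = 𝓔_{∞,g}(F + u, m) - 𝓔_{∞,g}(F, 0)`. -/
def reducedEnergyInf (g : ℝ) (d : ℤ) (F : ℝ → ℝ) (p : (ℝ → ℝ) × (ℝ → ℝ)) : ℝ :=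
  energyInf g d F (fOf F p.1) p.2 - energyInf g d F F 0

/-- `(f, m)` is a smooth solution on `[0, ∞)` of the system `(GL)_{∞,g}`, including the
conditions at `0` and at infinity that belong to the system. -/
structure IsSmoothSolutionInf (g : ℝ) (d : ℤ) (f m : ℝ → ℝ) : Prop where
  smooth_f : ContDiffOn ℝ ∞ f (Ici 0)
  smooth_m : ContDiffOn ℝ ∞ m (Ici 0)
  eq_f : ∀ r : ℝ, 0 < r →
    -deriv (deriv f) r - 1 / r * deriv f r + (d : ℝ) ^ 2 / r ^ 2 * f r
      = (1 - f r ^ 2 - m r ^ 2) * f r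
  eq_m : ∀ r : ℝ, 0 < r →
    -deriv (deriv m) r - 1 / r * deriv m r + g * m r
      = (1 - f r ^ 2 - m r ^ 2) * m r
  f_nonneg : ∀ r : ℝ, 0 ≤ r → 0 ≤ f r
  f_zero : Tendsto f (𝓝[>] 0) (𝓝 0)
  m_zero : derivWithin m (Ici 0) 0 = 0
  f_infty : Tendsto f atTop (𝓝 1)
  m_infty : Tendsto m atTop (𝓝 0)

end

end GLVortex

open GLVortex

/-! Existence is the direct method, and regularity is ODE analysis at the two singular ends `0` and
`∞`. Every element of `H` or `X` is replaced by its continuous representative, a primitive of its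
weak derivative (`IsPrim`, `HasWeakDeriv.exists_isPrim`). The problem then concerns functions on
`(0, ∞)` with explicit derivatives (`edens`, `edensInf`) in the affine classes `AdmF` (`f - η ∈ X`)
and `AdmS` (`(S - dη) / r ∈ X`).

Existence (`exists_isMin`, `exists_isMinInf`). The energy bounds the derivatives, `m` and `1 - f² -
m²` in `L²(r dr)`. Weak limits of the derivatives together with convergence of the values at `1`
give pointwise limits. The squared derivatives are weakly lower semicontinuous and the potential
terms pass to the limit by Fatou. The limit must lie in the affine classes again. At infinity a
radius common to the whole sequence beyond which `f ≥ 1/2` excludes the wrong sign. At the origin `S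
= O(r)` keeps `d - S` away from `0`, so the energy controls `f / r`. For `S` a Hardy inequality is
used. For `κ = ∞` the term `d² (f² - η²) / r²` has no sign, but its negative part is absorbed by the
other terms up to a multiple of `r⁻⁴`, which is integrable at infinity (`potential_lower_bound`).

Equations. The densities are polynomials in the size of a perturbation, so the linear coefficient
has integral zero (`integral_linear_coeff_eq_zero`), and a weak solution with continuous right side
is classical (`classical_of_weak`).

Sign of `f` (`pos_of_flip`). If `f s = 0`, reversing the sign of `f` on `(0, s]` does not change the
energy. The result is again a minimizer, hence differentiable at `s`, so `f' s = 0`. Uniqueness for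
the ODE gives `f = 0` beyond `s`, against `f → 1`.

Smoothness at the origin (`GLSystem.exists_smooth`). With `n = |d|` put `f = rⁿ a` and `S = r² b`.
The even extensions of `a`, `b`, `m` solve equations `(rᵏ y')' = rᵏ G` with `G` a polynomial in the
unknowns and `r`. Hence `y'` is `r` times a weighted average of `G`, which is as smooth as `G`, and
induction gains one derivative at a time.

Limit of `S` (`GLSystem.tendsto_S`). Membership in the class gives only `(S - d) / r → 0`; the
equation improves this through the monotone quantity `(S - d) S' / r`.

The profile at `κ = ∞` is a minimizer among pairs with `m = 0`. Conversely any profile `F` satisfies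
`F - η ∈ X` (`IsProfile.admF`), by an energy identity for `F - 1` at infinity. So `F + X = η + X`,
and replacing `F` by `η` in the energy only adds a constant. -/

open GLVortex

namespace GLVortex

/-! ### Absolutely continuous functions on `(0, ∞)` -/

/-- `u` is a primitive of the locally integrable function `w` on `(0, ∞)`. -/
def IsPrim (u w : ℝ → ℝ) : Prop :=
  LocallyIntegrableOn w (Ioi 0) ∧ ∀ a b : ℝ, 0 < a → 0 < b → ∫ t in a..b, w t = u b - u a

theorem uIcc_subset_Ioi {a b : ℝ} (ha : 0 < a) (hb : 0 < b) : uIcc a b ⊆ Ioi 0 := fun _ hx =>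
  lt_of_lt_of_le (lt_min ha hb) hx.1

theorem intervalIntegrable_of_locallyIntegrableOn {w : ℝ → ℝ} (hw : LocallyIntegrableOn w (Ioi 0))
    {a b : ℝ} (ha : 0 < a) (hb : 0 < b) : IntervalIntegrable w volume a b :=
  (hw.integrableOn_compact_subset (uIcc_subset_Ioi ha hb) isCompact_uIcc).intervalIntegrable

theorem locallyIntegrableOn_Ioi_iff {w : ℝ → ℝ} :
    LocallyIntegrableOn w (Ioi 0) ↔ ∀ a b : ℝ, 0 < a → 0 < b → IntervalIntegrable w volume a b := by
  refine ⟨fun h a b ha hb => intervalIntegrable_of_locallyIntegrableOn h ha hb, fun h => ?_⟩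
  intro x hx
  have hx : 0 < x := hx
  refine ⟨Ioc (x / 2) (x + 1), mem_nhdsWithin_of_mem_nhds (Ioc_mem_nhds (by linarith) (by linarith)), ?_⟩
  exact (intervalIntegrable_iff_integrableOn_Ioc_of_le (by linarith)).1
    (h (x / 2) (x + 1) (by linarith) (by linarith))

theorem locallyIntegrableOn_of_continuousOn {w : ℝ → ℝ} (hw : ContinuousOn w (Ioi 0)) :
    LocallyIntegrableOn w (Ioi 0) :=
  hw.locallyIntegrableOn measurableSet_Ioi

theorem LocallyIntegrableOn.mul_cont {w c : ℝ → ℝ} (hw : LocallyIntegrableOn w (Ioi 0))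
    (hc : ContinuousOn c (Ioi 0)) : LocallyIntegrableOn (fun r => w r * c r) (Ioi 0) := by
  rw [locallyIntegrableOn_Ioi_iff] at *
  exact fun a b ha hb => (hw a b ha hb).mul_continuousOn (hc.mono (uIcc_subset_Ioi ha hb))

namespace IsPrim

variable {u v w z : ℝ → ℝ}

theorem intervalIntegrable (h : IsPrim u w) {a b : ℝ} (ha : 0 < a) (hb : 0 < b) :
    IntervalIntegrable w volume a b := intervalIntegrable_of_locallyIntegrableOn h.1 ha hb

theorem eq_add (h : IsPrim u w) {a b : ℝ} (ha : 0 < a) (hb : 0 < b) :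
    u b = u a + ∫ t in a..b, w t := by rw [h.2 a b ha hb]; ring

theorem continuousOn (h : IsPrim u w) : ContinuousOn u (Ioi 0) := by
  intro x hx
  have hx : 0 < x := hx
  have h1 : ContinuousOn (fun b => ∫ t in (x/2)..b, w t) (uIcc (x/2) (x+1)) :=
    intervalIntegral.continuousOn_primitive_interval
      (h.1.integrableOn_compact_subset (uIcc_subset_Ioi (by linarith) (by linarith)) isCompact_uIcc)
  have hn : uIcc (x/2) (x+1) ∈ 𝓝 x := by
    rw [uIcc_of_le (by linarith)]; exact Icc_mem_nhds (by linarith) (by linarith)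
  have h2 := (h1.continuousAt hn).const_add (u (x/2))
  refine (h2.congr ?_).continuousWithinAt
  filter_upwards [Ioi_mem_nhds hx] with b hb
  rw [h.2 _ _ (by linarith) hb]; ring

theorem of_hasDerivAt (hd : ∀ r, 0 < r → HasDerivAt u (w r) r) (hw : ContinuousOn w (Ioi 0)) :
    IsPrim u w := by
  refine ⟨locallyIntegrableOn_of_continuousOn hw, fun a b ha hb => ?_⟩
  refine intervalIntegral.integral_eq_sub_of_hasDerivAt (fun x hx => hd x (uIcc_subset_Ioi ha hb hx)) ?_
  exact (hw.mono (uIcc_subset_Ioi ha hb)).intervalIntegrable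

theorem hasDerivAt (h : IsPrim u w) (hw : ContinuousOn w (Ioi 0)) {r : ℝ} (hr : 0 < r) :
    HasDerivAt u (w r) r := by
  have h1 := intervalIntegral.integral_hasDerivAt_right (h.intervalIntegrable zero_lt_one hr)
    (hw.stronglyMeasurableAtFilter isOpen_Ioi r hr) (hw.continuousAt (Ioi_mem_nhds hr))
  refine ((h1.const_add (u 1))).congr_of_eventuallyEq ?_
  filter_upwards [Ioi_mem_nhds hr] with b hb
  exact h.eq_add zero_lt_one hb

theorem congr_deriv (h : IsPrim u w) (hz : ∀ᵐ r, 0 < r → w r = z r) : IsPrim u z := by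
  have key : ∀ a b : ℝ, 0 < a → 0 < b → ∀ᵐ x, x ∈ uIoc a b → w x = z x := by
    intro a b ha hb
    filter_upwards [hz] with x hx hx'
    exact hx (uIcc_subset_Ioi ha hb (uIoc_subset_uIcc hx'))
  refine ⟨locallyIntegrableOn_Ioi_iff.2 fun a b ha hb => ?_, fun a b ha hb => ?_⟩
  · refine (h.intervalIntegrable ha hb).congr_ae ?_
    rw [EventuallyEq, ae_restrict_iff' measurableSet_uIoc]; exact key a b ha hb
  · rw [← h.2 a b ha hb]
    exact (intervalIntegral.integral_congr_ae (key a b ha hb)).symm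

theorem congr_fun (h : IsPrim u w) (hv : ∀ r, 0 < r → u r = v r) : IsPrim v w :=
  ⟨h.1, fun a b ha hb => by rw [h.2 a b ha hb, hv a ha, hv b hb]⟩

theorem of_locallyIntegrableOn (h : LocallyIntegrableOn w (Ioi 0)) (c s : ℝ) (hs : 0 < s) :
    IsPrim (fun r => c + ∫ t in s..r, w t) w := by
  refine ⟨h, fun a b ha hb => ?_⟩
  have := intervalIntegral.integral_interval_sub_left
    (intervalIntegrable_of_locallyIntegrableOn h hs hb)
    (intervalIntegrable_of_locallyIntegrableOn h hs ha)
  simp only; linarith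

theorem add (hu : IsPrim u w) (hv : IsPrim v z) :
    IsPrim (fun r => u r + v r) (fun r => w r + z r) := by
  refine ⟨hu.1.add hv.1, fun a b ha hb => ?_⟩
  rw [intervalIntegral.integral_add (hu.intervalIntegrable ha hb) (hv.intervalIntegrable ha hb),
    hu.2 a b ha hb, hv.2 a b ha hb]; ring

theorem const_mul (c : ℝ) (hu : IsPrim u w) : IsPrim (fun r => c * u r) (fun r => c * w r) := by
  refine ⟨locallyIntegrableOn_Ioi_iff.2 fun a b ha hb => (hu.intervalIntegrable ha hb).const_mul c,
    fun a b ha hb => ?_⟩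
  rw [intervalIntegral.integral_const_mul, hu.2 a b ha hb]; ring

theorem sub (hu : IsPrim u w) (hv : IsPrim v z) :
    IsPrim (fun r => u r - v r) (fun r => w r - z r) := by
  have := hu.add (hv.const_mul (-1))
  convert this using 2 <;> ring

theorem const (c : ℝ) : IsPrim (fun _ => c) (fun _ => 0) :=
  of_hasDerivAt (fun r _ => hasDerivAt_const r c) continuousOn_const

theorem id : IsPrim (fun r => r) (fun _ => 1) :=
  of_hasDerivAt (fun r _ => hasDerivAt_id r) continuousOn_const

/-- The product rule for absolutely continuous functions is applied to the integrals from `a`, that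
is, to `u - u a` and `v - v a`; the terms linear in `u a` and `v a` are restored afterwards. -/
theorem mul (hu : IsPrim u w) (hv : IsPrim v z) :
    IsPrim (fun r => u r * v r) (fun r => w r * v r + u r * z r) := by
  have hl : ∀ a b : ℝ, 0 < a → 0 < b →
      IntervalIntegrable (fun r => w r * v r + u r * z r) volume a b := fun a b ha hb =>
    ((hu.intervalIntegrable ha hb).mul_continuousOn
      (hv.continuousOn.mono (uIcc_subset_Ioi ha hb))).add
    ((hv.intervalIntegrable ha hb).continuousOn_mul
      (hu.continuousOn.mono (uIcc_subset_Ioi ha hb)))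
  refine ⟨locallyIntegrableOn_Ioi_iff.2 hl, fun a b ha hb => ?_⟩
  have haw := (hu.intervalIntegrable ha hb)
  have haz := (hv.intervalIntegrable ha hb)
  have hU := (haw.absolutelyContinuousOnInterval_intervalIntegral (c := a) left_mem_uIcc)
  have hV := (haz.absolutelyContinuousOnInterval_intervalIntegral (c := a) left_mem_uIcc)
  have h1 := hU.integral_deriv_mul_eq_sub hV
  have h2 : ∫ x in a..b, (w x * (v x - v a) + (u x - u a) * z x) = (u b - u a) * (v b - v a) := by
    rw [hu.2 a b ha hb, hv.2 a b ha hb] at h1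
    simp only [intervalIntegral.integral_same, mul_zero, sub_zero] at h1
    rw [← h1]
    refine intervalIntegral.integral_congr_ae ?_
    filter_upwards [haw.ae_hasDerivAt_integral, haz.ae_hasDerivAt_integral] with x h3 h4 hx
    have hx' := uIoc_subset_uIcc hx
    have hx0 := uIcc_subset_Ioi ha hb hx'
    rw [(h3 hx' a left_mem_uIcc).deriv, (h4 hx' a left_mem_uIcc).deriv, hu.2 a x ha hx0,
      hv.2 a x ha hx0]
  have h3 : ∫ x in a..b, (w x * v x + u x * z x) =
      (∫ x in a..b, (w x * (v x - v a) + (u x - u a) * z x)) +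
        ((v a * ∫ x in a..b, w x) + u a * ∫ x in a..b, z x) := by
    rw [← intervalIntegral.integral_const_mul, ← intervalIntegral.integral_const_mul,
      ← intervalIntegral.integral_add (haw.const_mul _) (haz.const_mul _),
      ← intervalIntegral.integral_add]
    · congr 1; ext x; ring
    · have := (hl a b ha hb).sub ((haw.const_mul (v a)).add (haz.const_mul (u a)))
      refine this.congr (fun x _ => ?_); ring
    · exact (haw.const_mul _).add (haz.const_mul _)
  rw [h3, h2, hu.2 a b ha hb, hv.2 a b ha hb]; ring

end IsPrim

/-! ### Weak derivatives -/

theorem IsTest.zero_off {φ : ℝ → ℝ} (h : IsTest φ) :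
    ∃ a b : ℝ, 0 < a ∧ a < b ∧ (∀ r, r ≤ a → φ r = 0) ∧ (∀ r, b ≤ r → φ r = 0) ∧
      (∀ r, r ≤ a → deriv φ r = 0) ∧ ∀ r, b ≤ r → deriv φ r = 0 := by
  obtain ⟨_, h2, h3⟩ := h
  have hz : ∀ r, r ∉ tsupport φ → φ r = 0 ∧ deriv φ r = 0 := fun r hr =>
    ⟨image_eq_zero_of_notMem_tsupport hr, by
      have h5 : φ =ᶠ[𝓝 r] fun _ => 0 := notMem_tsupport_iff_eventuallyEq.1 hr
      rw [h5.deriv_eq]; simp⟩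
  rcases (tsupport φ).eq_empty_or_nonempty with he | hne
  · exact ⟨1, 2, by norm_num, by norm_num, fun r _ => (hz r (by simp [he])).1,
      fun r _ => (hz r (by simp [he])).1, fun r _ => (hz r (by simp [he])).2,
      fun r _ => (hz r (by simp [he])).2⟩
  · obtain ⟨a, ha, ha'⟩ := h2.exists_isLeast hne
    obtain ⟨b, hb, hb'⟩ := h2.exists_isGreatest hne
    have ha0 : 0 < a := h3 ha
    have hab : a ≤ b := ha' hb
    have h6 : ∀ r, r ≤ a / 2 → r ∉ tsupport φ := fun r hr hm => by
      have := ha' hm; linarith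
    have h7 : ∀ r, b + 1 ≤ r → r ∉ tsupport φ := fun r hr hm => by
      have := hb' hm; linarith
    exact ⟨a / 2, b + 1, by linarith, by linarith, fun r hr => (hz r (h6 r hr)).1,
      fun r hr => (hz r (h7 r hr)).1, fun r hr => (hz r (h6 r hr)).2, fun r hr => (hz r (h7 r hr)).2⟩

theorem setIntegral_Ioi_eq_interval {G : ℝ → ℝ} {a b : ℝ} (ha : 0 < a) (hab : a < b)
    (h1 : ∀ r, r ≤ a → G r = 0) (h2 : ∀ r, b ≤ r → G r = 0) :
    ∫ r in Ioi (0 : ℝ), G r = ∫ r in a..b, G r := by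
  rw [intervalIntegral.integral_of_le hab.le]
  refine (setIntegral_eq_of_subset_of_forall_sdiff_eq_zero measurableSet_Ioi
    (fun x hx => lt_trans ha hx.1) ?_)
  rintro x ⟨_, hx⟩
  by_cases h : x ≤ a
  · exact h1 x h
  · exact h2 x (by by_contra h'; exact hx ⟨by linarith, by linarith⟩)

theorem integrableOn_Ioi_of_interval {G : ℝ → ℝ} {a b : ℝ} (hab : a < b)
    (h1 : ∀ r, r ≤ a → G r = 0) (h2 : ∀ r, b ≤ r → G r = 0)
    (hG : IntervalIntegrable G volume a b) : Integrable G := by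
  rw [intervalIntegrable_iff_integrableOn_Ioc_of_le hab.le] at hG
  refine (integrableOn_iff_integrable_of_support_subset ?_).1 hG
  intro x hx
  constructor
  · by_contra h; exact hx (h1 x (not_lt.1 h))
  · by_contra h; exact hx (h2 x (not_le.1 h).le)

theorem IsTest.isPrim {φ : ℝ → ℝ} (h : IsTest φ) : IsPrim φ (deriv φ) :=
  IsPrim.of_hasDerivAt (fun r _ => ((h.1.differentiable (by simp)) r).hasDerivAt)
    ((h.1.continuous_deriv (by simp)).continuousOn)

theorem IsPrim.hasWeakDeriv {u w : ℝ → ℝ} (h : IsPrim u w) : HasWeakDeriv u w := by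
  refine ⟨locallyIntegrableOn_of_continuousOn h.continuousOn, h.1, fun φ hφ => ?_⟩
  obtain ⟨a, b, ha, hab, z1, z2, z3, z4⟩ := hφ.zero_off
  have hb := ha.trans hab
  rw [setIntegral_Ioi_eq_interval ha hab (fun r hr => by rw [z3 r hr, mul_zero])
      (fun r hr => by rw [z4 r hr, mul_zero]),
    setIntegral_Ioi_eq_interval ha hab (fun r hr => by rw [z1 r hr, mul_zero])
      (fun r hr => by rw [z2 r hr, mul_zero])]
  have h1 := (h.mul hφ.isPrim).2 a b ha hb
  have hs := uIcc_subset_Ioi ha hb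
  rw [intervalIntegral.integral_add
    ((h.intervalIntegrable ha hb).mul_continuousOn (hφ.isPrim.continuousOn.mono hs))
    ((hφ.isPrim.intervalIntegrable ha hb).continuousOn_mul (h.continuousOn.mono hs))] at h1
  simp only [z1 a le_rfl, z2 b le_rfl, mul_zero, sub_zero] at h1
  linarith

theorem exists_isTest_integral_one : ∃ ρ : ℝ → ℝ, IsTest ρ ∧ ∫ r, ρ r = 1 := by
  let f : ContDiffBump (2 : ℝ) := ⟨1/2, 1, by norm_num, by norm_num⟩
  refine ⟨f.normed volume, ⟨f.contDiff_normed, f.hasCompactSupport_normed, ?_⟩, f.integral_normed⟩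
  rw [f.tsupport_normed_eq]
  intro x hx
  have h3 : f.rOut = 1 := rfl
  rw [Metric.mem_closedBall, Real.dist_eq, h3, abs_le] at hx
  have := hx.1
  simp only [mem_Ioi]; linarith

/-- Mean zero is exactly what makes the primitive that starts left of the support vanish again right
of it. -/
theorem IsTest.primitive {ψ : ℝ → ℝ} (h : IsTest ψ) (h0 : ∫ r, ψ r = 0) :
    ∃ φ, IsTest φ ∧ ∀ r, deriv φ r = ψ r := by
  obtain ⟨a, b, ha, hab, z1, z2, -, -⟩ := h.zero_off
  have hc := h.1.continuous
  have hd : ∀ r, HasDerivAt (fun r => ∫ t in a..r, ψ t) (ψ r) r := fun r =>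
    (hc.integral_hasStrictDerivAt a r).hasDerivAt
  have hder : deriv (fun r => ∫ t in a..r, ψ t) = ψ := funext fun r => (hd r).deriv
  have hz1 : ∀ r, r ≤ a → ∫ t in a..r, ψ t = 0 := by
    intro r hr
    refine (intervalIntegral.integral_congr (g := fun _ => 0) fun x hx => ?_).trans (by simp)
    rw [uIcc_of_ge hr] at hx
    exact z1 x hx.2
  have hall : ∫ r, ψ r = ∫ t in a..b, ψ t := by
    rw [← setIntegral_Ioi_eq_interval ha hab z1 z2, ← integral_indicator measurableSet_Ioi]
    congr 1; ext x
    by_cases hx : x ∈ Ioi (0:ℝ)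
    · simp [hx]
    · rw [indicator_of_notMem hx, z1 x (by simp at hx; linarith)]
  have hz2 : ∀ r, b ≤ r → ∫ t in a..r, ψ t = 0 := by
    intro r hr
    rw [← intervalIntegral.integral_add_adjacent_intervals (hc.intervalIntegrable a b)
      (hc.intervalIntegrable b r), ← hall, h0, zero_add]
    refine (intervalIntegral.integral_congr (g := fun _ => 0) fun x hx => ?_).trans (by simp)
    rw [uIcc_of_le hr] at hx
    exact z2 x hx.1
  have hsup : Function.support (fun r => ∫ t in a..r, ψ t) ⊆ Icc a b := by
    intro x hx
    constructor
    · by_contra h; exact hx (hz1 x (not_le.1 h).le)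
    · by_contra h; exact hx (hz2 x (not_le.1 h).le)
  have hts : tsupport (fun r => ∫ t in a..r, ψ t) ⊆ Icc a b := closure_minimal hsup isClosed_Icc
  refine ⟨fun r => ∫ t in a..r, ψ t, ⟨?_, ?_, ?_⟩, fun r => (hd r).deriv⟩
  · rw [contDiff_infty_iff_deriv, hder]
    exact ⟨fun r => (hd r).differentiableAt, h.1⟩
  · exact HasCompactSupport.of_support_subset_isCompact isCompact_Icc hsup
  · exact fun x hx => lt_of_lt_of_le ha (hts hx).1

theorem IsTest.integrable_mul {ψ u : ℝ → ℝ} (h : IsTest ψ) (hu : LocallyIntegrableOn u (Ioi 0)) :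
    Integrable (fun r => u r * ψ r) := by
  obtain ⟨a, b, ha, hab, z1, z2, -, -⟩ := h.zero_off
  exact integrableOn_Ioi_of_interval hab (fun r hr => by rw [z1 r hr, mul_zero])
    (fun r hr => by rw [z2 r hr, mul_zero])
    ((intervalIntegrable_of_locallyIntegrableOn hu ha (ha.trans hab)).mul_continuousOn
      h.1.continuous.continuousOn)

theorem IsTest.setIntegral {ψ u : ℝ → ℝ} (h : IsTest ψ) :
    ∫ r in Ioi (0:ℝ), u r * ψ r = ∫ r, u r * ψ r := by
  obtain ⟨a, b, ha, hab, z1, z2, -, -⟩ := h.zero_off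
  rw [← integral_indicator measurableSet_Ioi]
  congr 1; ext x
  by_cases hx : x ∈ Ioi (0:ℝ)
  · simp [hx]
  · rw [indicator_of_notMem hx, z1 x (by simp at hx; linarith), mul_zero]

theorem ae_eq_of_forall_isTest {u v : ℝ → ℝ} (hu : LocallyIntegrableOn u (Ioi 0))
    (hv : LocallyIntegrableOn v (Ioi 0))
    (h : ∀ ψ, IsTest ψ → ∫ r in Ioi (0:ℝ), u r * ψ r = ∫ r in Ioi (0:ℝ), v r * ψ r) :
    ∀ᵐ r, 0 < r → u r = v r := by
  have := isOpen_Ioi.ae_eq_zero_of_integral_contDiff_smul_eq_zero (hu.sub hv) (fun g hg1 hg2 hg3 => by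
    have hg : IsTest g := ⟨hg1, hg2, hg3⟩
    have h1 := h g hg
    rw [hg.setIntegral, hg.setIntegral] at h1
    rw [← sub_eq_zero, ← integral_sub (hg.integrable_mul hu) (hg.integrable_mul hv)] at h1
    rw [← h1]; congr 1; ext r; simp only [Pi.sub_apply, smul_eq_mul]; ring)
  filter_upwards [this] with r hr hr0
  have := hr hr0
  simp only [Pi.sub_apply] at this; linarith

/-- The du Bois-Reymond lemma. With `U` a primitive of `w`, the difference `u - U` annihilates
derivatives of test functions, hence all test functions of mean zero. Subtracting the multiple `(∫
ψ) ρ` of a fixed bump of mass one from `ψ` shows that `u - U` acts on `ψ` as the constant `C`. -/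
theorem HasWeakDeriv.exists_isPrim {u w : ℝ → ℝ} (h : HasWeakDeriv u w) :
    ∃ v, IsPrim v w ∧ ∀ᵐ r, 0 < r → u r = v r := by
  have hU := IsPrim.of_locallyIntegrableOn h.2.1 0 1 one_pos
  set U : ℝ → ℝ := fun r => 0 + ∫ t in (1:ℝ)..r, w t with hUdef
  obtain ⟨ρ, hρ, hρ1⟩ := exists_isTest_integral_one
  have hUl := locallyIntegrableOn_of_continuousOn hU.continuousOn
  set C : ℝ := ∫ r, (u r - U r) * ρ r with hC
  have hd : LocallyIntegrableOn (fun r => u r - U r) (Ioi 0) := h.1.sub hUl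
  refine ⟨fun r => U r + C, ?_, ?_⟩
  · have := hU.add (IsPrim.const C); simpa using this
  · refine ae_eq_of_forall_isTest h.1 (hUl.add (locallyIntegrableOn_of_continuousOn continuousOn_const))
      fun ψ hψ => ?_
    have ht : IsTest (fun r => ψ r - (∫ t, ψ t) * ρ r) := by
      refine ⟨hψ.1.sub (contDiff_const.mul hρ.1), hψ.2.1.sub (hρ.2.1.mul_left), ?_⟩
      refine (tsupport_sub _ _).trans (union_subset hψ.2.2 ?_)
      exact (tsupport_mul_subset_right).trans hρ.2.2
    obtain ⟨φ, hφ, hφ'⟩ := ht.primitive (by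
      rw [integral_sub (hψ.1.continuous.integrable_of_hasCompactSupport hψ.2.1)
        ((hρ.1.continuous.integrable_of_hasCompactSupport hρ.2.1).const_mul _),
        integral_const_mul, hρ1]; ring)
    have e1 := h.2.2 φ hφ
    have e2 := hU.hasWeakDeriv.2.2 φ hφ
    simp only [hφ'] at e1 e2
    rw [← e2, ht.setIntegral, ht.setIntegral, ← sub_eq_zero,
      ← integral_sub (ht.integrable_mul h.1) (ht.integrable_mul hUl)] at e1
    have e3 : ∫ r, (u r - U r) * ψ r = (∫ t, ψ t) * C := by
      rw [hC, ← integral_const_mul, ← sub_eq_zero,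
        ← integral_sub (hψ.integrable_mul hd) ((hρ.integrable_mul hd).const_mul _), ← e1]
      congr 1; ext r; ring
    have hUC : LocallyIntegrableOn (fun r => U r + C) (Ioi 0) :=
      hUl.add (locallyIntegrableOn_of_continuousOn continuousOn_const)
    rw [hψ.setIntegral, hψ.setIntegral, ← sub_eq_zero, ← integral_sub (hψ.integrable_mul h.1)
      (hψ.integrable_mul hUC)]
    have e4 : ∫ r, (u r * ψ r - (U r + C) * ψ r) = (∫ r, (u r - U r) * ψ r) - C * ∫ r, ψ r := by
      rw [← integral_const_mul, ← integral_sub (hψ.integrable_mul hd)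
        ((hψ.1.continuous.integrable_of_hasCompactSupport hψ.2.1).const_mul _)]
      congr 1; ext r; ring
    exact e4.trans (by rw [e3]; ring)

theorem HasWeakDeriv.unique {u₁ u₂ w₁ w₂ : ℝ → ℝ} (h₁ : HasWeakDeriv u₁ w₁) (h₂ : HasWeakDeriv u₂ w₂)
    (h : ∀ᵐ r, 0 < r → u₁ r = u₂ r) : ∀ᵐ r, 0 < r → w₁ r = w₂ r := by
  refine ae_eq_of_forall_isTest h₁.2.1 h₂.2.1 fun ψ hψ => ?_
  have e1 := h₁.2.2 ψ hψ
  have e2 := h₂.2.2 ψ hψ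
  have : ∫ r in Ioi (0:ℝ), u₁ r * deriv ψ r = ∫ r in Ioi (0:ℝ), u₂ r * deriv ψ r := by
    refine setIntegral_congr_ae measurableSet_Ioi ?_
    filter_upwards [h] with r hr hr0
    rw [hr hr0]
  linarith

theorem HasWeakDeriv.congr {u₁ u₂ w : ℝ → ℝ} (h₁ : HasWeakDeriv u₁ w)
    (h : ∀ᵐ r, 0 < r → u₁ r = u₂ r) : HasWeakDeriv u₂ w := by
  refine ⟨fun x hx => ?_, h₁.2.1, fun φ hφ => ?_⟩
  · obtain ⟨s, hs, hs'⟩ := h₁.1 x hx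
    refine ⟨s ∩ Ioi 0, inter_mem hs self_mem_nhdsWithin, ?_⟩
    refine (hs'.mono_set inter_subset_left).congr ?_
    have h2 : ∀ᵐ r ∂(volume.restrict (Ioi (0:ℝ))), u₁ r = u₂ r :=
      (ae_restrict_iff' measurableSet_Ioi).2 h
    exact ae_restrict_of_ae_restrict_of_subset inter_subset_right h2
  · rw [← h₁.2.2 φ hφ]
    refine setIntegral_congr_ae measurableSet_Ioi ?_
    filter_upwards [h] with r hr hr0
    rw [hr hr0]

/-- Makes the choice inside `wderiv` harmless: energies may be computed with any explicit weak
derivative. -/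
theorem wderiv_ae_eq {u w : ℝ → ℝ} (h : HasWeakDeriv u w) : ∀ᵐ r, 0 < r → wderiv u r = w r := by
  have hex : ∃ v, HasWeakDeriv u v := ⟨w, h⟩
  rw [wderiv, dif_pos hex]
  exact hex.choose_spec.unique h (by filter_upwards with r _ using rfl)

/-! ### The measure `r dr` -/

theorem measurable_toNNReal : Measurable fun r : ℝ => Real.toNNReal r := measurable_real_toNNReal

theorem ae_radial_iff {P : ℝ → Prop} : (∀ᵐ r ∂radialMeasure, P r) ↔ ∀ᵐ r, 0 < r → P r := by
  rw [radialMeasure, ae_withDensity_iff (by fun_prop), ae_restrict_iff' measurableSet_Ioi]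
  refine ⟨fun h => ?_, fun h => ?_⟩
  · filter_upwards [h] with r hr h0
    exact hr h0 (by simpa using h0)
  · filter_upwards [h] with r hr h0 _ using hr h0

theorem integrable_radial_iff {h : ℝ → ℝ} :
    Integrable h radialMeasure ↔ IntegrableOn (fun r => h r * r) (Ioi 0) := by
  have : radialMeasure = (volume.restrict (Ioi 0)).withDensity
      fun r => ((Real.toNNReal r : NNReal) : ENNReal) := rfl
  rw [this, integrable_withDensity_iff_integrable_smul measurable_toNNReal, IntegrableOn]
  refine integrable_congr ?_
  refine (ae_restrict_iff' measurableSet_Ioi).2 (Eventually.of_forall fun r hr => ?_)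
  have hr : 0 < r := hr
  simp only [NNReal.smul_def, smul_eq_mul, Real.coe_toNNReal r hr.le]; ring

theorem integral_radial (h : ℝ → ℝ) : ∫ r, h r ∂radialMeasure = ∫ r in Ioi (0:ℝ), h r * r := by
  have : radialMeasure = (volume.restrict (Ioi 0)).withDensity
      fun r => ((Real.toNNReal r : NNReal) : ENNReal) := rfl
  rw [this, integral_withDensity_eq_integral_smul measurable_toNNReal]
  refine setIntegral_congr_fun measurableSet_Ioi fun r hr => ?_
  have hr : 0 < r := hr
  simp only [NNReal.smul_def, smul_eq_mul, Real.coe_toNNReal r hr.le]; ring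

theorem radial_ac : radialMeasure ≪ volume.restrict (Ioi 0) := withDensity_absolutelyContinuous _ _

theorem ae_radial_of_forall {P : ℝ → Prop} (h : ∀ r, 0 < r → P r) : ∀ᵐ r ∂radialMeasure, P r :=
  ae_radial_iff.2 (Eventually.of_forall h)

theorem aesm_of_continuousOn {h : ℝ → ℝ} (hc : ContinuousOn h (Ioi 0)) :
    AEStronglyMeasurable h radialMeasure :=
  (hc.aestronglyMeasurable measurableSet_Ioi).mono_ac radial_ac

theorem aesm_of_locallyIntegrableOn {h : ℝ → ℝ} (hc : LocallyIntegrableOn h (Ioi 0)) :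
    AEStronglyMeasurable h radialMeasure :=
  hc.aestronglyMeasurable.mono_ac radial_ac

theorem IsPrim.aesm {u w : ℝ → ℝ} (h : IsPrim u w) : AEStronglyMeasurable u radialMeasure :=
  aesm_of_continuousOn h.continuousOn

theorem IsPrim.aesm_deriv {u w : ℝ → ℝ} (h : IsPrim u w) : AEStronglyMeasurable w radialMeasure :=
  aesm_of_locallyIntegrableOn h.1

theorem integrable_mul_of_sq {μ : Measure ℝ} {a b : ℝ → ℝ} (ha : AEStronglyMeasurable a μ)
    (hb : AEStronglyMeasurable b μ) (ha2 : Integrable (fun r => a r ^ 2) μ)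
    (hb2 : Integrable (fun r => b r ^ 2) μ) : Integrable (fun r => a r * b r) μ :=
  ((memLp_two_iff_integrable_sq ha).2 ha2).integrable_mul ((memLp_two_iff_integrable_sq hb).2 hb2)

/-- A function that is continuous on `(0, ∞)` and vanishes off a compact subset is integrable. -/
theorem integrable_radial_of_compact {h : ℝ → ℝ} {a b : ℝ} (ha : 0 < a)
    (hc : ContinuousOn h (Ioi 0)) (h1 : ∀ r, 0 < r → r < a → h r = 0) (h2 : ∀ r, b < r → h r = 0) :
    Integrable h radialMeasure := by
  rw [integrable_radial_iff]
  have h3 : IntegrableOn (fun r => h r * r) (Icc a b) :=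
    ((hc.mono fun x hx => lt_of_lt_of_le ha hx.1).mul continuousOn_id).integrableOn_Icc
  have h4 : IntegrableOn (fun r => h r * r) (Ioi 0 \ Icc a b) := by
    refine integrableOn_zero.congr_fun (fun x hx => ?_) (measurableSet_Ioi.diff measurableSet_Icc)
    obtain ⟨hx0, hx1⟩ := hx
    by_cases hxa : x < a
    · simp [h1 x hx0 hxa]
    · simp [h2 x (by by_contra hb; exact hx1 ⟨not_lt.1 hxa, not_lt.1 hb⟩)]
  refine (h3.union h4).mono_set fun x hx => ?_
  by_cases hx' : x ∈ Icc a b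
  · exact Or.inl hx'
  · exact Or.inr ⟨hx, hx'⟩

theorem integrableOn_of_radial {h : ℝ → ℝ} (hi : Integrable h radialMeasure) {s : Set ℝ}
    (hs : s ⊆ Ioi 0) : IntegrableOn (fun r => h r * r) s :=
  (integrable_radial_iff.1 hi).mono_set hs

theorem locallyIntegrableOn_of_radial {h : ℝ → ℝ} (hi : Integrable h radialMeasure) :
    LocallyIntegrableOn h (Ioi 0) := by
  have h1 : LocallyIntegrableOn (fun r => h r * r) (Ioi 0) :=
    (integrable_radial_iff.1 hi).locallyIntegrableOn
  have h2 := LocallyIntegrableOn.mul_cont h1 (c := fun r => r⁻¹)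
    (continuousOn_inv₀.mono fun x hx => ne_of_gt hx)
  rw [locallyIntegrableOn_Ioi_iff] at h2 ⊢
  intro a b ha hb
  refine (h2 a b ha hb).congr fun x hx => ?_
  have := uIcc_subset_Ioi ha hb (uIoc_subset_uIcc hx)
  have : x ≠ 0 := ne_of_gt this
  field_simp

theorem integrable_indicator_radial (a b : ℝ) :
    Integrable ((Ioc a b).indicator fun _ => (1:ℝ)) radialMeasure := by
  rw [integrable_radial_iff]
  have h1 : IntegrableOn (fun r : ℝ => r) (Ioc a b) :=
    (continuous_id.integrableOn_Icc).mono_set Ioc_subset_Icc_self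
  have h2 : Integrable ((Ioc a b).indicator fun r : ℝ => r) :=
    (integrable_indicator_iff measurableSet_Ioc).2 h1
  refine h2.integrableOn.congr_fun (fun r _ => ?_) measurableSet_Ioi
  by_cases hr : r ∈ Ioc a b <;> simp [hr]

theorem locallyIntegrableOn_of_sq {h : ℝ → ℝ} (hm : AEStronglyMeasurable h radialMeasure)
    (hi : Integrable (fun r => h r ^ 2) radialMeasure) : LocallyIntegrableOn h (Ioi 0) := by
  rw [locallyIntegrableOn_Ioi_iff]
  intro a b ha hb
  -- On a bounded interval square integrability gives integrability by pairing with the indicator of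
  -- the interval.
  have hI := integrable_indicator_radial (min a b) (max a b)
  have hI2 : Integrable (fun r => ((Ioc (min a b) (max a b)).indicator (fun _ => (1:ℝ)) r) ^ 2)
      radialMeasure := by
    refine hI.congr (Eventually.of_forall fun r => ?_)
    by_cases hr : r ∈ Ioc (min a b) (max a b) <;> simp only [indicator, hr] <;> simp
  have h3 := locallyIntegrableOn_Ioi_iff.1
    (locallyIntegrableOn_of_radial (integrable_mul_of_sq hm hI.1 hi hI2)) a b ha hb
  refine h3.congr fun x hx => ?_
  have hx : x ∈ Ioc (min a b) (max a b) := hx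
  simp only [indicator, hx, if_true, mul_one]

/-! ### Cauchy–Schwarz on intervals -/

/-- Weighted Cauchy–Schwarz: the quadratic polynomial `l ↦ ∫ ρ (w - l / ρ)²` is nonnegative, so its
discriminant is not positive. -/
theorem sq_intervalIntegral_le {w ρ : ℝ → ℝ} {a b : ℝ} (hab : a ≤ b)
    (hρ : ∀ x ∈ Icc a b, 0 < ρ x) (hc : ContinuousOn ρ (Icc a b))
    (hw : IntervalIntegrable w volume a b) (hw2 : IntervalIntegrable (fun x => w x ^ 2 * ρ x) volume a b) :
    (∫ x in a..b, w x) ^ 2 ≤ (∫ x in a..b, w x ^ 2 * ρ x) * ∫ x in a..b, (ρ x)⁻¹ := by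
  have hi : IntervalIntegrable (fun x => (ρ x)⁻¹) volume a b := by
    refine ContinuousOn.intervalIntegrable ?_
    rw [uIcc_of_le hab]
    exact hc.inv₀ fun x hx => (hρ x hx).ne'
  have key : ∀ l : ℝ, 0 ≤ (∫ x in a..b, w x ^ 2 * ρ x) - 2 * l * (∫ x in a..b, w x)
      + l ^ 2 * ∫ x in a..b, (ρ x)⁻¹ := by
    intro l
    rw [← intervalIntegral.integral_const_mul, ← intervalIntegral.integral_const_mul,
      ← intervalIntegral.integral_sub hw2 (hw.const_mul _),
      ← intervalIntegral.integral_add (hw2.sub (hw.const_mul _)) (hi.const_mul _)]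
    refine intervalIntegral.integral_nonneg hab fun x hx => ?_
    have := hρ x hx
    have e : w x ^ 2 * ρ x - 2 * l * w x + l ^ 2 * (ρ x)⁻¹ = ρ x * (w x - l * (ρ x)⁻¹) ^ 2 := by
      field_simp; ring
    rw [e]; positivity
  have h := discrim_le_zero (a := ∫ x in a..b, (ρ x)⁻¹) (b := -2 * ∫ x in a..b, w x)
    (c := ∫ x in a..b, w x ^ 2 * ρ x) (fun l => by have := key l; nlinarith)
  rw [discrim] at h; nlinarith

theorem setIntegral_interval_le_radial {h : ℝ → ℝ} (hi : Integrable h radialMeasure)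
    (h0 : ∀ r, 0 < r → 0 ≤ h r) {a b : ℝ} (ha : 0 ≤ a) (hab : a ≤ b) :
    ∫ r in a..b, h r * r ≤ ∫ r, h r ∂radialMeasure := by
  rw [integral_radial, intervalIntegral.integral_of_le hab]
  refine setIntegral_mono_set (integrable_radial_iff.1 hi) ?_ ?_
  · refine (ae_restrict_iff' measurableSet_Ioi).2 (Eventually.of_forall fun r hr => ?_)
    exact mul_nonneg (h0 r hr) (le_of_lt hr)
  · exact (show Ioc a b ⊆ Ioi 0 from fun x hx => lt_of_le_of_lt ha hx.1).eventuallyLE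

theorem intervalIntegrable_of_radial {h : ℝ → ℝ} (hi : Integrable h radialMeasure) {a b : ℝ}
    (ha : 0 ≤ a) (hab : a ≤ b) : IntervalIntegrable (fun r => h r * r) volume a b :=
  (intervalIntegrable_iff_integrableOn_Ioc_of_le hab).2
    (integrableOn_of_radial hi fun _ hx => lt_of_le_of_lt ha hx.1)

theorem IsPrim.sq_sub_le_log {u w : ℝ → ℝ} (h : IsPrim u w)
    (hw : Integrable (fun r => w r ^ 2) radialMeasure) {a b : ℝ} (ha : 0 < a) (hab : a ≤ b) :
    (u b - u a) ^ 2 ≤ (∫ r, w r ^ 2 ∂radialMeasure) * Real.log (b / a) := by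
  have hb := ha.trans_le hab
  rw [← h.2 a b ha hb]
  refine (sq_intervalIntegral_le (ρ := fun r => r) hab (fun x hx => ha.trans_le hx.1) continuousOn_id
    (h.intervalIntegrable ha hb) (intervalIntegrable_of_radial hw ha.le hab)).trans ?_
  rw [integral_inv_of_pos ha hb]
  exact mul_le_mul_of_nonneg_right
    (setIntegral_interval_le_radial hw (fun r _ => sq_nonneg _) ha.le hab)
    (Real.log_nonneg ((one_le_div ha).2 hab))

theorem IsPrim.sq_sub_le {u w : ℝ → ℝ} (h : IsPrim u w)
    (hw : Integrable (fun r => w r ^ 2) radialMeasure) {a b : ℝ} (ha : 0 < a) (hab : a ≤ b) :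
    (u b - u a) ^ 2 ≤ (∫ r, w r ^ 2 ∂radialMeasure) * ((b - a) / a) := by
  refine (h.sq_sub_le_log hw ha hab).trans ?_
  refine mul_le_mul_of_nonneg_left ?_ (integral_nonneg fun r => sq_nonneg _)
  have := Real.log_le_sub_one_of_pos (div_pos (ha.trans_le hab) ha)
  rwa [sub_div, div_self ha.ne']

/-- The bound for functions whose derivative is square integrable with weight `1 / r`. -/
theorem IsPrim.sq_sub_le_sq {u w : ℝ → ℝ} (h : IsPrim u w)
    (hw : Integrable (fun r => (w r / r) ^ 2) radialMeasure) {a b : ℝ} (ha : 0 < a) (hab : a ≤ b) :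
    (u b - u a) ^ 2 ≤ (∫ r, (w r / r) ^ 2 ∂radialMeasure) * ((b ^ 2 - a ^ 2) / 2) := by
  have hb := ha.trans_le hab
  rw [← h.2 a b ha hb]
  have hpos : ∀ x ∈ Icc a b, 0 < x := fun x hx => ha.trans_le hx.1
  have e : ∀ x ∈ uIcc a b, (w x / x) ^ 2 * x = w x ^ 2 * x⁻¹ := fun x hx => by
    have := hpos x (by rwa [uIcc_of_le hab] at hx)
    field_simp
  have hint := intervalIntegrable_of_radial hw ha.le hab
  refine (sq_intervalIntegral_le (ρ := fun r => r⁻¹) hab (fun x hx => inv_pos.2 (hpos x hx))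
    (continuousOn_id.inv₀ fun x hx => (hpos x hx).ne')
    (h.intervalIntegrable ha hb) (hint.congr fun x hx => e x (uIoc_subset_uIcc hx))).trans ?_
  simp only [inv_inv, integral_id]
  rw [← intervalIntegral.integral_congr e]
  refine mul_le_mul_of_nonneg_right
    (setIntegral_interval_le_radial hw (fun r _ => sq_nonneg _) ha.le hab) ?_
  have : a ^ 2 ≤ b ^ 2 := by nlinarith
  linarith

/-! ### Limits at the end points -/

theorem IsPrim.tendsto_atTop {u w : ℝ → ℝ} (h : IsPrim u w) {a : ℝ} (ha : 0 < a)
    (hw : IntegrableOn w (Ioi a)) : ∃ L, Tendsto u atTop (𝓝 L) := by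
  refine ⟨u a + ∫ r in Ioi a, w r, ?_⟩
  have := (intervalIntegral_tendsto_integral_Ioi a hw tendsto_id).const_add (u a)
  refine this.congr' ?_
  filter_upwards [eventually_gt_atTop 0] with b hb
  exact (h.eq_add ha hb).symm

theorem IsPrim.tendsto_zero {u w : ℝ → ℝ} (h : IsPrim u w)
    (hw : IntegrableOn w (Ioc 0 1)) :
    ∃ L, Tendsto u (𝓝[>] 0) (𝓝 L) := by
  refine ⟨u 1 - ∫ r in (0:ℝ)..1, w r, ?_⟩
  have hi : IntegrableOn w (uIcc 0 1) := by
    rw [uIcc_of_le zero_le_one]; exact (integrableOn_Icc_iff_integrableOn_Ioc).2 hw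
  have hcont := intervalIntegral.continuousOn_primitive_interval_left hi
  have h0 : Tendsto (fun x => ∫ t in x..1, w t) (𝓝[>] 0) (𝓝 (∫ t in (0:ℝ)..1, w t)) := by
    have := (hcont 0 (by simp)).tendsto
    refine this.mono_left ?_
    rw [uIcc_of_le zero_le_one, nhdsWithin_Icc_eq_nhdsGE zero_lt_one]
    exact nhdsWithin_mono _ Ioi_subset_Ici_self
  refine (h0.const_sub (u 1)).congr' ?_
  filter_upwards [self_mem_nhdsWithin] with b hb
  rw [h.2 b 1 hb one_pos]; ring

/-- A nonzero limit would make `1 / r` integrable at the origin. -/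
theorem eq_zero_of_tendsto_of_integrable_div {h : ℝ → ℝ} {L : ℝ} (hL : Tendsto h (𝓝[>] 0) (𝓝 L))
    (hi : IntegrableOn (fun r => h r / r) (Ioc 0 1)) : L = 0 := by
  by_contra hne
  have hpos : 0 < |L| := abs_pos.2 hne
  have h1 : ∀ᶠ r in 𝓝[>] (0:ℝ), |L| / 2 < |h r| :=
    hL.abs.eventually (lt_mem_nhds (by linarith))
  obtain ⟨δ, hδ, hδ'⟩ := (mem_nhdsGT_iff_exists_Ioo_subset (a := (0:ℝ))).1 h1
  have hδ : 0 < δ := hδ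
  set e := min (δ / 2) 1
  have he : 0 < e := lt_min (by linarith) one_pos
  have h2 : IntegrableOn (fun r => h r / r) (Ioc 0 e) :=
    hi.mono_set (Ioc_subset_Ioc_right (min_le_right _ _))
  have h3 : IntegrableOn (fun r : ℝ => r⁻¹) (Ioc 0 e) := by
    refine (h2.norm.const_mul (2 / |L|)).mono' (by fun_prop) ?_
    refine (ae_restrict_iff' measurableSet_Ioc).2 (Eventually.of_forall fun r hr => ?_)
    have hr1 : |L| / 2 < |h r| := hδ' ⟨hr.1, by
      have : e ≤ δ / 2 := min_le_left _ _
      linarith [hr.2]⟩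
    have hr0 := hr.1
    rw [Real.norm_eq_abs, Real.norm_eq_abs, abs_inv, abs_div, abs_of_pos hr0, ← one_div,
      mul_div_assoc', div_le_div_iff_of_pos_right hr0, div_mul_eq_mul_div, le_div_iff₀ hpos]
    linarith
  have h4 : IntervalIntegrable (fun r : ℝ => r⁻¹) volume 0 e :=
    (intervalIntegrable_iff_integrableOn_Ioc_of_le he.le).2 h3
  rw [intervalIntegrable_inv_iff] at h4
  rcases h4 with h4 | h4
  · exact he.ne h4
  · exact h4 left_mem_uIcc

/-- `u`, with derivative `w`, has finite `H`-norm. -/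
structure InH (u w : ℝ → ℝ) : Prop where
  prim : IsPrim u w
  sq : Integrable (fun r => u r ^ 2) radialMeasure
  dsq : Integrable (fun r => w r ^ 2) radialMeasure

/-- The derivative `u² + 2 r u u'` of `r u²` is integrable on `(1, ∞)`, so `r u²` converges and `u²`
tends to zero. -/
theorem InH.tendsto_atTop {u w : ℝ → ℝ} (h : InH u w) : Tendsto u atTop (𝓝 0) := by
  have hp := IsPrim.id.mul (h.prim.mul h.prim)
  have hprod := integrable_mul_of_sq h.prim.aesm_deriv h.prim.aesm h.dsq h.sq
  have i1 : IntegrableOn (fun r => u r ^ 2 * r) (Ioi 1) :=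
    integrableOn_of_radial h.sq (Ioi_subset_Ioi zero_le_one)
  have i2 : IntegrableOn (fun r => (w r * u r) * r) (Ioi 1) :=
    integrableOn_of_radial hprod (Ioi_subset_Ioi zero_le_one)
  have i3 : IntegrableOn (fun r => u r ^ 2) (Ioi 1) := by
    refine i1.mono' ((h.prim.continuousOn.mono (Ioi_subset_Ioi zero_le_one)).pow 2
      |>.aestronglyMeasurable measurableSet_Ioi) ?_
    refine (ae_restrict_iff' measurableSet_Ioi).2 (Eventually.of_forall fun r hr => ?_)
    have hr : 1 < r := hr
    rw [Real.norm_eq_abs, abs_of_nonneg (sq_nonneg _)]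
    nlinarith [sq_nonneg (u r)]
  obtain ⟨L, hL⟩ := hp.tendsto_atTop one_pos (by
    refine (i3.add (i2.const_mul 2)).congr_fun (fun r _ => ?_) measurableSet_Ioi
    simp only [Pi.add_apply]; ring)
  have h2 : Tendsto (fun r => u r ^ 2) atTop (𝓝 0) := by
    have := hL.mul tendsto_inv_atTop_zero
    rw [mul_zero] at this
    refine this.congr' ?_
    filter_upwards [eventually_gt_atTop 0] with r hr
    field_simp
  have h3 := h2.sqrt
  simp only [Real.sqrt_sq_eq_abs, Real.sqrt_zero] at h3
  exact (tendsto_zero_iff_abs_tendsto_zero _).2 h3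

/-- `u`, with derivative `w`, has finite `X`-norm. -/
structure InX (u w : ℝ → ℝ) : Prop extends InH u w where
  divsq : Integrable (fun r => (u r / r) ^ 2) radialMeasure

theorem IsPrim.aesm_div {u w : ℝ → ℝ} (h : IsPrim u w) :
    AEStronglyMeasurable (fun r => u r / r) radialMeasure :=
  aesm_of_continuousOn (h.continuousOn.div continuousOn_id fun _ hx => ne_of_gt hx)

/-- Vanishing at the origin needs no square integrability of `u` itself. -/
theorem IsPrim.tendsto_zero_of_sq {u w : ℝ → ℝ} (h : IsPrim u w)
    (hd : Integrable (fun r => w r ^ 2) radialMeasure)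
    (hq : Integrable (fun r => (u r / r) ^ 2) radialMeasure) : Tendsto u (𝓝[>] 0) (𝓝 0) := by
  have hprod := integrable_mul_of_sq h.aesm_deriv h.aesm_div hd hq
  have i2 : IntegrableOn (fun r => (w r * (u r / r)) * r) (Ioc 0 1) :=
    integrableOn_of_radial hprod fun _ hx => hx.1
  have i1 : IntegrableOn (fun r => (u r / r) ^ 2 * r) (Ioc 0 1) :=
    integrableOn_of_radial hq fun _ hx => hx.1
  -- The derivative `2 u' u = 2 (u' · u / r) r` of `u²` is integrable at `0`, so `u²` has a limit;
  -- integrability of `u² / r` forces this limit to vanish.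
  obtain ⟨L, hL⟩ := (h.mul h).tendsto_zero (by
    have i3 : IntegrableOn (fun r => 2 * ((w r * (u r / r)) * r)) (Ioc 0 1) := i2.const_mul 2
    refine i3.congr_fun (fun r hr => ?_) measurableSet_Ioc
    have := hr.1
    simp only; field_simp; ring)
  have hL0 : L = 0 := eq_zero_of_tendsto_of_integrable_div hL (by
    refine i1.congr_fun (fun r hr => ?_) measurableSet_Ioc
    have := hr.1
    simp only; field_simp)
  subst hL0
  have h3 := hL.sqrt
  simp only [← sq, Real.sqrt_sq_eq_abs, Real.sqrt_zero] at h3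
  exact (tendsto_zero_iff_abs_tendsto_zero _).2 h3

theorem InX.tendsto_zero {u w : ℝ → ℝ} (h : InX u w) : Tendsto u (𝓝[>] 0) (𝓝 0) :=
  h.prim.tendsto_zero_of_sq h.dsq h.divsq

theorem log_inv_sq_le {r : ℝ} (h0 : 0 < r) (h1 : r ≤ 1) : Real.log (1 / r) ^ 2 ≤ 4 / r := by
  have hp : 0 < 1 / r := by positivity
  have h2 : Real.log (1 / r) ≤ 2 * √(1 / r) := by
    have := Real.log_le_sub_one_of_pos (Real.sqrt_pos.2 hp)
    rw [Real.log_sqrt hp.le] at this; linarith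
  have h3 : 0 ≤ Real.log (1 / r) := Real.log_nonneg ((one_le_div h0).2 h1)
  have h4 : Real.log (1 / r) ^ 2 ≤ (2 * √(1 / r)) ^ 2 := by gcongr
  rw [mul_pow, Real.sq_sqrt hp.le] at h4
  calc _ ≤ _ := h4
    _ = 4 / r := by ring

/-- Elements of `H` may be unbounded at the origin, but only like the square root of a logarithm.
This crude power bound suffices both for `u² ∈ L²(r dr)` and for bounding `r m³` in the equation of
`m`. -/
theorem IsPrim.pow_four_le {u w : ℝ → ℝ} (h : IsPrim u w)
    (hd : Integrable (fun r => w r ^ 2) radialMeasure) :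
    ∃ C, 0 ≤ C ∧ ∀ r, 0 < r → r ≤ 1 → u r ^ 4 ≤ C / r := by
  set A := ∫ r, w r ^ 2 ∂radialMeasure
  refine ⟨8 * u 1 ^ 4 + 32 * A ^ 2, by positivity, fun r h0 h1 => ?_⟩
  have hA := h.sq_sub_le_log hd h0 h1
  have h2 : ((u 1 - u r) ^ 2) ^ 2 ≤ (A * Real.log (1 / r)) ^ 2 := by gcongr
  rw [mul_pow] at h2
  have h3 : A ^ 2 * Real.log (1 / r) ^ 2 ≤ A ^ 2 * (4 / r) := by
    gcongr; exact log_inv_sq_le h0 h1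
  have h4 : u r ^ 4 ≤ 8 * u 1 ^ 4 + 8 * ((u 1 - u r) ^ 2) ^ 2 := by
    have e1 : u r ^ 2 ≤ 2 * u 1 ^ 2 + 2 * (u 1 - u r) ^ 2 := by nlinarith [sq_nonneg (2 * u 1 - u r)]
    have e2 : (u r ^ 2) ^ 2 ≤ (2 * u 1 ^ 2 + 2 * (u 1 - u r) ^ 2) ^ 2 := by gcongr
    nlinarith [sq_nonneg (u 1 ^ 2 - (u 1 - u r) ^ 2)]
  have h5 : 8 * u 1 ^ 4 ≤ 8 * u 1 ^ 4 / r := by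
    rw [le_div_iff₀ h0]; nlinarith [show 0 ≤ u 1 ^ 4 by positivity]
  calc _ ≤ 8 * u 1 ^ 4 / r + 8 * (A ^ 2 * (4 / r)) := by linarith
    _ = _ := by ring

/-! ### The spaces `H` and `X` -/

theorem memLp_two_radial {u : ℝ → ℝ} (hu : AEStronglyMeasurable u radialMeasure) :
    MemLp u 2 radialMeasure ↔ Integrable (fun r => u r ^ 2) radialMeasure :=
  memLp_two_iff_integrable_sq hu

theorem InH.mem {u w : ℝ → ℝ} (h : InH u w) : u ∈ radialH :=
  ⟨(memLp_two_radial h.prim.aesm).2 h.sq, w, h.prim.hasWeakDeriv,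
    (memLp_two_radial h.prim.aesm_deriv).2 h.dsq⟩

theorem InX.mem {u w : ℝ → ℝ} (h : InX u w) : u ∈ radialX :=
  ⟨h.toInH.mem, (memLp_two_radial h.prim.aesm_div).2 h.divsq⟩

theorem exists_inH {u : ℝ → ℝ} (h : u ∈ radialH) :
    ∃ v w, InH v w ∧ HasWeakDeriv u w ∧ ∀ᵐ r, 0 < r → u r = v r := by
  obtain ⟨h1, w, h2, h3⟩ := h
  obtain ⟨v, hv, hvu⟩ := h2.exists_isPrim
  have hae : u =ᵐ[radialMeasure] v := ae_radial_iff.2 hvu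
  exact ⟨v, w, ⟨hv, ((memLp_congr_ae hae).1 h1).integrable_sq, h3.integrable_sq⟩, h2, hvu⟩

theorem exists_inX {u : ℝ → ℝ} (h : u ∈ radialX) :
    ∃ v w, InX v w ∧ HasWeakDeriv u w ∧ ∀ᵐ r, 0 < r → u r = v r := by
  obtain ⟨v, w, h1, h2, h3⟩ := exists_inH h.1
  refine ⟨v, w, ⟨h1, ?_⟩, h2, h3⟩
  refine h.2.integrable_sq.congr ?_
  filter_upwards [ae_radial_iff.2 h3] with r hr
  rw [hr]

/-! ### Square integrable functions for `r dr` -/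

theorem InH.memLp {u w : ℝ → ℝ} (h : InH u w) : MemLp u 2 radialMeasure :=
  (memLp_two_radial h.prim.aesm).2 h.sq

theorem InH.memLp_deriv {u w : ℝ → ℝ} (h : InH u w) : MemLp w 2 radialMeasure :=
  (memLp_two_radial h.prim.aesm_deriv).2 h.dsq

theorem InX.memLp_div {u w : ℝ → ℝ} (h : InX u w) : MemLp (fun r => u r / r) 2 radialMeasure :=
  (memLp_two_radial h.prim.aesm_div).2 h.divsq

theorem memLp_mul_of_bound {a b : ℝ → ℝ} {C : ℝ} (ha : ContinuousOn a (Ioi 0))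
    (hC : ∀ r, 0 < r → |a r| ≤ C) (hb : MemLp b 2 radialMeasure) :
    MemLp (fun r => a r * b r) 2 radialMeasure := by
  refine (hb.const_mul C).of_le ((aesm_of_continuousOn ha).mul hb.1) ?_
  refine ae_radial_of_forall fun r hr => ?_
  rw [norm_mul, norm_mul]
  exact mul_le_mul_of_nonneg_right ((hC r hr).trans (le_abs_self C)) (norm_nonneg _)

theorem memLp_of_compact {h : ℝ → ℝ} {a b : ℝ} (ha : 0 < a)
    (hc : ContinuousOn h (Ioi 0)) (h1 : ∀ r, 0 < r → r < a → h r = 0) (h2 : ∀ r, b < r → h r = 0) :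
    MemLp h 2 radialMeasure := by
  refine (memLp_two_radial (aesm_of_continuousOn hc)).2 ?_
  exact integrable_radial_of_compact (b := b) ha (hc.pow 2) (fun r h0 hr => by rw [h1 r h0 hr]; simp)
    (fun r hr => by rw [h2 r hr]; simp)

theorem exists_bound_of_tendsto {f : ℝ → ℝ} {a b : ℝ} (hc : ContinuousOn f (Ioi 0))
    (h0 : Tendsto f (𝓝[>] 0) (𝓝 a)) (h1 : Tendsto f atTop (𝓝 b)) :
    ∃ C, ∀ r, 0 < r → |f r| ≤ C := by
  have e0 : ∀ᶠ r in 𝓝[>] (0:ℝ), |f r| < |a| + 1 := h0.abs.eventually (gt_mem_nhds (by linarith))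
  have e1 : ∀ᶠ r in atTop, |f r| < |b| + 1 := h1.abs.eventually (gt_mem_nhds (by linarith))
  obtain ⟨δ, hδ, hδ'⟩ := (mem_nhdsGT_iff_exists_Ioo_subset (a := (0:ℝ))).1 e0
  have hδ : 0 < δ := hδ
  obtain ⟨R, hR⟩ := eventually_atTop.1 e1
  obtain ⟨C, hC⟩ := (isCompact_Icc (a := δ) (b := R)).exists_bound_of_continuousOn
    (hc.mono fun x hx => lt_of_lt_of_le hδ hx.1)
  refine ⟨max C (max (|a| + 1) (|b| + 1)), fun r hr => ?_⟩
  rcases lt_or_ge r δ with h | h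
  · exact le_max_of_le_right (le_max_of_le_left (le_of_lt (hδ' ⟨hr, h⟩)))
  · rcases le_or_gt R r with h' | h'
    · exact le_max_of_le_right (le_max_of_le_right (hR r h').le)
    · exact le_max_of_le_left (hC r ⟨h, h'.le⟩)

theorem integrableOn_rpow_neg_three : IntegrableOn (fun r : ℝ => r⁻¹ ^ 3) (Ioi 1) := by
  have := integrableOn_Ioi_rpow_of_lt (a := -3) (by norm_num) (c := 1) one_pos
  refine this.congr_fun (fun r hr => ?_) measurableSet_Ioi
  have hr : 1 < r := hr
  have : 0 < r := by linarith
  simp only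
  rw [Real.rpow_neg this.le, inv_pow]; norm_cast

/-- `r⁻⁴` is integrable at infinity for `r dr`. -/
theorem integrable_inv_four (K : ℝ) :
    Integrable ((Ioi (1:ℝ)).indicator fun r => K / r ^ 4) radialMeasure := by
  rw [integrable_radial_iff]
  have h2 : Integrable ((Ioi (1:ℝ)).indicator fun r : ℝ => K * r⁻¹ ^ 3) :=
    (integrable_indicator_iff measurableSet_Ioi).2 (integrableOn_rpow_neg_three.const_mul K)
  refine h2.integrableOn.congr_fun (fun r hr => ?_) measurableSet_Ioi
  have hr : 0 < r := hr
  by_cases hr1 : r ∈ Ioi (1:ℝ)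
  · simp only [indicator_of_mem hr1]; field_simp
  · simp [indicator_of_notMem hr1]

theorem integrable_indicator_inv (C : ℝ) :
    Integrable ((Ioc (0:ℝ) 1).indicator fun r => C / r) radialMeasure := by
  rw [integrable_radial_iff]
  have h2 : Integrable ((Ioc (0:ℝ) 1).indicator fun _ : ℝ => C) :=
    (integrable_indicator_iff measurableSet_Ioc).2 (integrableOn_const (by simp))
  refine h2.integrableOn.congr_fun (fun r hr => ?_) measurableSet_Ioi
  have hr : 0 < r := hr
  by_cases hr1 : r ∈ Ioc (0:ℝ) 1
  · simp only [indicator_of_mem hr1]; field_simp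
  · simp [indicator_of_notMem hr1]

theorem IsPrim.exists_bound_Ici {u w : ℝ → ℝ} (h : IsPrim u w) {L : ℝ}
    (hL : Tendsto u atTop (𝓝 L)) {a : ℝ} (ha : 0 < a) : ∃ C, ∀ r, a ≤ r → |u r| ≤ C := by
  have e1 : ∀ᶠ r in atTop, |u r| < |L| + 1 := hL.abs.eventually (gt_mem_nhds (by linarith))
  obtain ⟨R, hR⟩ := eventually_atTop.1 e1
  obtain ⟨C, hC⟩ := (isCompact_Icc (a := a) (b := R)).exists_bound_of_continuousOn
    (h.continuousOn.mono fun x hx => lt_of_lt_of_le ha hx.1)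
  refine ⟨max C (|L| + 1), fun r hr => ?_⟩
  rcases le_or_gt R r with h' | h'
  · exact le_max_of_le_right (hR r h').le
  · exact le_max_of_le_left (hC r ⟨hr, h'.le⟩)

theorem InH.memLp_sq {u w : ℝ → ℝ} (h : InH u w) : MemLp (fun r => u r ^ 2) 2 radialMeasure := by
  have hm : AEStronglyMeasurable (fun r => u r ^ 2) radialMeasure := h.prim.aesm.pow 2
  refine (memLp_two_radial hm).2 ?_
  obtain ⟨C, hC0, hC⟩ := h.prim.pow_four_le h.dsq
  obtain ⟨D, hD⟩ := h.prim.exists_bound_Ici h.tendsto_atTop one_pos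
  refine ((h.sq.const_mul (D ^ 2)).add (integrable_indicator_inv C)).mono' (hm.pow 2) ?_
  refine ae_radial_of_forall fun r hr => ?_
  rw [Real.norm_eq_abs, abs_of_nonneg (by positivity), Pi.add_apply]
  by_cases hr1 : r ∈ Ioc (0:ℝ) 1
  · rw [indicator_of_mem hr1]
    have := hC r hr1.1 hr1.2
    have : 0 ≤ D ^ 2 * u r ^ 2 := by positivity
    calc _ = u r ^ 4 := by ring
      _ ≤ _ := by linarith
  · rw [indicator_of_notMem hr1, add_zero]
    have h1 : 1 ≤ r := by by_contra h'; exact hr1 ⟨hr, by linarith⟩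
    have h2 : u r ^ 2 ≤ D ^ 2 := sq_le_sq.2 ((hD r h1).trans (le_abs_self D))
    rw [_root_.sq (u r ^ 2)]
    exact mul_le_mul_of_nonneg_right h2 (sq_nonneg _)

theorem InX.exists_bound {u w : ℝ → ℝ} (h : InX u w) : ∃ C, ∀ r, 0 < r → |u r| ≤ C :=
  exists_bound_of_tendsto h.prim.continuousOn h.tendsto_zero h.tendsto_atTop

/-! ### Linear structure of the spaces -/

namespace InH

variable {u v w z : ℝ → ℝ}

theorem add (h : InH u w) (k : InH v z) : InH (fun r => u r + v r) (fun r => w r + z r) :=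
  ⟨h.prim.add k.prim, (h.memLp.add k.memLp).integrable_sq,
    (h.memLp_deriv.add k.memLp_deriv).integrable_sq⟩

theorem const_mul (h : InH u w) (t : ℝ) : InH (fun r => t * u r) (fun r => t * w r) :=
  ⟨h.prim.const_mul t, (h.memLp.const_mul t).integrable_sq, (h.memLp_deriv.const_mul t).integrable_sq⟩

end InH

namespace InX

variable {u v w z : ℝ → ℝ}

theorem add (h : InX u w) (k : InX v z) : InX (fun r => u r + v r) (fun r => w r + z r) :=
  ⟨h.toInH.add k.toInH, by
    have := (h.memLp_div.add k.memLp_div).integrable_sq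
    simpa only [Pi.add_apply, ← add_div] using this⟩

theorem const_mul (h : InX u w) (t : ℝ) : InX (fun r => t * u r) (fun r => t * w r) :=
  ⟨h.toInH.const_mul t, by
    have := (h.memLp_div.const_mul t).integrable_sq
    simpa only [mul_div_assoc] using this⟩

end InX

theorem InH.zero : InH (fun _ => 0) (fun _ => 0) :=
  ⟨IsPrim.const 0, by simp, by simp⟩

theorem InX.zero : InX (fun _ => 0) (fun _ => 0) := ⟨InH.zero, by simp⟩

theorem IsTest.inX {φ : ℝ → ℝ} (h : IsTest φ) : InX φ (deriv φ) := by
  obtain ⟨a, b, ha, hab, z1, z2, z3, z4⟩ := h.zero_off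
  have hc := h.1.continuous.continuousOn (s := Ioi 0)
  refine ⟨⟨h.isPrim, ?_, ?_⟩, ?_⟩
  · exact (memLp_of_compact (b := b) ha hc (fun r _ hr => z1 r hr.le)
      (fun r hr => z2 r hr.le)).integrable_sq
  · exact (memLp_of_compact (b := b) ha (h.1.continuous_deriv (by simp)).continuousOn
      (fun r _ hr => z3 r hr.le) (fun r hr => z4 r hr.le)).integrable_sq
  · exact (memLp_of_compact (b := b) ha (hc.div continuousOn_id fun _ hx => ne_of_gt hx)
      (fun r _ hr => by simp [z1 r hr.le])
      (fun r hr => by simp [z2 r hr.le])).integrable_sq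

/-! ### The cut-off -/

namespace IsCutoff

variable {η : ℝ → ℝ} (h : IsCutoff η)
include h

theorem contDiffOn_Ioi : ContDiffOn ℝ ∞ η (Ioi 0) := h.smooth.mono Ioi_subset_Ici_self

theorem hasDerivAt {r : ℝ} (hr : 0 < r) : HasDerivAt η (deriv η r) r :=
  ((h.contDiffOn_Ioi.differentiableOn (by simp)).differentiableAt (Ioi_mem_nhds hr)).hasDerivAt

theorem continuousOn_deriv : ContinuousOn (deriv η) (Ioi 0) :=
  h.contDiffOn_Ioi.continuousOn_deriv_of_isOpen isOpen_Ioi (by simp)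

theorem isPrim : IsPrim η (deriv η) :=
  IsPrim.of_hasDerivAt (fun _ hr => h.hasDerivAt hr) h.continuousOn_deriv

theorem deriv_eq_zero {r : ℝ} (h0 : 0 < r) (hr : r < 1 ∨ 2 < r) : deriv η r = 0 := by
  rcases hr with hr | hr
  · have : η =ᶠ[𝓝 r] fun _ => 0 := by
      filter_upwards [Ioo_mem_nhds h0 hr] with x hx using h.eq_zero x ⟨hx.1.le, hx.2.le⟩
    rw [this.deriv_eq]; simp
  · have : η =ᶠ[𝓝 r] fun _ => 1 := by
      filter_upwards [Ioi_mem_nhds hr] with x hx using h.eq_one x (mem_Ici.2 (le_of_lt hx))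
    rw [this.deriv_eq]; simp

theorem abs_le {r : ℝ} (hr : 0 < r) : |η r| ≤ 1 := by
  have := h.mem_Icc r hr.le
  rw [_root_.abs_le]; constructor <;> linarith [this.1, this.2]

theorem memLp_deriv : MemLp (deriv η) 2 radialMeasure :=
  memLp_of_compact one_pos h.continuousOn_deriv (fun _ h0 hr => h.deriv_eq_zero h0 (Or.inl hr))
    (fun _ hr => h.deriv_eq_zero (by linarith) (Or.inr hr))

theorem tendsto_atTop : Tendsto η atTop (𝓝 1) :=
  tendsto_const_nhds.congr' (by
    filter_upwards [eventually_ge_atTop 2] with r hr using (h.eq_one r hr).symm)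

theorem tendsto_zero : Tendsto η (𝓝[>] 0) (𝓝 0) :=
  tendsto_const_nhds.congr' (by
    filter_upwards [Ioo_mem_nhdsGT one_pos] with r hr using (h.eq_zero r ⟨hr.1.le, hr.2.le⟩).symm)

theorem memLp_one_sub_sq : MemLp (fun r => 1 - η r ^ 2) 2 radialMeasure := by
  have hc : ContinuousOn (fun r => 1 - η r ^ 2) (Ioi 0) :=
    continuousOn_const.sub (h.isPrim.continuousOn.pow 2)
  refine (memLp_two_radial (aesm_of_continuousOn hc)).2 ?_
  refine (integrable_indicator_radial 0 2).mono' ((aesm_of_continuousOn hc).pow 2) ?_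
  refine ae_radial_of_forall fun r hr => ?_
  rw [Real.norm_eq_abs, abs_of_nonneg (sq_nonneg _)]
  by_cases h2 : r ∈ Ioc (0:ℝ) 2
  · rw [indicator_of_mem h2]
    have := h.mem_Icc r hr.le
    have h3 : 0 ≤ 1 - η r ^ 2 := by nlinarith [this.1, this.2]
    nlinarith [sq_nonneg (η r)]
  · rw [indicator_of_notMem h2, h.eq_one r (by by_contra h'; exact h2 ⟨hr, le_of_lt (not_le.1 h')⟩)]
    simp

end IsCutoff

theorem exists_isCutoff : ∃ η : ℝ → ℝ, IsCutoff η :=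
  ⟨fun r => Real.smoothTransition (r - 1),
    (Real.smoothTransition.contDiff.comp (contDiff_id.sub contDiff_const)).contDiffOn,
    fun r hr => Real.smoothTransition.zero_of_nonpos (by linarith [hr.2]),
    fun r hr => Real.smoothTransition.one_of_one_le (by
      have : 2 ≤ r := hr
      linarith),
    fun r _ => ⟨Real.smoothTransition.nonneg _, Real.smoothTransition.le_one _⟩⟩

/-! ### Energy densities with explicit derivatives -/

/-- The density of `𝓔_{κ,g}` with explicit derivatives. -/
noncomputable def edens (κ g : ℝ) (d : ℤ) (f f' S S' m m' : ℝ → ℝ) (r : ℝ) : ℝ :=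
  f' r ^ 2 + (S' r / r) ^ 2 + m' r ^ 2 + κ ^ 2 * g * m r ^ 2
    + (d - S r) ^ 2 * f r ^ 2 / r ^ 2 + κ ^ 2 / 2 * (1 - f r ^ 2 - m r ^ 2) ^ 2

/-- The density of `𝓔_{∞,g}` with explicit derivatives. -/
noncomputable def edensInf (g : ℝ) (d : ℤ) (F f f' m m' : ℝ → ℝ) (r : ℝ) : ℝ :=
  f' r ^ 2 + m' r ^ 2 + g * m r ^ 2
    + (d : ℝ) ^ 2 / r ^ 2 * (f r ^ 2 - F r ^ 2) + 1 / 2 * (1 - f r ^ 2 - m r ^ 2) ^ 2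

theorem density_ae_eq {κ g : ℝ} {d : ℤ} {f S m f₁ S₁ m₁ f' S' m' : ℝ → ℝ} (hf : IsPrim f₁ f')
    (hS : IsPrim S₁ S') (hm : IsPrim m₁ m') (ef : ∀ᵐ r, 0 < r → f r = f₁ r)
    (eS : ∀ᵐ r, 0 < r → S r = S₁ r) (em : ∀ᵐ r, 0 < r → m r = m₁ r) :
    density κ g d f S m =ᵐ[radialMeasure] edens κ g d f₁ f' S₁ S' m₁ m' := by
  have df := wderiv_ae_eq (hf.hasWeakDeriv.congr (u₂ := f) (by
    filter_upwards [ef] with r hr h0 using (hr h0).symm))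
  have dS := wderiv_ae_eq (hS.hasWeakDeriv.congr (u₂ := S) (by
    filter_upwards [eS] with r hr h0 using (hr h0).symm))
  have dm := wderiv_ae_eq (hm.hasWeakDeriv.congr (u₂ := m) (by
    filter_upwards [em] with r hr h0 using (hr h0).symm))
  refine ae_radial_iff.2 ?_
  filter_upwards [ef, eS, em, df, dS, dm] with r h1 h2 h3 h4 h5 h6 h0
  rw [density, edens, h1 h0, h2 h0, h3 h0, h4 h0, h5 h0, h6 h0]

theorem densityInf_ae_eq {g : ℝ} {d : ℤ} {F f m f₁ m₁ f' m' : ℝ → ℝ} (hf : IsPrim f₁ f')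
    (hm : IsPrim m₁ m') (ef : ∀ᵐ r, 0 < r → f r = f₁ r) (em : ∀ᵐ r, 0 < r → m r = m₁ r) :
    densityInf g d F f m =ᵐ[radialMeasure] edensInf g d F f₁ f' m₁ m' := by
  have df := wderiv_ae_eq (hf.hasWeakDeriv.congr (u₂ := f) (by
    filter_upwards [ef] with r hr h0 using (hr h0).symm))
  have dm := wderiv_ae_eq (hm.hasWeakDeriv.congr (u₂ := m) (by
    filter_upwards [em] with r hr h0 using (hr h0).symm))
  refine ae_radial_iff.2 ?_
  filter_upwards [ef, em, df, dm] with r h1 h3 h4 h6 h0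
  rw [densityInf, edensInf, h1 h0, h3 h0, h4 h0, h6 h0]

/-! ### The affine classes -/

/-- `f` is `η` plus an element of `X`. -/
def AdmF (η f f' : ℝ → ℝ) : Prop := InX (fun r => f r - η r) (fun r => f' r - deriv η r)

/-- `S` is `d η + r v` with `v` an element of `X`. -/
def AdmS (d : ℤ) (η S S' : ℝ → ℝ) : Prop :=
  InX (fun r => (S r - d * η r) / r) (fun r => (S' r - d * deriv η r) / r - (S r - d * η r) / r ^ 2)

/-! ### Square integrability of the terms of the densities on the affine classes -/

section

variable {η f f' S S' m m' : ℝ → ℝ} {d : ℤ} (hη : IsCutoff η)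
include hη

theorem AdmF.prim (hf : AdmF η f f') : IsPrim f f' := by
  have := InH.prim (InX.toInH hf) |>.add hη.isPrim
  simpa using this

theorem AdmF.memLp_deriv (hf : AdmF η f f') : MemLp f' 2 radialMeasure := by
  have := (InX.toInH hf).memLp_deriv.add hη.memLp_deriv
  refine (memLp_congr_ae (Eventually.of_forall fun r => ?_)).1 this
  simp

theorem AdmF.tendsto_atTop (hf : AdmF η f f') : Tendsto f atTop (𝓝 1) := by
  have := (InX.toInH hf).tendsto_atTop.add hη.tendsto_atTop
  simpa using this

theorem AdmF.tendsto_zero (hf : AdmF η f f') : Tendsto f (𝓝[>] 0) (𝓝 0) := by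
  have := (InX.tendsto_zero hf).add hη.tendsto_zero
  simpa using this

theorem AdmF.exists_bound (hf : AdmF η f f') : ∃ C, ∀ r, 0 < r → |f r| ≤ C :=
  exists_bound_of_tendsto (hf.prim hη).continuousOn (hf.tendsto_zero hη) (hf.tendsto_atTop hη)

theorem AdmF.memLp_one_sub (hf : AdmF η f f') (hm : InH m m') :
    MemLp (fun r => 1 - f r ^ 2 - m r ^ 2) 2 radialMeasure := by
  obtain ⟨C, hC⟩ := InX.exists_bound hf
  have h1 := memLp_mul_of_bound (InX.toInH hf).prim.continuousOn hC (InX.toInH hf).memLp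
  have h2 := memLp_mul_of_bound hη.isPrim.continuousOn (fun r hr => hη.abs_le hr) (InX.toInH hf).memLp
  -- With `u = f - η` this is `1 - f² - m² = (1 - η²) - 2ηu - u² - m²`.
  have := ((hη.memLp_one_sub_sq.sub (h2.const_mul 2)).sub h1).sub hm.memLp_sq
  refine (memLp_congr_ae (Eventually.of_forall fun r => ?_)).1 this
  simp only [Pi.sub_apply]; ring

theorem AdmS.prim (hS : AdmS d η S S') : IsPrim S S' := by
  have h1 := (IsPrim.id.mul (InX.toInH hS).prim).add (hη.isPrim.const_mul d)
  refine (h1.congr_deriv (Eventually.of_forall fun r hr => ?_)).congr_fun fun r hr => ?_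
  · field_simp; ring
  · field_simp; ring

theorem AdmS.memLp_deriv (hS : AdmS d η S S') : MemLp (fun r => S' r / r) 2 radialMeasure := by
  have h3 : MemLp (fun r => deriv η r / r) 2 radialMeasure := by
    refine memLp_of_compact one_pos (b := 2) (hη.continuousOn_deriv.div continuousOn_id
      fun x hx => ne_of_gt hx) (fun r h0 hr => ?_) (fun r hr => ?_)
    · rw [hη.deriv_eq_zero h0 (Or.inl hr), zero_div]
    · rw [hη.deriv_eq_zero (by linarith) (Or.inr hr), zero_div]
  have := ((InX.toInH hS).memLp_deriv.add (InX.memLp_div hS)).add (h3.const_mul d)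
  refine (memLp_congr_ae (ae_radial_of_forall fun r hr => ?_)).1 this
  simp only [Pi.add_apply]; field_simp; ring

theorem AdmS.tendsto_zero (hS : AdmS d η S S') : Tendsto S (𝓝[>] 0) (𝓝 0) := by
  have h0 : Tendsto (fun r : ℝ => r) (𝓝[>] 0) (𝓝 0) := tendsto_nhdsWithin_of_tendsto_nhds tendsto_id
  have := (h0.mul (InX.tendsto_zero hS)).add (hη.tendsto_zero.const_mul (d:ℝ))
  simp only [mul_zero, add_zero] at this
  refine this.congr' ?_
  filter_upwards [self_mem_nhdsWithin] with r hr
  have : r ≠ 0 := ne_of_gt hr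
  field_simp; ring

theorem AdmS.memLp_mul (hS : AdmS d η S S') (hf : AdmF η f f') :
    MemLp (fun r => (d - S r) * f r / r) 2 radialMeasure := by
  obtain ⟨C, hC⟩ := hf.exists_bound hη
  have hηc := hη.isPrim.continuousOn
  have h1 := memLp_mul_of_bound (hf.prim hη).continuousOn hC (InX.toInH hS).memLp
  have h2 : MemLp (fun r => (1 - η r) * η r / r) 2 radialMeasure := by
    refine memLp_of_compact one_pos (b := 2) (((continuousOn_const.sub hηc).mul hηc).div
      continuousOn_id fun x hx => ne_of_gt hx) (fun r h0 hr => ?_) (fun r hr => ?_)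
    · simp [hη.eq_zero r ⟨h0.le, hr.le⟩]
    · simp [hη.eq_one r (le_of_lt hr)]
  have h3 : MemLp (fun r => (1 - η r) * ((f r - η r) / r)) 2 radialMeasure := by
    refine memLp_mul_of_bound (C := 1) (continuousOn_const.sub hηc) (fun r hr => ?_) (InX.memLp_div hf)
    have := hη.mem_Icc r hr.le
    rw [abs_le]; constructor <;> linarith [this.1, this.2]
  -- With `v = (S - dη) / r` and `u = f - η` this is `(d - S) f / r = d ((1 - η) η / r + (1 - η) u /
  -- r) - f v`.
  have := ((h2.add h3).const_mul (d:ℝ)).sub h1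
  refine (memLp_congr_ae (ae_radial_of_forall fun r hr => ?_)).1 this
  simp only [Pi.add_apply, Pi.sub_apply]; field_simp; ring

theorem integrable_edens {κ g : ℝ} (hf : AdmF η f f') (hS : AdmS d η S S') (hm : InH m m') :
    Integrable (edens κ g d f f' S S' m m') radialMeasure := by
  have := (((((hf.memLp_deriv hη).integrable_sq.add (hS.memLp_deriv hη).integrable_sq).add
    hm.memLp_deriv.integrable_sq).add (hm.sq.const_mul (κ ^ 2 * g))).add
    (hS.memLp_mul hη hf).integrable_sq).add ((hf.memLp_one_sub hη hm).integrable_sq.const_mul (κ ^ 2 / 2))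
  refine this.congr (ae_radial_of_forall fun r hr => ?_)
  simp only [Pi.add_apply, edens]; ring

/-- Needed for the part of `(f² - η²) / r²` that is linear in `f - η`. -/
theorem IsCutoff.memLp_div_sq : MemLp (fun r => η r / r ^ 2) 2 radialMeasure := by
  have hm : AEStronglyMeasurable (fun r => η r / r ^ 2) radialMeasure :=
    aesm_of_continuousOn (hη.isPrim.continuousOn.div (continuousOn_id.pow 2)
      fun x hx => pow_ne_zero 2 (ne_of_gt hx))
  refine (memLp_two_radial hm).2 ((integrable_inv_four 1).mono' (hm.pow 2) ?_)
  refine ae_radial_of_forall fun r hr => ?_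
  rw [Real.norm_eq_abs, abs_of_nonneg (sq_nonneg _)]
  by_cases h2 : r ∈ Ioi (1:ℝ)
  · rw [indicator_of_mem h2, div_pow, ← pow_mul]
    have := hη.mem_Icc r hr.le
    refine div_le_div_of_nonneg_right ?_ (by positivity)
    nlinarith [this.1, this.2]
  · rw [indicator_of_notMem h2, hη.eq_zero r ⟨hr.le, not_lt.1 h2⟩]; simp

theorem integrable_sq_sub_sq (hf : AdmF η f f') :
    Integrable (fun r => (d:ℝ) ^ 2 / r ^ 2 * (f r ^ 2 - η r ^ 2)) radialMeasure := by
  have h1 := (hη.memLp_div_sq.integrable_mul (InX.toInH hf).memLp).const_mul 2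
  have := (h1.add (InX.memLp_div hf).integrable_sq).const_mul ((d:ℝ) ^ 2)
  refine this.congr (ae_radial_of_forall fun r hr => ?_)
  simp only [Pi.add_apply, Pi.mul_apply]; field_simp; ring

theorem integrable_edensInf {g : ℝ} (hf : AdmF η f f') (hm : InH m m') :
    Integrable (edensInf g d η f f' m m') radialMeasure := by
  have := ((((hf.memLp_deriv hη).integrable_sq.add
    hm.memLp_deriv.integrable_sq).add (hm.sq.const_mul g)).add
    (integrable_sq_sub_sq (d := d) hη hf)).add ((hf.memLp_one_sub hη hm).integrable_sq.const_mul (1 / 2))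
  refine this.congr (ae_radial_of_forall fun r hr => ?_)
  simp only [Pi.add_apply, edensInf]

end

theorem AdmF.self {η : ℝ → ℝ} : AdmF η η (deriv η) := by
  have : InX (fun r => η r - η r) (fun r => deriv η r - deriv η r) := by
    simpa using InX.zero
  exact this

theorem AdmS.self {η : ℝ → ℝ} {d : ℤ} : AdmS d η (fun r => d * η r) (fun r => d * deriv η r) := by
  have : InX (fun r => (d * η r - d * η r) / r)
    (fun r => (d * deriv η r - d * deriv η r) / r - (d * η r - d * η r) / r ^ 2) := by
    simpa using InX.zero
  exact this

theorem AdmF.add {η f f' u w : ℝ → ℝ} (hf : AdmF η f f') (hu : InX u w) :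
    AdmF η (fun r => f r + u r) (fun r => f' r + w r) := by
  have := InX.add hf hu
  unfold AdmF
  convert this using 2 <;> ring

theorem AdmS.add {d : ℤ} {η S S' φ : ℝ → ℝ} (hS : AdmS d η S S') (hφ : IsTest φ) (t : ℝ) :
    AdmS d η (fun r => S r + t * φ r) (fun r => S' r + t * deriv φ r) := by
  have h1 : InX (fun r => φ r / r) (fun r => deriv φ r / r - φ r / r ^ 2) := by
    obtain ⟨a, b, ha, hab, z1, z2, z3, z4⟩ := hφ.zero_off
    have hc := hφ.1.continuous.continuousOn (s := Ioi 0)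
    have hc' := (hφ.1.continuous_deriv (by simp)).continuousOn (s := Ioi 0)
    have hr0 : ∀ x ∈ Ioi (0:ℝ), x ≠ 0 := fun x hx => ne_of_gt hx
    have hr2 : ∀ x ∈ Ioi (0:ℝ), x ^ 2 ≠ 0 := fun x hx => pow_ne_zero 2 (ne_of_gt hx)
    have hcw : ContinuousOn (fun r => deriv φ r / r - φ r / r ^ 2) (Ioi 0) :=
      (hc'.div continuousOn_id hr0).sub (hc.div (continuousOn_id.pow 2) hr2)
    refine ⟨⟨IsPrim.of_hasDerivAt (fun r hr => ?_) hcw, ?_, ?_⟩, ?_⟩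
    · have : HasDerivAt (fun r => φ r / r) ((deriv φ r * r - φ r * 1) / r ^ 2) r :=
        ((hφ.1.differentiable (by simp)) r).hasDerivAt.div (hasDerivAt_id r) hr.ne'
      refine this.congr_deriv ?_
      have hr' := hr.ne'
      field_simp
    · exact (memLp_of_compact (b := b) ha (hc.div continuousOn_id hr0)
        (fun r _ hr => by simp [z1 r hr.le]) (fun r hr => by simp [z2 r hr.le])).integrable_sq
    · exact (memLp_of_compact (b := b) ha hcw (fun r _ hr => by simp [z1 r hr.le, z3 r hr.le])
        (fun r hr => by simp [z2 r hr.le, z4 r hr.le])).integrable_sq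
    · exact (memLp_of_compact (b := b) ha ((hc.div continuousOn_id hr0).div continuousOn_id hr0)
        (fun r _ hr => by simp [z1 r hr.le]) (fun r hr => by simp [z2 r hr.le])).integrable_sq
  have := InX.add hS (h1.const_mul t)
  unfold AdmS
  convert this using 2 <;> ring

/-! ### First variation -/

/-- If a family of integrands that is polynomial of degree four in the parameter has least integral
at the parameter `0`, then its linear coefficient has integral zero. -/
theorem integral_linear_coeff_eq_zero {μ : Measure ℝ} {D : ℝ → ℝ → ℝ} {c₀ c₁ c₂ c₃ c₄ : ℝ → ℝ}
    (hD : ∀ t, D t =ᵐ[μ] fun r => c₀ r + t * c₁ r + t ^ 2 * c₂ r + t ^ 3 * c₃ r + t ^ 4 * c₄ r)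
    (hint : ∀ t, Integrable (D t) μ) (hmin : ∀ t, ∫ r, c₀ r ∂μ ≤ ∫ r, D t r ∂μ) :
    ∫ r, c₁ r ∂μ = 0 := by
  have hi : ∀ t, Integrable
      (fun r => c₀ r + t * c₁ r + t ^ 2 * c₂ r + t ^ 3 * c₃ r + t ^ 4 * c₄ r) μ :=
    fun t => (hint t).congr (hD t)
  have i0 : Integrable c₀ μ := by simpa using hi 0
  -- The coefficients of a quartic are recovered from its values at `0`, `±1`, `±2` by finite
  -- difference formulas, so integrability at these five parameters gives integrability of each
  -- coefficient.
  have i1 : Integrable c₁ μ := by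
    have := ((((hi 1).sub (hi (-1))).const_mul (8/12)).sub (((hi 2).sub (hi (-2))).const_mul (1/12)))
    refine this.congr (Eventually.of_forall fun r => ?_); simp only [Pi.sub_apply]; ring
  have i2 : Integrable c₂ μ := by
    have := ((((hi 1).add (hi (-1))).const_mul (16/24)).sub
      (((hi 2).add (hi (-2))).const_mul (1/24))).sub (i0.const_mul (30/24))
    refine this.congr (Eventually.of_forall fun r => ?_); simp only [Pi.sub_apply, Pi.add_apply]; ring
  have i3 : Integrable c₃ μ := by
    have := (((hi 2).sub (hi (-2))).const_mul (1/12)).sub (((hi 1).sub (hi (-1))).const_mul (2/12))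
    refine this.congr (Eventually.of_forall fun r => ?_); simp only [Pi.sub_apply]; ring
  have i4 : Integrable c₄ μ := by
    have := ((((hi 2).add (hi (-2))).const_mul (1/24)).sub
      (((hi 1).add (hi (-1))).const_mul (4/24))).add (i0.const_mul (6/24))
    refine this.congr (Eventually.of_forall fun r => ?_); simp only [Pi.sub_apply, Pi.add_apply]; ring
  have hval : ∀ t, ∫ r, D t r ∂μ = ∫ r, c₀ r ∂μ + t * ∫ r, c₁ r ∂μ + t ^ 2 * ∫ r, c₂ r ∂μ
      + t ^ 3 * ∫ r, c₃ r ∂μ + t ^ 4 * ∫ r, c₄ r ∂μ := by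
    intro t
    rw [integral_congr_ae (hD t), integral_add, integral_add, integral_add, integral_add,
      integral_const_mul, integral_const_mul, integral_const_mul, integral_const_mul]
    · exact i0
    · exact i1.const_mul t
    · exact i0.add (i1.const_mul t)
    · exact i2.const_mul _
    · exact (i0.add (i1.const_mul t)).add (i2.const_mul _)
    · exact i3.const_mul _
    · exact ((i0.add (i1.const_mul t)).add (i2.const_mul _)).add (i3.const_mul _)
    · exact i4.const_mul _
  have hder : HasDerivAt (fun t : ℝ => ∫ r, c₀ r ∂μ + t * ∫ r, c₁ r ∂μ + t ^ 2 * ∫ r, c₂ r ∂μ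
      + t ^ 3 * ∫ r, c₃ r ∂μ + t ^ 4 * ∫ r, c₄ r ∂μ) (∫ r, c₁ r ∂μ) 0 := by
    have h1 := ((hasDerivAt_id (0:ℝ)).mul_const (∫ r, c₁ r ∂μ)).const_add (∫ r, c₀ r ∂μ)
    have h2 := ((hasDerivAt_pow 2 (0:ℝ))).mul_const (∫ r, c₂ r ∂μ)
    have h3 := ((hasDerivAt_pow 3 (0:ℝ))).mul_const (∫ r, c₃ r ∂μ)
    have h4 := ((hasDerivAt_pow 4 (0:ℝ))).mul_const (∫ r, c₄ r ∂μ)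
    have := ((h1.add h2).add h3).add h4
    refine this.congr_deriv ?_
    simp
  refine IsLocalMin.hasDerivAt_eq_zero (Eventually.of_forall fun t => ?_) hder
  have := hmin t
  rw [hval t] at this
  simpa using this

theorem IsTest.deriv {φ : ℝ → ℝ} (h : IsTest φ) : IsTest (deriv φ) :=
  ⟨(contDiff_infty_iff_deriv.1 h.1).2, h.2.1.deriv, tsupport_deriv_subset.trans h.2.2⟩

/-- A weak solution of `(ρ f')' = k` with continuous `k` is a classical one. -/
theorem classical_of_weak {f f' ρ k : ℝ → ℝ} (hf : IsPrim f f') (hρ : ContinuousOn ρ (Ioi 0))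
    (hρ0 : ∀ r, 0 < r → ρ r ≠ 0) (hk : ContinuousOn k (Ioi 0))
    (h : ∀ φ, IsTest φ → ∫ r in Ioi (0:ℝ), (f' r * ρ r * deriv φ r + k r * φ r) = 0) :
    ∃ p, (∀ r, 0 < r → HasDerivAt f (p r / ρ r) r) ∧ (∀ r, 0 < r → HasDerivAt p (k r) r) ∧
      ∀ᵐ r, 0 < r → f' r = p r / ρ r := by
  have hl := LocallyIntegrableOn.mul_cont hf.1 hρ
  have hkl := locallyIntegrableOn_of_continuousOn hk
  have hw : HasWeakDeriv (fun r => f' r * ρ r) k := by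
    refine ⟨hl, hkl, fun φ hφ => ?_⟩
    have := h φ hφ
    rw [integral_add (hφ.deriv.integrable_mul hl).integrableOn
      (hφ.integrable_mul hkl).integrableOn] at this
    linarith
  obtain ⟨p, hp, hpe⟩ := hw.exists_isPrim
  have hfe : ∀ᵐ r, 0 < r → f' r = p r / ρ r := by
    filter_upwards [hpe] with r hr h0
    rw [← hr h0, mul_div_cancel_right₀ _ (hρ0 r h0)]
  refine ⟨p, fun r hr => ?_, fun r hr => hp.hasDerivAt hk hr, hfe⟩
  exact (hf.congr_deriv hfe).hasDerivAt (hp.continuousOn.div hρ hρ0) hr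

/-- The Ginzburg–Landau system on `(0, ∞)` in first order form. -/
structure GLSystem (ε K γ : ℝ) (d : ℤ) (f p S P m q : ℝ → ℝ) : Prop where
  -- The fluxes are `p = r f'`, `P = S' / r` and `q = r m'`. The finite `κ` system has `ε = 1`; the
  -- limiting one is included as `ε = 0` with `S = P = 0`.
  hf : ∀ r, 0 < r → HasDerivAt f (p r / r) r
  hp : ∀ r, 0 < r → HasDerivAt p
    (r * (((d - S r) ^ 2 / r ^ 2 - K * (1 - f r ^ 2 - m r ^ 2)) * f r)) r
  hS : ∀ r, 0 < r → HasDerivAt S (r * P r) r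
  hP : ∀ r, 0 < r → HasDerivAt P (-ε * ((d - S r) * f r ^ 2 / r)) r
  hm : ∀ r, 0 < r → HasDerivAt m (q r / r) r
  hq : ∀ r, 0 < r → HasDerivAt q (r * ((γ - K * (1 - f r ^ 2 - m r ^ 2)) * m r)) r

/-! ### Euler–Lagrange equations in flux form -/

section finite

variable {κ g : ℝ} {d : ℤ} {η f f' S S' m m' : ℝ → ℝ} (hη : IsCutoff η)
include hη

/-- Only competitors that change `f` are used, which lets the result apply to the reflected function
as well. The functions `c₁`, …, `c₄` are the coefficients of the density of `f + t φ` as a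
polynomial in `t`. -/
theorem exists_flux_f (hf : AdmF η f f') (hS : AdmS d η S S') (hm : InH m m')
    (hmin : ∀ f₁ f₁', AdmF η f₁ f₁' → ∫ r, edens κ g d f f' S S' m m' r ∂radialMeasure ≤
      ∫ r, edens κ g d f₁ f₁' S S' m m' r ∂radialMeasure) :
    ∃ p, (∀ r, 0 < r → HasDerivAt f (p r / r) r) ∧ ∀ r, 0 < r → HasDerivAt p
      (r * (((d - S r) ^ 2 / r ^ 2 - κ ^ 2 * (1 - f r ^ 2 - m r ^ 2)) * f r)) r := by
  have cf := (hf.prim hη).continuousOn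
  have cS := (hS.prim hη).continuousOn
  have cm := hm.prim.continuousOn
  have hk : ContinuousOn (fun r => r * (((d - S r) ^ 2 / r ^ 2 - κ ^ 2 * (1 - f r ^ 2 - m r ^ 2)) * f r))
      (Ioi 0) := by
    refine continuousOn_id.mul (ContinuousOn.mul (ContinuousOn.sub (ContinuousOn.div ?_
      (continuousOn_id.pow 2) fun x hx => pow_ne_zero 2 (ne_of_gt hx)) ?_) cf) <;> fun_prop
  obtain ⟨p, h1, h2, -⟩ := classical_of_weak (ρ := fun r => r) (hf.prim hη) continuousOn_id
    (fun r hr => hr.ne') hk fun φ hφ => by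
      have hadm : ∀ t : ℝ, AdmF η (fun r => f r + t * φ r) (fun r => f' r + t * deriv φ r) :=
        fun t => hf.add (hφ.inX.const_mul t)
      have := integral_linear_coeff_eq_zero (μ := radialMeasure)
        (D := fun t => edens κ g d (fun r => f r + t * φ r) (fun r => f' r + t * deriv φ r) S S' m m')
        (c₀ := edens κ g d f f' S S' m m')
        (c₁ := fun r => 2 * (f' r * deriv φ r + (d - S r) ^ 2 / r ^ 2 * f r * φ r
          - κ ^ 2 * (1 - f r ^ 2 - m r ^ 2) * f r * φ r))
        (c₂ := fun r => deriv φ r ^ 2 + (d - S r) ^ 2 / r ^ 2 * φ r ^ 2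
          + κ ^ 2 / 2 * (4 * f r ^ 2 * φ r ^ 2 - 2 * (1 - f r ^ 2 - m r ^ 2) * φ r ^ 2))
        (c₃ := fun r => 2 * κ ^ 2 * f r * φ r ^ 3) (c₄ := fun r => κ ^ 2 / 2 * φ r ^ 4)
        (fun t => Eventually.of_forall fun r => by simp only [edens]; ring)
        (fun t => integrable_edens hη (hadm t) hS hm) (fun t => hmin _ _ (hadm t))
      rw [integral_const_mul, integral_radial] at this
      refine Eq.trans ?_ ((mul_eq_zero.1 this).resolve_left two_ne_zero)
      refine setIntegral_congr_fun measurableSet_Ioi fun r _ => ?_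
      ring
  exact ⟨p, h1, h2⟩

theorem exists_flux_S (hf : AdmF η f f') (hS : AdmS d η S S') (hm : InH m m')
    (hmin : ∀ S₁ S₁', AdmS d η S₁ S₁' → ∫ r, edens κ g d f f' S S' m m' r ∂radialMeasure ≤
      ∫ r, edens κ g d f f' S₁ S₁' m m' r ∂radialMeasure) :
    ∃ P, (∀ r, 0 < r → HasDerivAt S (r * P r) r) ∧
      ∀ r, 0 < r → HasDerivAt P (-1 * ((d - S r) * f r ^ 2 / r)) r := by
  have cf := (hf.prim hη).continuousOn
  have cS := (hS.prim hη).continuousOn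
  have hk : ContinuousOn (fun r => -1 * ((d - S r) * f r ^ 2 / r)) (Ioi 0) := by
    refine continuousOn_const.mul (ContinuousOn.div ?_ continuousOn_id fun x hx => ne_of_gt hx)
    fun_prop
  -- The principal term `(S' / r)² r` carries the weight `1 / r`, so the flux is `S' / r`.
  obtain ⟨p, h1, h2, -⟩ := classical_of_weak (ρ := fun r => r⁻¹) (hS.prim hη)
    (continuousOn_id.inv₀ fun x hx => ne_of_gt hx)
    (fun r hr => (inv_pos.2 hr).ne') hk fun φ hφ => by
      have hadm := fun t : ℝ => hS.add hφ t
      have := integral_linear_coeff_eq_zero (μ := radialMeasure)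
        (D := fun t => edens κ g d f f' (fun r => S r + t * φ r) (fun r => S' r + t * deriv φ r) m m')
        (c₀ := edens κ g d f f' S S' m m')
        (c₁ := fun r => 2 * (S' r / r * (deriv φ r / r) - (d - S r) * f r ^ 2 / r ^ 2 * φ r))
        (c₂ := fun r => (deriv φ r / r) ^ 2 + φ r ^ 2 * f r ^ 2 / r ^ 2)
        (c₃ := fun r => 0) (c₄ := fun r => 0)
        (fun t => Eventually.of_forall fun r => by simp only [edens]; ring)
        (fun t => integrable_edens hη hf (hadm t) hm) (fun t => hmin _ _ (hadm t))
      rw [integral_const_mul, integral_radial] at this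
      refine Eq.trans ?_ ((mul_eq_zero.1 this).resolve_left two_ne_zero)
      refine setIntegral_congr_fun measurableSet_Ioi fun r hr => ?_
      have hr : r ≠ 0 := ne_of_gt hr
      field_simp
      ring
  refine ⟨p, fun r hr => ?_, h2⟩
  have := h1 r hr
  rwa [div_inv_eq_mul, mul_comm] at this

/-- The last conclusion turns the finite Dirichlet integral of `m` into a bound for `∫ q² / r`,
which later excludes a logarithmic singularity at the origin. -/
theorem exists_flux_m (hf : AdmF η f f') (hS : AdmS d η S S') (hm : InH m m')
    (hmin : ∀ m₁ m₁', InH m₁ m₁' → ∫ r, edens κ g d f f' S S' m m' r ∂radialMeasure ≤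
      ∫ r, edens κ g d f f' S S' m₁ m₁' r ∂radialMeasure) :
    ∃ q, (∀ r, 0 < r → HasDerivAt m (q r / r) r) ∧ (∀ r, 0 < r → HasDerivAt q
      (r * ((κ ^ 2 * g - κ ^ 2 * (1 - f r ^ 2 - m r ^ 2)) * m r)) r) ∧
      ∀ᵐ r, 0 < r → m' r = q r / r := by
  have cf := (hf.prim hη).continuousOn
  have cm := hm.prim.continuousOn
  have hk : ContinuousOn (fun r => r * ((κ ^ 2 * g - κ ^ 2 * (1 - f r ^ 2 - m r ^ 2)) * m r))
      (Ioi 0) := by fun_prop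
  exact classical_of_weak (ρ := fun r => r) hm.prim continuousOn_id
    (fun r hr => hr.ne') hk fun φ hφ => by
      have hadm : ∀ t : ℝ, InH (fun r => m r + t * φ r) (fun r => m' r + t * deriv φ r) :=
        fun t => hm.add (hφ.inX.toInH.const_mul t)
      have := integral_linear_coeff_eq_zero (μ := radialMeasure)
        (D := fun t => edens κ g d f f' S S' (fun r => m r + t * φ r) (fun r => m' r + t * deriv φ r))
        (c₀ := edens κ g d f f' S S' m m')
        (c₁ := fun r => 2 * (m' r * deriv φ r + κ ^ 2 * g * m r * φ r
          - κ ^ 2 * (1 - f r ^ 2 - m r ^ 2) * m r * φ r))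
        (c₂ := fun r => deriv φ r ^ 2 + κ ^ 2 * g * φ r ^ 2
          + κ ^ 2 / 2 * (4 * m r ^ 2 * φ r ^ 2 - 2 * (1 - f r ^ 2 - m r ^ 2) * φ r ^ 2))
        (c₃ := fun r => 2 * κ ^ 2 * m r * φ r ^ 3) (c₄ := fun r => κ ^ 2 / 2 * φ r ^ 4)
        (fun t => Eventually.of_forall fun r => by simp only [edens]; ring)
        (fun t => integrable_edens hη hf hS (hadm t)) (fun t => hmin _ _ (hadm t))
      rw [integral_const_mul, integral_radial] at this
      refine Eq.trans ?_ ((mul_eq_zero.1 this).resolve_left two_ne_zero)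
      refine setIntegral_congr_fun measurableSet_Ioi fun r _ => ?_
      ring

theorem exists_fluxInf_f (hf : AdmF η f f') (hm : InH m m')
    (hmin : ∀ f₁ f₁', AdmF η f₁ f₁' → ∫ r, edensInf g d η f f' m m' r ∂radialMeasure ≤
      ∫ r, edensInf g d η f₁ f₁' m m' r ∂radialMeasure) :
    ∃ p, (∀ r, 0 < r → HasDerivAt f (p r / r) r) ∧ ∀ r, 0 < r → HasDerivAt p
      (r * ((((d:ℝ) - 0) ^ 2 / r ^ 2 - 1 * (1 - f r ^ 2 - m r ^ 2)) * f r)) r := by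
  have cf := (hf.prim hη).continuousOn
  have cm := hm.prim.continuousOn
  have hk : ContinuousOn (fun r => r * ((((d:ℝ) - 0) ^ 2 / r ^ 2 - 1 * (1 - f r ^ 2 - m r ^ 2)) * f r))
      (Ioi 0) := by
    refine continuousOn_id.mul (ContinuousOn.mul (ContinuousOn.sub (ContinuousOn.div ?_
      (continuousOn_id.pow 2) fun x hx => pow_ne_zero 2 (ne_of_gt hx)) ?_) cf) <;> fun_prop
  obtain ⟨p, h1, h2, -⟩ := classical_of_weak (ρ := fun r => r) (hf.prim hη) continuousOn_id
    (fun r hr => hr.ne') hk fun φ hφ => by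
      have hadm : ∀ t : ℝ, AdmF η (fun r => f r + t * φ r) (fun r => f' r + t * deriv φ r) :=
        fun t => hf.add (hφ.inX.const_mul t)
      have := integral_linear_coeff_eq_zero (μ := radialMeasure)
        (D := fun t => edensInf g d η (fun r => f r + t * φ r) (fun r => f' r + t * deriv φ r) m m')
        (c₀ := edensInf g d η f f' m m')
        (c₁ := fun r => 2 * (f' r * deriv φ r + (d:ℝ) ^ 2 / r ^ 2 * f r * φ r
          - (1 - f r ^ 2 - m r ^ 2) * f r * φ r))
        (c₂ := fun r => deriv φ r ^ 2 + (d:ℝ) ^ 2 / r ^ 2 * φ r ^ 2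
          + 1 / 2 * (4 * f r ^ 2 * φ r ^ 2 - 2 * (1 - f r ^ 2 - m r ^ 2) * φ r ^ 2))
        (c₃ := fun r => 2 * f r * φ r ^ 3) (c₄ := fun r => 1 / 2 * φ r ^ 4)
        (fun t => Eventually.of_forall fun r => by simp only [edensInf]; ring)
        (fun t => integrable_edensInf hη (hadm t) hm) (fun t => hmin _ _ (hadm t))
      rw [integral_const_mul, integral_radial] at this
      refine Eq.trans ?_ ((mul_eq_zero.1 this).resolve_left two_ne_zero)
      refine setIntegral_congr_fun measurableSet_Ioi fun r _ => ?_
      ring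
  exact ⟨p, h1, h2⟩

theorem exists_fluxInf_m (hf : AdmF η f f') (hm : InH m m')
    (hmin : ∀ m₁ m₁', InH m₁ m₁' → ∫ r, edensInf g d η f f' m m' r ∂radialMeasure ≤
      ∫ r, edensInf g d η f f' m₁ m₁' r ∂radialMeasure) :
    ∃ q, (∀ r, 0 < r → HasDerivAt m (q r / r) r) ∧ (∀ r, 0 < r → HasDerivAt q
      (r * ((g - 1 * (1 - f r ^ 2 - m r ^ 2)) * m r)) r) ∧
      ∀ᵐ r, 0 < r → m' r = q r / r := by
  have cf := (hf.prim hη).continuousOn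
  have cm := hm.prim.continuousOn
  have hk : ContinuousOn (fun r => r * ((g - 1 * (1 - f r ^ 2 - m r ^ 2)) * m r))
      (Ioi 0) := by fun_prop
  exact classical_of_weak (ρ := fun r => r) hm.prim continuousOn_id
    (fun r hr => hr.ne') hk fun φ hφ => by
      have hadm : ∀ t : ℝ, InH (fun r => m r + t * φ r) (fun r => m' r + t * deriv φ r) :=
        fun t => hm.add (hφ.inX.toInH.const_mul t)
      have := integral_linear_coeff_eq_zero (μ := radialMeasure)
        (D := fun t => edensInf g d η f f' (fun r => m r + t * φ r) (fun r => m' r + t * deriv φ r))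
        (c₀ := edensInf g d η f f' m m')
        (c₁ := fun r => 2 * (m' r * deriv φ r + g * m r * φ r
          - (1 - f r ^ 2 - m r ^ 2) * m r * φ r))
        (c₂ := fun r => deriv φ r ^ 2 + g * φ r ^ 2
          + 1 / 2 * (4 * m r ^ 2 * φ r ^ 2 - 2 * (1 - f r ^ 2 - m r ^ 2) * φ r ^ 2))
        (c₃ := fun r => 2 * m r * φ r ^ 3) (c₄ := fun r => 1 / 2 * φ r ^ 4)
        (fun t => Eventually.of_forall fun r => by simp only [edensInf]; ring)
        (fun t => integrable_edensInf hη hf (hadm t)) (fun t => hmin _ _ (hadm t))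
      rw [integral_const_mul, integral_radial] at this
      refine Eq.trans ?_ ((mul_eq_zero.1 this).resolve_left two_ne_zero)
      refine setIntegral_congr_fun measurableSet_Ioi fun r _ => ?_
      ring

end finite

/-! ### Positivity of the order parameter -/

theorem IsPrim.indicator {f f' : ℝ → ℝ} (h : IsPrim f f') {s : ℝ} (hs : 0 < s) (h0 : f s = 0) :
    IsPrim ((Iic s).indicator f) ((Iic s).indicator f') := by
  have hl : LocallyIntegrableOn ((Iic s).indicator f') (Ioi 0) := by
    rw [locallyIntegrableOn_Ioi_iff]
    intro a b ha hb
    have := h.intervalIntegrable ha hb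
    rw [intervalIntegrable_iff] at this ⊢
    exact Integrable.indicator this measurableSet_Iic
  refine (IsPrim.of_locallyIntegrableOn hl 0 s hs).congr_fun fun r hr => ?_
  rw [zero_add]
  rcases le_total r s with hrs | hrs
  · rw [indicator_of_mem (mem_Iic.2 hrs), intervalIntegral.integral_congr (g := f'), h.2 s r hs hr, h0,
      sub_zero]
    intro x hx
    rw [uIcc_of_ge hrs] at hx
    exact indicator_of_mem (mem_Iic.2 hx.2) _
  · rcases hrs.eq_or_lt with rfl | hlt
    · simp [h0]
    rw [indicator_of_notMem (by simpa using hlt), intervalIntegral.integral_congr_ae (g := fun _ => 0)]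
    · simp
    · refine Eventually.of_forall fun x hx => ?_
      rw [uIoc_of_le hrs] at hx
      exact indicator_of_notMem (by simpa using hx.1) _

theorem memLp_indicator_of_bound {h : ℝ → ℝ} {s : ℝ} (hm : AEStronglyMeasurable h radialMeasure)
    (hb : ∀ r, 0 < r → |h r| ≤ 1) : MemLp ((Iic s).indicator h) 2 radialMeasure := by
  have hm' := hm.indicator (measurableSet_Iic (a := s))
  refine (memLp_two_radial hm').2 ?_
  refine (integrable_indicator_radial 0 s).mono' (hm'.pow 2) (ae_radial_of_forall fun r hr => ?_)
  rw [Real.norm_eq_abs, abs_of_nonneg (sq_nonneg _)]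
  by_cases h2 : r ≤ s
  · rw [indicator_of_mem (mem_Iic.2 h2), indicator_of_mem (mem_Ioc.2 ⟨hr, h2⟩)]
    exact (sq_le_one_iff_abs_le_one _).2 (hb r hr)
  · rw [indicator_of_notMem (by simpa using h2), indicator_of_notMem (by simp [h2])]
    simp

/-- The zero at `s` keeps the reflected function continuous. The square integrability of `f` and `f
/ r` on `(0, s]` follows from that of `f - η`, since `η` and `η / r` are bounded. -/
theorem AdmF.flip {η f f' : ℝ → ℝ} (hη : IsCutoff η) (hf : AdmF η f f') {s : ℝ} (hs : 0 < s)
    (h0 : f s = 0) : AdmF η (fun r => f r + (-2) * (Iic s).indicator f r)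
      (fun r => f' r + (-2) * (Iic s).indicator f' r) := by
  refine AdmF.add hf (InX.const_mul ?_ (-2))
  have hp := (hf.prim hη).indicator hs h0
  refine ⟨⟨hp, ?_, ((hf.memLp_deriv hη).indicator measurableSet_Iic).integrable_sq⟩, ?_⟩
  · have h1 := (InX.toInH hf).memLp.indicator (measurableSet_Iic (a := s))
    have h2 := memLp_indicator_of_bound (s := s) hη.isPrim.aesm fun r hr => hη.abs_le hr
    refine ((memLp_congr_ae (Eventually.of_forall fun r => ?_)).1 (h1.add h2)).integrable_sq
    by_cases hr : r ≤ s
    · simp [hr]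
    · simp [hr]
  · have h1 := (InX.memLp_div hf).indicator (measurableSet_Iic (a := s))
    have h2 := memLp_indicator_of_bound (s := s) hη.isPrim.aesm_div fun r hr => by
      rcases le_or_gt r 1 with h | h
      · simp [hη.eq_zero r ⟨hr.le, h⟩]
      · rw [abs_div, div_le_one (abs_pos.2 hr.ne')]
        exact (hη.abs_le hr).trans (h.le.trans (le_abs_self r))
    refine ((memLp_congr_ae (Eventually.of_forall fun r => ?_)).1 (h1.add h2)).integrable_sq
    by_cases hr : r ≤ s
    · simp [hr, sub_div]
    · simp [hr]

/-- Grönwall's inequality for the linear first order system of the pair `(f, p)` on `[s, b]`, away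
from the singular point. -/
theorem eq_zero_of_flux {f p V : ℝ → ℝ} (hV : ContinuousOn V (Ioi 0))
    (hf : ∀ r, 0 < r → HasDerivAt f (p r / r) r) (hp : ∀ r, 0 < r → HasDerivAt p (r * (V r * f r)) r)
    {s : ℝ} (hs : 0 < s) (hf0 : f s = 0) (hp0 : p s = 0) : ∀ r, s ≤ r → f r = 0 := by
  intro b hb
  have hpos : ∀ x ∈ Icc s b, 0 < x := fun x hx => hs.trans_le hx.1
  obtain ⟨C, hC⟩ := (isCompact_Icc (a := s) (b := b)).exists_bound_of_continuousOn
    ((continuousOn_id.mul hV).mono hpos)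
  have hd : ∀ r, 0 < r → HasDerivAt (fun r => (f r, p r)) (p r / r, r * (V r * f r)) r :=
    fun r hr => (hf r hr).prodMk (hp r hr)
  have := eq_zero_of_abs_deriv_le_mul_abs_self_of_eq_zero_right (f := fun r => (f r, p r))
    (f' := fun r => (p r / r, r * (V r * f r))) (K := max s⁻¹ C) (a := s) (b := b)
    (fun x hx => (hd x (hpos x hx)).continuousAt.continuousWithinAt)
    (fun x hx => (hd x (hpos x (Ico_subset_Icc_self hx))).hasDerivWithinAt)
    (by simp [hf0, hp0]) (fun x hx => by
      have hx' := Ico_subset_Icc_self hx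
      have hx0 := hpos x hx'
      rw [Prod.norm_mk, Prod.norm_mk]
      refine max_le ?_ ?_
      · rw [norm_div, Real.norm_of_nonneg hx0.le, div_eq_inv_mul]
        refine mul_le_mul ?_ (le_max_right _ _) (norm_nonneg _) (le_max_of_le_left (inv_pos.2 hs).le)
        exact le_max_of_le_left (inv_anti₀ hs hx.1)
      · rw [← mul_assoc, norm_mul]
        refine mul_le_mul ?_ (le_max_left _ _) (norm_nonneg _) (le_max_of_le_left (inv_pos.2 hs).le)
        exact le_max_of_le_right (hC x hx')) b (right_mem_Icc.2 hb)
  exact congrArg Prod.fst this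

/-- If changing the sign of `f` on `(0, s]` at any zero `s` leads to another solution, then `f` is
positive. -/
theorem pos_of_flip {f V : ℝ → ℝ} (hV : ContinuousOn V (Ioi 0)) (h1 : Tendsto f atTop (𝓝 1))
    (hsol : ∃ p, (∀ r, 0 < r → HasDerivAt f (p r / r) r) ∧
      ∀ r, 0 < r → HasDerivAt p (r * (V r * f r)) r)
    (hflip : ∀ s, 0 < s → f s = 0 → ∃ p : ℝ → ℝ,
      ∀ r, 0 < r → HasDerivAt (fun r => f r + (-2) * (Iic s).indicator f r) (p r / r) r) :
    ∀ r, 0 < r → 0 < f r := by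
  obtain ⟨p, hf, hp⟩ := hsol
  have hne : ∀ s, 0 < s → f s ≠ 0 := by
    intro s hs h0
    obtain ⟨p', hp'⟩ := hflip s hs h0
    -- The reflected function equals `f` on the right of `s` and `-f` on the left. Being
    -- differentiable at `s`, it has derivative both `f' s` and `-f' s`.
    have e1 : HasDerivWithinAt f (p' s / s) (Ici s) s := by
      refine (hp' s hs).hasDerivWithinAt.congr (fun x hx => ?_) (by simp [h0])
      rcases (mem_Ici.1 hx).eq_or_lt with rfl | h
      · simp [h0]
      · rw [indicator_of_notMem (by simpa using h)]; ring
    have e2 : HasDerivWithinAt (fun r => -f r) (p' s / s) (Iic s) s := by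
      refine (hp' s hs).hasDerivWithinAt.congr (fun x hx => ?_) (by simp [h0])
      rw [indicator_of_mem hx]; ring
    have f1 := (uniqueDiffOn_Ici s s self_mem_Ici).eq_deriv _ e1 (hf s hs).hasDerivWithinAt
    have f2 := (uniqueDiffOn_Iic s s self_mem_Iic).eq_deriv _ e2 (hf s hs).neg.hasDerivWithinAt
    have hps : p s = 0 := by
      have : p s / s = 0 := by linarith
      exact (div_eq_zero_iff.1 this).resolve_right hs.ne'
    have hz := eq_zero_of_flux hV hf hp hs h0 hps
    have : Tendsto f atTop (𝓝 0) := tendsto_const_nhds.congr' (by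
      filter_upwards [eventually_ge_atTop s] with r hr using (hz r hr).symm)
    exact one_ne_zero (tendsto_nhds_unique h1 this)
  intro r hr
  by_contra hneg
  obtain ⟨R, hR, hR'⟩ := ((h1.eventually (lt_mem_nhds (zero_lt_one' ℝ))).and
    (eventually_ge_atTop r)).exists
  have hc : ContinuousOn f (Icc r R) := fun x hx =>
    (hf x (hr.trans_le hx.1)).continuousAt.continuousWithinAt
  obtain ⟨s, hs, hs0⟩ := intermediate_value_Icc hR' hc ⟨not_lt.1 hneg, hR.le⟩
  exact hne s (hr.trans_le hs.1) hs0

/-! ### Weighted averages and smoothness across a regular singular point -/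

/-- The weighted average `∫₀¹ t^k h(rt) dt`. -/
noncomputable def avg (k : ℕ) (h : ℝ → ℝ) (r : ℝ) : ℝ := ∫ t in (0:ℝ)..1, t ^ k * h (r * t)

theorem avg_continuous {k : ℕ} {h : ℝ → ℝ} (hc : Continuous h) : Continuous (avg k h) :=
  intervalIntegral.continuous_parametric_intervalIntegral_of_continuous' (by fun_prop) _ _

theorem avg_hasDerivAt {k : ℕ} {h : ℝ → ℝ} (hc : ContDiff ℝ 1 h) (r : ℝ) :
    HasDerivAt (avg k h) (avg (k + 1) (deriv h) r) r := by
  have hc0 := hc.continuous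
  have hc1 : Continuous (deriv h) := hc.continuous_deriv le_rfl
  obtain ⟨C, hC⟩ := (isCompact_Icc (a := -(|r| + 1)) (b := |r| + 1)).exists_bound_of_continuousOn
    hc1.continuousOn
  refine (intervalIntegral.hasDerivAt_integral_of_dominated_loc_of_deriv_le
    (F := fun r t => t ^ k * h (r * t)) (F' := fun r t => t ^ (k + 1) * deriv h (r * t))
    (bound := fun _ => C) (s := Metric.ball r 1) (Metric.ball_mem_nhds r one_pos)
    (Eventually.of_forall fun x => ?_) ?_ ?_ ?_ ?_ ?_).2
  · exact Continuous.aestronglyMeasurable (by fun_prop)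
  · exact Continuous.intervalIntegrable (by fun_prop) _ _
  · exact Continuous.aestronglyMeasurable (by fun_prop)
  · refine Eventually.of_forall fun t ht x hx => ?_
    rw [uIoc_of_le zero_le_one] at ht
    have hx' : |x| ≤ |r| + 1 := by
      rw [Metric.mem_ball, Real.dist_eq] at hx
      have := abs_sub_abs_le_abs_sub x r
      linarith
    have h1 : |x * t| ≤ |r| + 1 := by
      rw [abs_mul, abs_of_pos ht.1]
      exact (mul_le_of_le_one_right (abs_nonneg x) ht.2).trans hx'
    rw [norm_mul, Real.norm_of_nonneg (pow_nonneg ht.1.le _)]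
    have h2 := hC (x * t) (abs_le.1 h1)
    calc _ ≤ 1 * ‖deriv h (x * t)‖ :=
          mul_le_mul_of_nonneg_right (pow_le_one₀ ht.1.le ht.2) (norm_nonneg _)
      _ ≤ C := by rwa [one_mul]
  · exact intervalIntegrable_const
  · refine Eventually.of_forall fun t _ x _ => ?_
    have h1 := ((hc.differentiable one_ne_zero) (x * t)).hasDerivAt
    have h2 : HasDerivAt (fun y : ℝ => y * t) t x := by
      simpa using (hasDerivAt_id x).mul_const t
    have h3 := (h1.comp x h2).const_mul (t ^ k)
    refine h3.congr_deriv ?_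
    ring

theorem avg_contDiff (j : ℕ) : ∀ {k : ℕ} {h : ℝ → ℝ}, ContDiff ℝ j h → ContDiff ℝ j (avg k h) := by
  induction j with
  | zero =>
    intro k h hc
    have hc : ContDiff ℝ 0 h := by simpa using hc
    have : ContDiff ℝ 0 (avg k h) := contDiff_zero.2 (avg_continuous (contDiff_zero.1 hc))
    simpa using this
  | succ j ih =>
    intro k h hc
    have h1 : ContDiff ℝ 1 h := hc.of_le (by norm_cast; omega)
    have hd : deriv (avg k h) = avg (k + 1) (deriv h) := funext fun r => (avg_hasDerivAt h1 r).deriv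
    push_cast at hc ⊢
    rw [contDiff_succ_iff_deriv] at hc ⊢
    refine ⟨fun r => (avg_hasDerivAt h1 r).differentiableAt, by simp, ?_⟩
    rw [hd]
    exact ih hc.2.2

theorem avg_even {k : ℕ} {h : ℝ → ℝ} (he : ∀ r, h (-r) = h r) (r : ℝ) : avg k h (-r) = avg k h r := by
  simp only [avg, neg_mul, he]

/-- Rescaling to `[0, 1]` extracts the power of `r`, so that dividing a flux by it leaves an average
that inherits the smoothness of `h`. -/
theorem avg_eq {k : ℕ} {h : ℝ → ℝ} (r : ℝ) :
    r ^ (k + 1) * avg k h r = ∫ s in (0:ℝ)..r, s ^ k * h s := by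
  have := intervalIntegral.mul_integral_comp_mul_left (f := fun s => s ^ k * h s) (a := 0) (b := 1) r
  rw [mul_zero, mul_one] at this
  rw [← this, avg, pow_succ', mul_assoc, ← intervalIntegral.integral_const_mul]
  congr 1
  refine intervalIntegral.integral_congr fun t _ => ?_
  ring

theorem tendsto_left_of_hasDerivAt {f : ℝ → ℝ} {f' r : ℝ} (h : HasDerivAt f f' r) :
    Tendsto f (𝓝[<] r) (𝓝 (f r)) := h.continuousAt.tendsto.mono_left nhdsWithin_le_nhds

/-- An even function that solves `(r^k y')' = r^k G` for `r > 0` is differentiable on the line. -/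
theorem hasDerivAt_of_singular {y P G : ℝ → ℝ} {k : ℕ} (hy : ∀ r, y (-r) = y r)
    (hG : Continuous G) (hGe : ∀ r, G (-r) = G r) (hy0 : Tendsto y (𝓝[>] 0) (𝓝 (y 0)))
    (hP0 : Tendsto P (𝓝[>] 0) (𝓝 0)) (hyP : ∀ r, 0 < r → HasDerivAt y (P r / r ^ k) r)
    (hPG : ∀ r, 0 < r → HasDerivAt P (r ^ k * G r) r) (r : ℝ) :
    HasDerivAt y (r * avg k G r) r := by
  -- The flux vanishes at the origin, so it is the integral of `sᵏ G` from `0`.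
  have hP : ∀ r, 0 < r → P r = r ^ (k + 1) * avg k G r := fun r hr => by
    have := intervalIntegral.integral_eq_sub_of_hasDerivAt_of_tendsto hr
      (fun x hx => hPG x hx.1) (Continuous.intervalIntegrable (by fun_prop) _ _) hP0
      (tendsto_left_of_hasDerivAt (hPG r hr))
    rw [avg_eq, this, sub_zero]
  have hA := avg_continuous (k := k) hG
  have hYd : ∀ r, HasDerivAt (fun r => y 0 + ∫ s in (0:ℝ)..r, s * avg k G s) (r * avg k G r) r :=
    fun r => ((Continuous.integral_hasStrictDerivAt (by fun_prop) 0 r).hasDerivAt).const_add _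
  have hpos : ∀ r, 0 ≤ r → y r = y 0 + ∫ s in (0:ℝ)..r, s * avg k G s := by
    intro r hr
    rcases hr.eq_or_lt with rfl | hr
    · simp
    have := intervalIntegral.integral_eq_sub_of_hasDerivAt_of_tendsto hr
      (f := y) (f' := fun s => s * avg k G s) (fun x hx => by
        refine (hyP x hx.1).congr_deriv ?_
        rw [hP x hx.1, pow_succ]
        have := hx.1.ne'
        field_simp) (Continuous.intervalIntegrable (by fun_prop) _ _) hy0
      (tendsto_left_of_hasDerivAt (hyP r hr))
    rw [this]; ring
  have hall : y = fun r => y 0 + ∫ s in (0:ℝ)..r, s * avg k G s := by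
    funext r
    rcases le_total 0 r with hr | hr
    · exact hpos r hr
    · have h1 := hpos (-r) (by linarith)
      rw [hy] at h1
      rw [h1]
      have h2 := intervalIntegral.integral_comp_neg (a := 0) (b := -r) (f := fun s => s * avg k G s)
      simp only [neg_neg, neg_zero, avg_even hGe, neg_mul, intervalIntegral.integral_neg] at h2
      have h3 := intervalIntegral.integral_symm (μ := volume) (f := fun s => s * avg k G s) 0 r
      linarith
  rw [hall]
  exact hYd r

/-- The bootstrap step: applied to a `G` that is built from the unknowns, it raises their common
regularity by one. -/
theorem contDiff_succ_of_singular {y G : ℝ → ℝ} {k j : ℕ} (h : ∀ r, HasDerivAt y (r * avg k G r) r)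
    (hG : ContDiff ℝ j G) : ContDiff ℝ (j + 1 : ℕ) y := by
  push_cast
  rw [contDiff_succ_iff_deriv]
  refine ⟨fun r => (h r).differentiableAt, by simp, ?_⟩
  have : deriv y = fun r => r * avg k G r := funext fun r => (h r).deriv
  rw [this]
  exact contDiff_id.mul (avg_contDiff j hG)

/-! ### Behaviour near the origin -/

theorem exists_bound_Ioc {f : ℝ → ℝ} {L : ℝ} (hc : ContinuousOn f (Ioi 0))
    (h : Tendsto f (𝓝[>] 0) (𝓝 L)) : ∃ C, 0 ≤ C ∧ ∀ r, 0 < r → r ≤ 1 → |f r| ≤ C := by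
  have e0 : ∀ᶠ r in 𝓝[>] (0:ℝ), |f r| < |L| + 1 := h.abs.eventually (gt_mem_nhds (by linarith))
  obtain ⟨δ, hδ, hδ'⟩ := (mem_nhdsGT_iff_exists_Ioo_subset (a := (0:ℝ))).1 e0
  have hδ : 0 < δ := hδ
  obtain ⟨C, hC⟩ := (isCompact_Icc (a := δ) (b := 1)).exists_bound_of_continuousOn
    (hc.mono fun x hx => lt_of_lt_of_le hδ hx.1)
  refine ⟨max C (|L| + 1), le_max_of_le_right (by positivity), fun r hr hr1 => ?_⟩
  rcases lt_or_ge r δ with h' | h'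
  · exact le_max_of_le_right (le_of_lt (hδ' ⟨hr, h'⟩))
  · exact le_max_of_le_left (hC r ⟨h', hr1⟩)

theorem abs_sub_le_of_deriv_bound {y y' : ℝ → ℝ} (hy : ∀ r, 0 < r → HasDerivAt y (y' r) r) {C s r : ℝ}
    (hs : 0 < s) (hsr : s ≤ r) (hC : ∀ x, s ≤ x → x ≤ r → |y' x| ≤ C) : |y r - y s| ≤ C * (r - s) := by
  have := (convex_Icc s r).norm_image_sub_le_of_norm_hasDerivWithin_le (f := y) (f' := y')
    (fun x hx => (hy x (hs.trans_le hx.1)).hasDerivWithinAt) (fun x hx => hC x hx.1 hx.2)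
    (left_mem_Icc.2 hsr) (right_mem_Icc.2 hsr)
  rwa [Real.norm_eq_abs, Real.norm_eq_abs, abs_of_nonneg (by linarith : 0 ≤ r - s)] at this

theorem abs_le_of_deriv_bound {y y' : ℝ → ℝ} (hy : ∀ r, 0 < r → HasDerivAt y (y' r) r) {C r : ℝ}
    (hr : 0 < r) (h0 : Tendsto y (𝓝[>] 0) (𝓝 0)) (hC0 : 0 ≤ C)
    (hC : ∀ x, 0 < x → x ≤ r → |y' x| ≤ C) : |y r| ≤ C * r := by
  have h1 : Tendsto (fun s => |y r - y s|) (𝓝[>] 0) (𝓝 |y r - 0|) := (h0.const_sub (y r)).abs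
  rw [sub_zero] at h1
  refine le_of_tendsto h1 ?_
  filter_upwards [Ioo_mem_nhdsGT hr] with s hs
  refine (abs_sub_le_of_deriv_bound hy hs.1 hs.2.le fun x hx hx' => hC x (hs.1.trans_le hx) hx').trans ?_
  exact mul_le_mul_of_nonneg_left (by linarith [hs.1]) hC0

theorem exists_tendsto_of_deriv_bound {y y' : ℝ → ℝ} (hy : ∀ r, 0 < r → HasDerivAt y (y' r) r)
    (hc : ContinuousOn y' (Ioi 0)) {C : ℝ} (hC : ∀ x, 0 < x → x ≤ 1 → |y' x| ≤ C) :
    ∃ L, Tendsto y (𝓝[>] 0) (𝓝 L) := by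
  refine (IsPrim.of_hasDerivAt hy hc).tendsto_zero ?_
  refine Integrable.mono' (integrableOn_const (C := C) (by simp))
    ((hc.mono fun x hx => hx.1).aestronglyMeasurable measurableSet_Ioc) ?_
  exact (ae_restrict_iff' measurableSet_Ioc).2 (Eventually.of_forall fun r hr => hC r hr.1 hr.2)

/-- If `y` has a limit at the origin then `r y'` cannot tend to a nonzero limit. -/
theorem eq_zero_of_tendsto_mul_deriv {y w : ℝ → ℝ} (hy : ∀ r, 0 < r → HasDerivAt y (w r / r) r)
    {l L : ℝ} (h0 : Tendsto y (𝓝[>] 0) (𝓝 l)) (hw : Tendsto w (𝓝[>] 0) (𝓝 L)) : L = 0 := by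
  by_contra hne
  have hpos : 0 < |L| := abs_pos.2 hne
  have h1 : ∀ᶠ r in 𝓝[>] (0:ℝ), |L| / 2 < |w r| :=
    hw.abs.eventually (lt_mem_nhds (by linarith))
  obtain ⟨δ, hδ, hδ'⟩ := (mem_nhdsGT_iff_exists_Ioo_subset (a := (0:ℝ))).1 h1
  have hδ : 0 < δ := hδ
  have h2 : ∀ s, 0 < s → s < δ → |L| / 2 * (Real.log δ - Real.log s) ≤ |y δ - y s| := by
    intro s hs hsδ
    -- Cauchy's mean value theorem against the logarithm: the increment of `y` is `w c` times that
    -- of `log`, hence unbounded as `s → 0`.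
    obtain ⟨c, hc, hce⟩ := exists_ratio_hasDerivAt_eq_ratio_slope y (fun r => w r / r) hsδ
      (fun x hx => (hy x (hs.trans_le hx.1)).continuousAt.continuousWithinAt)
      (fun x hx => hy x (hs.trans hx.1)) Real.log (fun r => r⁻¹)
      (Real.continuousOn_log.mono fun x hx => (hs.trans_le hx.1).ne')
      (fun x hx => Real.hasDerivAt_log (hs.trans hx.1).ne')
    have hc0 : 0 < c := hs.trans hc.1
    have h3 : y δ - y s = (Real.log δ - Real.log s) * w c := by
      field_simp at hce; linarith
    have h4 : 0 ≤ Real.log δ - Real.log s := sub_nonneg.2 (Real.log_le_log hs hsδ.le)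
    rw [h3, abs_mul, abs_of_nonneg h4, mul_comm]
    exact mul_le_mul_of_nonneg_left (le_of_lt (hδ' ⟨hc0, hc.2⟩)) h4
  have h5 : Tendsto (fun s => |L| / 2 * (Real.log δ - Real.log s)) (𝓝[>] 0) atTop := by
    refine Tendsto.const_mul_atTop (by linarith) ?_
    simp only [sub_eq_add_neg]
    exact tendsto_atTop_add_const_left _ _ (tendsto_neg_atBot_atTop.comp Real.tendsto_log_nhdsGT_zero)
  have h6 : Tendsto (fun s => |y δ - y s|) (𝓝[>] 0) (𝓝 |y δ - l|) := (h0.const_sub _).abs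
  refine not_tendsto_nhds_of_tendsto_atTop (tendsto_atTop_mono' _ ?_ h5) _ h6
  filter_upwards [Ioo_mem_nhdsGT hδ] with s hs using h2 s hs.1 hs.2

/-! ### Regularity at the origin -/

theorem hasDerivAt_div_pow {f p : ℝ → ℝ} {n : ℕ} (hf : ∀ r, 0 < r → HasDerivAt f (p r / r) r) {r : ℝ}
    (hr : 0 < r) : HasDerivAt (fun r => f r / r ^ n)
      ((r ^ n * p r - n * r ^ n * f r) / r ^ (2 * n + 1)) r := by
  refine ((hf r hr).div (hasDerivAt_pow n r) (pow_ne_zero n hr.ne')).congr_deriv ?_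
  rcases n with _ | n
  · simp
  · simp only [Nat.add_sub_cancel]
    have hr' := hr.ne'
    field_simp
    ring

/-- The quantity is `r` times the Wronskian of `rⁿ` and `f`, and equals `r^(2n+1) (f / rⁿ)'`. Since
`rⁿ` solves the equation without `V`, the singular term `n² / r²` cancels. -/
theorem hasDerivAt_wronskian {f p V : ℝ → ℝ} {n : ℕ} (hf : ∀ r, 0 < r → HasDerivAt f (p r / r) r)
    (hp : ∀ r, 0 < r → HasDerivAt p (r * (((n:ℝ) ^ 2 / r ^ 2 + V r) * f r)) r) {r : ℝ} (hr : 0 < r) :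
    HasDerivAt (fun r => r ^ n * p r - n * r ^ n * f r) (r ^ (n + 1) * (V r * f r)) r := by
  have h1 := ((hasDerivAt_pow n r).mul (hp r hr)).sub (((hasDerivAt_pow n r).const_mul (n:ℝ)).mul (hf r hr))
  refine h1.congr_deriv ?_
  rcases n with _ | n
  · simp
  · simp only [Nat.add_sub_cancel]
    have hr' := hr.ne'
    field_simp
    ring

/-- A solution of `f'' + f'/r = (n²/r² + V) f` that vanishes at the origin is `O(r^n)`. -/
theorem order_of_singular {f p V : ℝ → ℝ} {n : ℕ} (hn : 1 ≤ n) (hV : ContinuousOn V (Ioi 0))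
    (hf : ∀ r, 0 < r → HasDerivAt f (p r / r) r)
    (hp : ∀ r, 0 < r → HasDerivAt p (r * (((n:ℝ) ^ 2 / r ^ 2 + V r) * f r)) r) {D : ℝ}
    (hD : ∀ r, 0 < r → r ≤ 1 → |V r| ≤ D) (hf0 : Tendsto f (𝓝[>] 0) (𝓝 0)) :
    ∃ C, 0 ≤ C ∧ (∀ r, 0 < r → r ≤ 1 → |f r| ≤ C * r ^ n) ∧
      ∀ r, 0 < r → r ≤ 1 → |r ^ n * p r - n * r ^ n * f r| ≤ C * r ^ (2 * n + 2) := by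
  have cf : ContinuousOn f (Ioi 0) := fun x hx => (hf x hx).continuousAt.continuousWithinAt
  have cQ' : ContinuousOn (fun r => r ^ (n + 1) * (V r * f r)) (Ioi 0) :=
    (continuousOn_id.pow _).mul (hV.mul cf)
  have hD0 : 0 ≤ D := (abs_nonneg _).trans (hD 1 one_pos le_rfl)
  have hQ : ∀ r, 0 < r → HasDerivAt (fun r => r ^ n * p r - n * r ^ n * f r)
      (r ^ (n + 1) * (V r * f r)) r := fun r hr => hasDerivAt_wronskian hf hp hr
  obtain ⟨C₀, hC₀, hfC⟩ := exists_bound_Ioc cf hf0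
  have hrn : Tendsto (fun r : ℝ => r ^ n) (𝓝[>] 0) (𝓝 0) := by
    have : Tendsto (fun r : ℝ => r ^ n) (𝓝 0) (𝓝 (0 ^ n)) := (continuous_pow n).tendsto 0
    rw [zero_pow (by omega)] at this
    exact this.mono_left nhdsWithin_le_nhds
  have step : ∀ {C : ℝ} {j : ℕ}, 0 ≤ C → (∀ r, 0 < r → r ≤ 1 → |f r| ≤ C * r ^ j) →
      ∀ r, 0 < r → r ≤ 1 → ∀ x, 0 < x → x ≤ r →
        |x ^ (n + 1) * (V x * f x)| ≤ D * C * r ^ (n + 1 + j) := by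
    intro C j hC hb r hr hr1 x hx hxr
    have h1 := hb x hx (hxr.trans hr1)
    have h2 := hD x hx (hxr.trans hr1)
    rw [abs_mul, abs_mul, abs_of_pos (pow_pos hx _)]
    calc x ^ (n + 1) * (|V x| * |f x|) ≤ x ^ (n + 1) * (D * (C * x ^ j)) := by gcongr
      _ = D * C * x ^ (n + 1 + j) := by ring
      _ ≤ _ := by gcongr
  obtain ⟨L, hL⟩ := exists_tendsto_of_deriv_bound hQ cQ' (C := D * C₀ * 1 ^ (n + 1 + 0))
    (fun x hx hx1 => step hC₀ (by simpa using hfC) 1 one_pos le_rfl x hx hx1)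
  -- Here `r (rⁿ f)' = Q + 2n rⁿ f`, with `Q` the Wronskian, tends to `L` while `rⁿ f → 0`; a
  -- nonzero `L` would force logarithmic growth of `rⁿ f`.
  have hL0 : L = 0 := by
    have hz : ∀ r, 0 < r → HasDerivAt (fun r => r ^ n * f r)
        ((r ^ n * p r - n * r ^ n * f r + 2 * n * (r ^ n * f r)) / r) r := fun r hr => by
      refine ((hasDerivAt_pow n r).mul (hf r hr)).congr_deriv ?_
      obtain ⟨k, rfl⟩ := Nat.exists_eq_add_of_le' hn
      simp only [Nat.add_sub_cancel]
      have hr' := hr.ne'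
      field_simp
      ring
    have hlim := hrn.mul hf0
    rw [mul_zero] at hlim
    have := hL.add (hlim.const_mul (2 * (n:ℝ)))
    rw [mul_zero, add_zero] at this
    exact eq_zero_of_tendsto_mul_deriv hz hlim this
  subst hL0
  have hQb : ∀ {C : ℝ} {j : ℕ}, 0 ≤ C → (∀ r, 0 < r → r ≤ 1 → |f r| ≤ C * r ^ j) →
      ∀ r, 0 < r → r ≤ 1 → |r ^ n * p r - n * r ^ n * f r| ≤ D * C * r ^ (n + 2 + j) := by
    intro C j hC hb r hr hr1
    refine (abs_le_of_deriv_bound hQ hr hL (by positivity) (step hC hb r hr hr1)).trans (le_of_eq ?_)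
    ring
  -- The order of vanishing is raised one unit at a time: `f = O(rʲ)` gives `Q = O(r^(n+2+j))`, so
  -- `(f / rⁿ)' = O(r^(j+1-n))`. For `j + 1 ≤ n` this power is largest at the left end of `[r, 1]`,
  -- and comparison with the value at `1` gives `f = O(r^(j+1))`.
  have main : ∀ j, j ≤ n → ∃ C, 0 ≤ C ∧ ∀ r, 0 < r → r ≤ 1 → |f r| ≤ C * r ^ j := by
    intro j
    induction j with
    | zero => exact fun _ => ⟨C₀, hC₀, by simpa using hfC⟩
    | succ j ih =>
      intro hj
      obtain ⟨C, hC, hb⟩ := ih (by omega)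
      refine ⟨|f 1| + D * C, by positivity, fun r hr hr1 => ?_⟩
      have h1 : |f 1 / 1 ^ n - f r / r ^ n| ≤ D * C * (r ^ (j + 1) / r ^ n) * (1 - r) := by
        refine abs_sub_le_of_deriv_bound (fun x hx => hasDerivAt_div_pow (n := n) hf hx) hr hr1
          fun x hrx hx1 => ?_
        have hx := hr.trans_le hrx
        rw [abs_div, abs_of_pos (pow_pos hx (2 * n + 1)), div_le_iff₀ (by positivity)]
        refine (hQb hC hb x hx hx1).trans ?_
        have h3 : x ^ (j + 1) / x ^ n ≤ r ^ (j + 1) / r ^ n := by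
          obtain ⟨i, hi⟩ := Nat.exists_eq_add_of_le hj
          rw [hi, pow_add x (j + 1), pow_add r (j + 1), div_mul_cancel_left₀ (by positivity),
            div_mul_cancel_left₀ (by positivity)]
          exact inv_anti₀ (by positivity) (by gcongr)
        calc D * C * x ^ (n + 2 + j) = D * C * (x ^ (j + 1) / x ^ n) * x ^ (2 * n + 1) := by
              field_simp; ring
          _ ≤ _ := by gcongr
      have h2 : |f r / r ^ n| ≤ |f 1| + D * C * (r ^ (j + 1) / r ^ n) := by
        have h4 : D * C * (r ^ (j + 1) / r ^ n) * (1 - r) ≤ D * C * (r ^ (j + 1) / r ^ n) :=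
          mul_le_of_le_one_right (by positivity) (by linarith)
        have h5 := abs_sub_abs_le_abs_sub (f r / r ^ n) (f 1 / 1 ^ n)
        rw [abs_sub_comm] at h5
        simp only [one_pow, div_one] at h1 h5
        linarith
      rw [abs_div, abs_of_pos (pow_pos hr n), div_le_iff₀ (pow_pos hr n)] at h2
      have h6 : r ^ n ≤ r ^ (j + 1) := pow_le_pow_of_le_one hr.le hr1 hj
      calc |f r| ≤ (|f 1| + D * C * (r ^ (j + 1) / r ^ n)) * r ^ n := h2
        _ = |f 1| * r ^ n + D * C * r ^ (j + 1) := by field_simp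
        _ ≤ |f 1| * r ^ (j + 1) + D * C * r ^ (j + 1) := by gcongr
        _ = _ := by ring
  obtain ⟨C, hC, hb⟩ := main n le_rfl
  refine ⟨max C (D * C), le_max_of_le_left hC, fun r hr hr1 => (hb r hr hr1).trans ?_, fun r hr hr1 => ?_⟩
  · gcongr; exact le_max_left _ _
  · refine (hQb hC hb r hr hr1).trans ?_
    rw [show n + 2 + n = 2 * n + 2 by ring]
    gcongr; exact le_max_right _ _

/-- Even extension of a function on `(0, ∞)` with value `L` at the origin. -/
noncomputable def evenExt (L : ℝ) (c : ℝ → ℝ) (r : ℝ) : ℝ := if r = 0 then L else c |r|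

theorem evenExt_neg (L : ℝ) (c : ℝ → ℝ) (r : ℝ) : evenExt L c (-r) = evenExt L c r := by
  simp [evenExt]

theorem evenExt_of_pos (L : ℝ) (c : ℝ → ℝ) {r : ℝ} (hr : 0 < r) : evenExt L c r = c r := by
  simp [evenExt, hr.ne', abs_of_pos hr]

theorem evenExt_zero (L : ℝ) (c : ℝ → ℝ) : evenExt L c 0 = L := by simp [evenExt]

theorem evenExt_continuous {L : ℝ} {c : ℝ → ℝ} (hc : ContinuousOn c (Ioi 0))
    (h : Tendsto c (𝓝[>] 0) (𝓝 L)) : Continuous (evenExt L c) := by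
  rw [continuous_iff_continuousAt]
  intro r
  by_cases hr : r = 0
  · subst hr
    rw [continuousAt_iff_punctured_nhds, evenExt_zero]
    refine (h.comp tendsto_abs_nhdsNE_zero).congr' ?_
    filter_upwards [self_mem_nhdsWithin] with x hx
    simp [evenExt, show x ≠ 0 from hx]
  · have h1 : ContinuousAt (fun x => c |x|) r :=
      (hc.continuousAt (Ioi_mem_nhds (abs_pos.2 hr))).comp (f := fun x : ℝ => |x|)
        continuous_abs.continuousAt
    refine h1.congr ?_
    filter_upwards [isOpen_ne.mem_nhds hr] with x hx
    simp [evenExt, show x ≠ 0 from hx]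

theorem evenExt_hasDerivAt {L : ℝ} {c : ℝ → ℝ} {c' r : ℝ} (hr : 0 < r) (h : HasDerivAt c c' r) :
    HasDerivAt (evenExt L c) c' r := by
  refine h.congr_of_eventuallyEq ?_
  filter_upwards [Ioi_mem_nhds hr] with x hx using evenExt_of_pos L c hx

theorem evenExt_tendsto {L : ℝ} {c : ℝ → ℝ} (h : Tendsto c (𝓝[>] 0) (𝓝 L)) :
    Tendsto (evenExt L c) (𝓝[>] 0) (𝓝 (evenExt L c 0)) := by
  rw [evenExt_zero]
  refine h.congr' ?_
  filter_upwards [self_mem_nhdsWithin] with x hx using (evenExt_of_pos L c hx).symm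

/-! ### Removal of the singularity at the origin for the full system -/

namespace GLSystem

variable {ε K γ : ℝ} {d : ℤ} {f p S P m q : ℝ → ℝ} (h : GLSystem ε K γ d f p S P m q)
include h

theorem cont_f : ContinuousOn f (Ioi 0) := fun x hx => (h.hf x hx).continuousAt.continuousWithinAt
theorem cont_p : ContinuousOn p (Ioi 0) := fun x hx => (h.hp x hx).continuousAt.continuousWithinAt
theorem cont_S : ContinuousOn S (Ioi 0) := fun x hx => (h.hS x hx).continuousAt.continuousWithinAt
theorem cont_P : ContinuousOn P (Ioi 0) := fun x hx => (h.hP x hx).continuousAt.continuousWithinAt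
theorem cont_m : ContinuousOn m (Ioi 0) := fun x hx => (h.hm x hx).continuousAt.continuousWithinAt
theorem cont_q : ContinuousOn q (Ioi 0) := fun x hx => (h.hq x hx).continuousAt.continuousWithinAt

/-- The magnetization is bounded at the origin, and its flux vanishes there. -/
theorem bound_m (hf0 : Tendsto f (𝓝[>] 0) (𝓝 0)) {A : ℝ}
    (hA : ∀ r, 0 < r → r ≤ 1 → m r ^ 4 ≤ A / r)
    (hq : IntegrableOn (fun r => q r ^ 2 / r) (Ioc 0 1)) :
    (∃ L, Tendsto m (𝓝[>] 0) (𝓝 L)) ∧ Tendsto q (𝓝[>] 0) (𝓝 0) := by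
  obtain ⟨C, hC, hfC⟩ := exists_bound_Ioc h.cont_f hf0
  have hA0 : 0 ≤ A := by
    have := hA 1 one_pos le_rfl
    have h2 : 0 ≤ m 1 ^ 4 := by positivity
    simp at this; linarith
  -- The derivative of `q` is bounded because `r |m|` and `r |m|³` are at most `r + r m⁴ ≤ 1 + A`.
  have hb : ∀ r, 0 < r → r ≤ 1 →
      |r * ((γ - K * (1 - f r ^ 2 - m r ^ 2)) * m r)| ≤ (|γ| + |K| * (2 + C ^ 2)) * (1 + A) := by
    intro r hr hr1
    have h1 : r * m r ^ 4 ≤ A := by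
      have := hA r hr hr1
      rw [le_div_iff₀ hr] at this; linarith
    have hf2 : f r ^ 2 ≤ C ^ 2 := sq_le_sq.2 ((hfC r hr hr1).trans (le_abs_self C))
    have h2 : |γ - K * (1 - f r ^ 2 - m r ^ 2)| ≤ |γ| + |K| * (1 + C ^ 2 + m r ^ 2) := by
      refine (abs_sub _ _).trans ?_
      rw [abs_mul]
      gcongr
      rw [abs_le]; constructor <;> nlinarith [sq_nonneg (m r), sq_nonneg (f r)]
    have h3 : |m r| ≤ 1 + m r ^ 4 := by
      have : |m r| ≤ 1 + |m r| ^ 4 := by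
        rcases le_total |m r| 1 with h | h
        · have : 0 ≤ |m r| ^ 4 := by positivity
          linarith
        · have := le_self_pow₀ h (n := 4) (by norm_num); linarith
      rwa [show |m r| ^ 4 = m r ^ 4 from by rw [← abs_pow, abs_of_nonneg (by positivity)]] at this
    have h4 : m r ^ 2 * |m r| ≤ 1 + m r ^ 4 := by
      rw [← sq_abs (m r), show m r ^ 4 = |m r| ^ 4 from by rw [← abs_pow, abs_of_nonneg (by positivity)]]
      rcases le_total |m r| 1 with h | h
      · have h5 : |m r| ^ 3 ≤ 1 := pow_le_one₀ (abs_nonneg _) h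
        have : 0 ≤ |m r| ^ 4 := by positivity
        nlinarith
      · have := pow_le_pow_right₀ h (show 3 ≤ 4 by norm_num)
        nlinarith
    have h5 : r * |m r| ≤ 1 + A := by nlinarith [abs_nonneg (m r)]
    have h6 : r * (m r ^ 2 * |m r|) ≤ 1 + A := by nlinarith
    rw [abs_mul, abs_mul, abs_of_pos hr]
    calc r * (|γ - K * (1 - f r ^ 2 - m r ^ 2)| * |m r|)
        ≤ r * ((|γ| + |K| * (1 + C ^ 2 + m r ^ 2)) * |m r|) := by gcongr
      _ = (|γ| + |K| * (1 + C ^ 2)) * (r * |m r|) + |K| * (r * (m r ^ 2 * |m r|)) := by ring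
      _ ≤ (|γ| + |K| * (1 + C ^ 2)) * (1 + A) + |K| * (1 + A) := by gcongr
      _ = _ := by ring
  have cq' : ContinuousOn (fun r => r * ((γ - K * (1 - f r ^ 2 - m r ^ 2)) * m r)) (Ioi 0) := by
    have := h.cont_f
    have := h.cont_m
    fun_prop
  obtain ⟨L, hL⟩ := exists_tendsto_of_deriv_bound h.hq cq' hb
  -- Since `q² / r` is integrable at `0` the limit of `q` is zero. Then `q = O(r)`, so `m' = q / r`
  -- is bounded and `m` has a limit.
  have hL0 : L = 0 := by
    have := eq_zero_of_tendsto_of_integrable_div (hL.pow 2) hq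
    exact pow_eq_zero_iff (two_ne_zero) |>.1 this
  subst hL0
  refine ⟨?_, hL⟩
  refine exists_tendsto_of_deriv_bound h.hm (h.cont_q.div continuousOn_id fun x hx => ne_of_gt hx)
    (C := (|γ| + |K| * (2 + C ^ 2)) * (1 + A)) fun r hr hr1 => ?_
  rw [abs_div, abs_of_pos hr, div_le_iff₀ hr]
  exact abs_le_of_deriv_bound h.hq hr hL (by positivity) fun x hx hxr => hb x hx (hxr.trans hr1)

/-- The potential vanishes quadratically at the origin. -/
theorem bound_S (hS0 : Tendsto S (𝓝[>] 0) (𝓝 0))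
    (hε : IntegrableOn (fun r => ε * (f r ^ 2 / r)) (Ioc 0 1)) :
    (∃ C, 0 ≤ C ∧ ∀ r, 0 < r → r ≤ 1 → |P r| ≤ C ∧ |S r| ≤ C * r ^ 2) := by
  obtain ⟨B, hB, hSB⟩ := exists_bound_Ioc h.cont_S hS0
  have cP' : ContinuousOn (fun r => -ε * ((d - S r) * f r ^ 2 / r)) (Ioi 0) :=
    continuousOn_const.mul (((continuousOn_const.sub h.cont_S).mul (h.cont_f.pow 2)).div
      continuousOn_id fun x hx => ne_of_gt hx)
  -- The derivative of `P` is a bounded factor times `ε f² / r`, hence integrable. So `P` is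
  -- bounded, and `S' = r P` yields `S = O(r²)`.
  obtain ⟨L, hL⟩ := (IsPrim.of_hasDerivAt h.hP cP').tendsto_zero (by
    refine (hε.norm.const_mul (|(d:ℝ)| + B)).mono'
      ((cP'.mono fun x hx => hx.1).aestronglyMeasurable measurableSet_Ioc) ?_
    refine (ae_restrict_iff' measurableSet_Ioc).2 (Eventually.of_forall fun r hr => ?_)
    rw [show -ε * ((d - S r) * f r ^ 2 / r) = -(d - S r) * (ε * (f r ^ 2 / r)) by ring, norm_mul,
      norm_neg]
    refine mul_le_mul_of_nonneg_right ?_ (norm_nonneg _)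
    exact (norm_sub_le _ _).trans (add_le_add le_rfl (hSB r hr.1 hr.2)))
  obtain ⟨C, hC, hPC⟩ := exists_bound_Ioc h.cont_P hL
  refine ⟨C, hC, fun r hr hr1 => ⟨hPC r hr hr1, ?_⟩⟩
  have := abs_le_of_deriv_bound h.hS hr hS0 (C := C * r) (by positivity) fun x hx hxr => by
    rw [abs_mul, abs_of_pos hx]
    have := hPC x hx (hxr.trans hr1)
    calc x * |P x| ≤ r * C := by gcongr
      _ = C * r := by ring
  calc |S r| ≤ C * r * r := this
    _ = C * r ^ 2 := by ring

/-- The quotients `a = f / rⁿ` with `n = |d|`, `b = S / r²` and `m` itself extend to even continuous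
functions that solve singular equations with weights `r^(2n+1)`, `r³` and `r`. These are
bootstrapped together, so `f = rⁿ a` and `S = r² b` are smooth too. -/
theorem exists_smooth (hd : d ≠ 0) (hf0 : Tendsto f (𝓝[>] 0) (𝓝 0)) (hS0 : Tendsto S (𝓝[>] 0) (𝓝 0))
    (hε : IntegrableOn (fun r => ε * (f r ^ 2 / r)) (Ioc 0 1)) {A : ℝ}
    (hA : ∀ r, 0 < r → r ≤ 1 → m r ^ 4 ≤ A / r)
    (hq : IntegrableOn (fun r => q r ^ 2 / r) (Ioc 0 1)) :
    ∃ f₁ S₁ m₁ : ℝ → ℝ, ContDiff ℝ ∞ f₁ ∧ ContDiff ℝ ∞ S₁ ∧ ContDiff ℝ ∞ m₁ ∧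
      (∀ r, 0 < r → f₁ r = f r) ∧ (∀ r, 0 < r → S₁ r = S r) ∧ (∀ r, 0 < r → m₁ r = m r) ∧
      f₁ 0 = 0 ∧ HasDerivAt m₁ 0 0 := by
  obtain ⟨⟨Lm, hLm⟩, hq0⟩ := h.bound_m hf0 hA hq
  obtain ⟨B, hB, hSB⟩ := h.bound_S hS0 hε
  obtain ⟨Cm, hCm, hmb⟩ := exists_bound_Ioc h.cont_m hLm
  obtain ⟨Cf, hCf, hfb⟩ := exists_bound_Ioc h.cont_f hf0
  set n := d.natAbs with hndef
  have hn : 1 ≤ n := Int.natAbs_pos.2 hd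
  have hn2 : (n:ℝ) ^ 2 = (d:ℝ) ^ 2 := by
    have := Int.natAbs_sq d
    rw [← hndef] at this
    exact_mod_cast this
  -- What remains of the potential after `n² / r²` is removed; it is bounded because `S = O(r²)`.
  set V : ℝ → ℝ := fun r => ((d - S r) ^ 2 - (d:ℝ) ^ 2) / r ^ 2 - K * (1 - f r ^ 2 - m r ^ 2) with hVdef
  have hVc : ContinuousOn V (Ioi 0) := by
    have := h.cont_f
    have := h.cont_m
    have := h.cont_S
    refine ContinuousOn.sub (ContinuousOn.div (by fun_prop) (by fun_prop)
      fun x hx => pow_ne_zero 2 (ne_of_gt hx)) (by fun_prop)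
  have hVb : ∀ r, 0 < r → r ≤ 1 → |V r| ≤ B * (2 * |(d:ℝ)| + B) + |K| * (1 + Cf ^ 2 + Cm ^ 2) := by
    intro r hr hr1
    have h1 : |((d - S r) ^ 2 - (d:ℝ) ^ 2) / r ^ 2| ≤ B * (2 * |(d:ℝ)| + B) := by
      rw [abs_div, abs_of_pos (pow_pos hr 2), div_le_iff₀ (pow_pos hr 2),
        show ((d:ℝ) - S r) ^ 2 - (d:ℝ) ^ 2 = S r * (S r - 2 * d) by ring, abs_mul]
      have e1 := (hSB r hr hr1).2
      have e2 : |S r| ≤ B := e1.trans (mul_le_of_le_one_right hB (pow_le_one₀ hr.le hr1))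
      have e3 : |S r - 2 * d| ≤ 2 * |(d:ℝ)| + B := by
        refine (abs_sub _ _).trans ?_
        rw [abs_mul, abs_two]; linarith
      calc _ ≤ (B * r ^ 2) * (2 * |(d:ℝ)| + B) := by gcongr
        _ = _ := by ring
    have h2 : |K * (1 - f r ^ 2 - m r ^ 2)| ≤ |K| * (1 + Cf ^ 2 + Cm ^ 2) := by
      rw [abs_mul]
      have e1 : f r ^ 2 ≤ Cf ^ 2 := sq_le_sq.2 ((hfb r hr hr1).trans (le_abs_self _))
      have e2 : m r ^ 2 ≤ Cm ^ 2 := sq_le_sq.2 ((hmb r hr hr1).trans (le_abs_self _))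
      gcongr
      rw [abs_le]; constructor <;> nlinarith [sq_nonneg (m r), sq_nonneg (f r)]
    exact (abs_sub _ _).trans (add_le_add h1 h2)
  have hp' : ∀ r, 0 < r → HasDerivAt p (r * (((n:ℝ) ^ 2 / r ^ 2 + V r) * f r)) r := fun r hr => by
    refine (h.hp r hr).congr_deriv ?_
    rw [hn2, hVdef]; ring
  obtain ⟨C, hC, hfn, hQn⟩ := order_of_singular hn hVc h.hf hp' hVb hf0
  -- the rescaled unknowns
  have hrn : ∀ k : ℕ, 0 < k → Tendsto (fun r : ℝ => C * r ^ k) (𝓝[>] 0) (𝓝 0) := fun k hk => by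
    have : Tendsto (fun r : ℝ => C * r ^ k) (𝓝 0) (𝓝 (C * 0 ^ k)) :=
      (continuous_const.mul (continuous_pow k)).tendsto 0
    rw [zero_pow (by omega), mul_zero] at this
    exact this.mono_left nhdsWithin_le_nhds
  have hQ0 : Tendsto (fun r => r ^ n * p r - n * r ^ n * f r) (𝓝[>] 0) (𝓝 0) := by
    refine squeeze_zero_norm' ?_ (hrn (2 * n + 2) (by omega))
    filter_upwards [Ioo_mem_nhdsGT one_pos] with r hr using hQn r hr.1 hr.2.le
  have cS := h.cont_S
  have cP := h.cont_P
  have cf := h.cont_f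
  have cp := h.cont_p
  have hr0 : ∀ k : ℕ, ∀ x ∈ Ioi (0:ℝ), x ^ k ≠ 0 := fun k x hx => pow_ne_zero k (ne_of_gt hx)
  obtain ⟨La, hLa⟩ := exists_tendsto_of_deriv_bound
    (fun r hr => hasDerivAt_div_pow (n := n) h.hf hr)
    (ContinuousOn.div (by fun_prop) (by fun_prop) (hr0 _)) (C := C) (fun r hr hr1 => by
      rw [abs_div, abs_of_pos (pow_pos hr _), div_le_iff₀ (pow_pos hr _)]
      refine (hQn r hr hr1).trans ?_
      have : r ^ (2 * n + 2) ≤ r ^ (2 * n + 1) := pow_le_pow_of_le_one hr.le hr1 (by omega)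
      gcongr)
  have hb' : ∀ r, 0 < r → HasDerivAt (fun r => S r / r ^ 2) ((r ^ 2 * P r - 2 * S r) / r ^ 3) r :=
    fun r hr => by
      refine ((h.hS r hr).div (hasDerivAt_pow 2 r) (pow_ne_zero 2 hr.ne')).congr_deriv ?_
      have hr' := hr.ne'
      field_simp
      ring
  -- The analogue of the Wronskian for `S`: this flux is `r³ (S / r²)'`.
  have hQb' : ∀ r, 0 < r → HasDerivAt (fun r => r ^ 2 * P r - 2 * S r)
      (-ε * (r * ((d - S r) * f r ^ 2))) r := fun r hr => by
    refine (((hasDerivAt_pow 2 r).mul (h.hP r hr)).sub ((h.hS r hr).const_mul 2)).congr_deriv ?_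
    have hr' := hr.ne'
    field_simp
    ring
  have hQb0 : Tendsto (fun r => r ^ 2 * P r - 2 * S r) (𝓝[>] 0) (𝓝 0) := by
    have h1 : Tendsto (fun r => r ^ 2 * P r) (𝓝[>] 0) (𝓝 0) := by
      have h2 : Tendsto (fun r : ℝ => B * r ^ 2) (𝓝[>] 0) (𝓝 0) := by
        have : Tendsto (fun r : ℝ => B * r ^ 2) (𝓝 0) (𝓝 (B * 0 ^ 2)) :=
          (continuous_const.mul (continuous_pow 2)).tendsto 0
        simp only [ne_eq, OfNat.ofNat_ne_zero, not_false_eq_true, zero_pow, mul_zero] at this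
        exact this.mono_left nhdsWithin_le_nhds
      refine squeeze_zero_norm' ?_ h2
      filter_upwards [Ioo_mem_nhdsGT one_pos] with r hr
      rw [norm_mul, norm_pow, Real.norm_of_nonneg hr.1.le, mul_comm]
      have := (hSB r hr.1 hr.2.le).1
      gcongr
      exact this
    have := h1.sub (hS0.const_mul 2)
    simpa using this
  have hSb : ∀ r, 0 < r → r ≤ 1 → |S r| ≤ B := fun r hr hr1 =>
    (hSB r hr hr1).2.trans (mul_le_of_le_one_right hB (pow_le_one₀ hr.le hr1))
  have hfr : ∀ r, 0 < r → r ≤ 1 → |f r| ≤ C * r := fun r hr hr1 => by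
    refine (hfn r hr hr1).trans ?_
    have : r ^ n ≤ r := by simpa using pow_le_pow_of_le_one hr.le hr1 hn
    gcongr
  obtain ⟨Lb, hLb⟩ := exists_tendsto_of_deriv_bound hb'
    (ContinuousOn.div (by fun_prop) (by fun_prop) (hr0 _)) (C := |ε| * ((|(d:ℝ)| + B) * C ^ 2))
    (fun r hr hr1 => by
      rw [abs_div, abs_of_pos (pow_pos hr _), div_le_iff₀ (pow_pos hr _)]
      refine (abs_le_of_deriv_bound hQb' hr hQb0
        (C := |ε| * ((|(d:ℝ)| + B) * C ^ 2) * r ^ 2) (by positivity) fun x hx hxr => ?_).trans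
        (le_of_eq (by ring))
      have e1 := hfr x hx (hxr.trans hr1)
      have e2 : |(d:ℝ) - S x| ≤ |(d:ℝ)| + B := (abs_sub _ _).trans
        (add_le_add le_rfl (hSb x hx (hxr.trans hr1)))
      rw [abs_mul, abs_neg, abs_mul, abs_mul, abs_of_pos hx, abs_pow]
      have e3 : C * x ≤ C * r := by gcongr
      calc |ε| * (x * (|(d:ℝ) - S x| * |f x| ^ 2)) ≤ |ε| * (1 * ((|(d:ℝ)| + B) * (C * r) ^ 2)) := by
            have := hxr.trans hr1
            have := e1.trans e3
            gcongr
        _ = _ := by ring)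
  -- even extensions
  set a := evenExt La fun r => f r / r ^ n with ha
  set b := evenExt Lb fun r => S r / r ^ 2 with hb
  set M := evenExt Lm m with hM
  have ca : Continuous a := evenExt_continuous (cf.div (by fun_prop) (hr0 n)) hLa
  have cb : Continuous b := evenExt_continuous (cS.div (by fun_prop) (hr0 2)) hLb
  have cM : Continuous M := evenExt_continuous h.cont_m hLm
  have ea : ∀ r, 0 < r → r ^ n * a r = f r := fun r hr => by
    rw [ha, evenExt_of_pos _ _ hr]; field_simp
  have eb : ∀ r, 0 < r → r ^ 2 * b r = S r := fun r hr => by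
    rw [hb, evenExt_of_pos _ _ hr]; field_simp
  have eM : ∀ r, 0 < r → M r = m r := fun r hr => evenExt_of_pos _ _ hr
  have na : ∀ r, a (-r) = a r := evenExt_neg _ _
  have nb : ∀ r, b (-r) = b r := evenExt_neg _ _
  have nM : ∀ r, M (-r) = M r := evenExt_neg _ _
  -- Even powers of `r` are written as powers of `r ^ 2`, so that `neg_sq` shows the right side to
  -- be even.
  have da : ∀ r, HasDerivAt a (r * avg (2 * n + 1) (fun r => (-2 * d * b r + r ^ 2 * b r ^ 2
      - K * (1 - (r ^ 2) ^ n * a r ^ 2 - M r ^ 2)) * a r) r) r := by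
    refine hasDerivAt_of_singular na (by fun_prop) (fun r => by simp only [na, nb, nM, neg_sq])
      (evenExt_tendsto hLa) hQ0
      (fun r hr => evenExt_hasDerivAt hr (hasDerivAt_div_pow h.hf hr)) fun r hr => ?_
    refine (hasDerivAt_wronskian h.hf hp' hr).congr_deriv ?_
    have hr' := hr.ne'
    simp only [hVdef]
    rw [eM r hr, ← ea r hr, ← eb r hr]
    field_simp
    ring
  have db : ∀ r, HasDerivAt b (r * avg 3 (fun r => -ε * ((d - r ^ 2 * b r) *
      ((r ^ 2) ^ (n - 1) * a r ^ 2))) r) r := by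
    refine hasDerivAt_of_singular nb (by fun_prop) (fun r => by simp only [na, nb, neg_sq])
      (evenExt_tendsto hLb) hQb0
      (fun r hr => evenExt_hasDerivAt hr (hb' r hr)) fun r hr => ?_
    refine (hQb' r hr).congr_deriv ?_
    rw [← ea r hr, ← eb r hr]
    obtain ⟨k, hk⟩ := Nat.exists_eq_add_of_le' hn
    rw [hk, Nat.add_sub_cancel]
    ring
  have dM : ∀ r, HasDerivAt M (r * avg 1 (fun r => (γ - K * (1 - (r ^ 2) ^ n * a r ^ 2 - M r ^ 2)) *
      M r) r) r := by
    refine hasDerivAt_of_singular nM (by fun_prop) (fun r => by simp only [na, nM, neg_sq])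
      (evenExt_tendsto hLm) hq0
      (fun r hr => by simpa using evenExt_hasDerivAt hr (h.hm r hr)) fun r hr => ?_
    refine (h.hq r hr).congr_deriv ?_
    rw [eM r hr, ← ea r hr]
    ring
  have hj : ∀ j : ℕ, ContDiff ℝ j a ∧ ContDiff ℝ j b ∧ ContDiff ℝ j M := by
    intro j
    induction j with
    | zero =>
      simp only [CharP.cast_eq_zero]
      exact ⟨contDiff_zero.2 ca, contDiff_zero.2 cb, contDiff_zero.2 cM⟩
    | succ j ih =>
      obtain ⟨i1, i2, i3⟩ := ih
      exact ⟨contDiff_succ_of_singular da (by fun_prop), contDiff_succ_of_singular db (by fun_prop),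
        contDiff_succ_of_singular dM (by fun_prop)⟩
  have ia : ContDiff ℝ ∞ a := contDiff_infty.2 fun j => (hj j).1
  have ib : ContDiff ℝ ∞ b := contDiff_infty.2 fun j => (hj j).2.1
  have iM : ContDiff ℝ ∞ M := contDiff_infty.2 fun j => (hj j).2.2
  refine ⟨fun r => r ^ n * a r, fun r => r ^ 2 * b r, M, by fun_prop, by fun_prop, iM, ea, eb, eM, ?_, ?_⟩
  · simp [show n ≠ 0 by omega]
  · simpa using dM 0

end GLSystem

/-! ### The potential at infinity -/

theorem le_of_hasDerivAt_nonneg {F F' : ℝ → ℝ} {a : ℝ} (hF : ∀ r, a ≤ r → HasDerivAt F (F' r) r)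
    (h0 : ∀ r, a ≤ r → 0 ≤ F' r) {x y : ℝ} (hx : a ≤ x) (hxy : x ≤ y) : F x ≤ F y := by
  have : MonotoneOn F (Ici a) := by
    refine monotoneOn_of_deriv_nonneg (convex_Ici a)
      (fun x hx => (hF x hx).continuousAt.continuousWithinAt) (fun x hx => ?_) fun x hx => ?_
    · rw [interior_Ici] at hx
      exact (hF x (le_of_lt hx)).differentiableAt.differentiableWithinAt
    · rw [interior_Ici] at hx
      rw [(hF x (le_of_lt hx)).deriv]; exact h0 x (le_of_lt hx)
  exact this hx (hx.trans hxy) hxy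

/-- Put `w = S - d` and `E = w P`. Then `E' = r P² + w² f² / r ≥ 0` and `(w²)' = 2 r E`. A positive
value of `E` would make `w²` grow like `r²`, against `w / r → 0`; so `E ≤ 0` and `w²` decreases. If
`w²` stayed above some `δ > 0`, then `E' ≥ δ / (2r)` for large `r` and `E` would become positive. -/
theorem GLSystem.tendsto_S {K γ : ℝ} {d : ℤ} {f p S P m q : ℝ → ℝ} (h : GLSystem 1 K γ d f p S P m q)
    (hf : Tendsto f atTop (𝓝 1)) (hv : Tendsto (fun r => (S r - d) / r) atTop (𝓝 0)) :
    Tendsto S atTop (𝓝 d) := by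
  have hE : ∀ r, 0 < r → HasDerivAt (fun r => (S r - d) * P r)
      (r * P r ^ 2 + (S r - d) ^ 2 * f r ^ 2 / r) r := fun r hr => by
    refine (((h.hS r hr).sub_const (d:ℝ)).mul (h.hP r hr)).congr_deriv ?_
    ring
  have hw : ∀ r, 0 < r → HasDerivAt (fun r => (S r - d) ^ 2) (2 * r * ((S r - d) * P r)) r :=
    fun r hr => by
      refine (((h.hS r hr).sub_const (d:ℝ)).pow 2).congr_deriv ?_
      ring
  have hEmono : ∀ x y, 0 < x → x ≤ y → (S x - d) * P x ≤ (S y - d) * P y := fun x y hx hxy =>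
    le_of_hasDerivAt_nonneg (a := x) (fun r hr => hE r (hx.trans_le hr))
      (fun r hr => by have := hx.trans_le hr; positivity) le_rfl hxy
  have hE0 : ∀ r, 0 < r → (S r - d) * P r ≤ 0 := by
    intro s hs
    by_contra hpos
    rw [not_le] at hpos
    set e := (S s - d) * P s with he
    have h1 : ∀ r, s ≤ r → e * (1 - s ^ 2 / r ^ 2) ≤ ((S r - d) / r) ^ 2 := by
      intro r hr
      have hr0 := hs.trans_le hr
      have h2 := le_of_hasDerivAt_nonneg (a := s) (F := fun r => (S r - d) ^ 2 - e * r ^ 2)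
        (F' := fun r => 2 * r * ((S r - d) * P r) - e * (2 * r)) (fun x hx => by
          refine ((hw x (hs.trans_le hx)).sub ((hasDerivAt_pow 2 x).const_mul e)).congr_deriv ?_
          simp) (fun x hx => by
          have := hEmono s x hs hx
          have := hs.trans_le hx
          nlinarith) le_rfl hr
      rw [div_pow, le_div_iff₀ (by positivity)]
      have h3 : e * (1 - s ^ 2 / r ^ 2) * r ^ 2 = e * r ^ 2 - e * s ^ 2 := by field_simp
      rw [h3]
      nlinarith [sq_nonneg (S s - d)]
    have h4 : Tendsto (fun r : ℝ => e * (1 - s ^ 2 / r ^ 2)) atTop (𝓝 (e * (1 - 0))) :=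
      ((tendsto_const_nhds.div_atTop (tendsto_pow_atTop two_ne_zero)).const_sub 1).const_mul e
    have h5 := le_of_tendsto_of_tendsto h4 (hv.pow 2) (by
      filter_upwards [eventually_ge_atTop s] with r hr using h1 r hr)
    simp only [sub_zero, mul_one, ne_eq, OfNat.ofNat_ne_zero, not_false_eq_true, zero_pow] at h5
    linarith
  have hanti : ∀ x y, 0 < x → x ≤ y → (S y - d) ^ 2 ≤ (S x - d) ^ 2 := fun x y hx hxy => by
    have := le_of_hasDerivAt_nonneg (a := x) (fun r hr => (hw r (hx.trans_le hr)).neg)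
      (fun r hr => by
        have h1 := hx.trans_le hr
        have := hE0 r h1
        nlinarith) le_rfl hxy
    simp only [Pi.neg_apply] at this
    linarith
  have hsmall : ∀ δ, 0 < δ → ∃ R, 0 < R ∧ (S R - d) ^ 2 < δ := by
    intro δ hδ
    by_contra hcon
    push Not at hcon
    obtain ⟨R, hR1, hR⟩ := ((eventually_ge_atTop (1:ℝ)).and
      (eventually_atTop.2 (eventually_atTop.1 ((hf.pow 2).eventually
        (lt_mem_nhds (show (1/2:ℝ) < 1 ^ 2 by norm_num))) |>.imp fun a ha => fun b hb c hc =>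
          ha c (hb.trans hc)))).exists
    have hR0 : 0 < R := by linarith
    have key : ∀ r, R ≤ r → (S R - d) * P R + δ / 2 * (Real.log r - Real.log R) ≤ 0 := by
      intro r hr
      have h2 := le_of_hasDerivAt_nonneg (a := R) (F := fun r => (S r - d) * P r - δ / 2 * Real.log r)
        (fun x hx => (hE x (hR0.trans_le hx)).sub
          ((Real.hasDerivAt_log (hR0.trans_le hx).ne').const_mul (δ / 2))) (fun x hx => by
          have hx0 := hR0.trans_le hx
          have e1 := hcon x hx0
          have e2 : 1 / 2 ≤ f x ^ 2 := (hR x hx).le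
          have e3 : δ * (1 / 2) ≤ (S x - d) ^ 2 * f x ^ 2 := by gcongr
          have e4 : δ / 2 * x⁻¹ ≤ (S x - d) ^ 2 * f x ^ 2 / x := by
            rw [div_eq_mul_inv (_ * _)]
            exact mul_le_mul_of_nonneg_right (by linarith) (inv_pos.2 hx0).le
          have : 0 ≤ x * P x ^ 2 := by positivity
          linarith) le_rfl hr
      have := hE0 r (hR0.trans_le hr)
      linarith
    have ht : Tendsto (fun r => (S R - d) * P R + δ / 2 * (Real.log r - Real.log R)) atTop atTop := by
      refine tendsto_atTop_add_const_left _ _ (Tendsto.const_mul_atTop (by linarith) ?_)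
      exact tendsto_atTop_add_const_right _ _ Real.tendsto_log_atTop
    obtain ⟨r, hr, hr'⟩ := ((ht.eventually (eventually_gt_atTop 0)).and (eventually_ge_atTop R)).exists
    linarith [key r hr']
  have h2 : Tendsto (fun r => (S r - d) ^ 2) atTop (𝓝 0) := by
    rw [Metric.tendsto_atTop]
    intro δ hδ
    obtain ⟨R, hR, hR'⟩ := hsmall δ hδ
    refine ⟨R, fun r hr => ?_⟩
    rw [Real.dist_eq, sub_zero, abs_of_nonneg (sq_nonneg _)]
    exact (hanti R r hR hr).trans_lt hR'
  have h3 := h2.sqrt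
  simp only [Real.sqrt_sq_eq_abs, Real.sqrt_zero] at h3
  have h4 := (tendsto_zero_iff_abs_tendsto_zero _).2 h3
  simpa using h4.add_const (d:ℝ)

/-! ### From first order systems to the equations -/

theorem deriv_deriv_eq {f f₁ p k : ℝ → ℝ} (hf : ∀ r, 0 < r → HasDerivAt f (p r / r) r)
    (hp : ∀ r, 0 < r → HasDerivAt p (r * k r) r) (he : ∀ r, 0 < r → f₁ r = f r) {r : ℝ} (hr : 0 < r) :
    deriv f₁ r = p r / r ∧ deriv (deriv f₁) r = k r - 1 / r * deriv f₁ r := by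
  have h1 : ∀ x, 0 < x → deriv f₁ x = p x / x := fun x hx => by
    refine ((hf x hx).congr_of_eventuallyEq ?_).deriv
    filter_upwards [Ioi_mem_nhds hx] with y hy using he y hy
  refine ⟨h1 r hr, ?_⟩
  have h2 : HasDerivAt (deriv f₁) ((r * k r * r - p r * 1) / r ^ 2) r := by
    refine ((hp r hr).div (hasDerivAt_id r) hr.ne').congr_of_eventuallyEq ?_
    filter_upwards [Ioi_mem_nhds hr] with y hy using h1 y hy
  rw [h2.deriv, h1 r hr]
  field_simp

theorem deriv_deriv_eq' {S S₁ P k : ℝ → ℝ} (hS : ∀ r, 0 < r → HasDerivAt S (r * P r) r)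
    (hP : ∀ r, 0 < r → HasDerivAt P (k r) r) (he : ∀ r, 0 < r → S₁ r = S r) {r : ℝ} (hr : 0 < r) :
    deriv (deriv S₁) r = 1 / r * deriv S₁ r + r * k r := by
  have h1 : ∀ x, 0 < x → deriv S₁ x = x * P x := fun x hx => by
    refine ((hS x hx).congr_of_eventuallyEq ?_).deriv
    filter_upwards [Ioi_mem_nhds hx] with y hy using he y hy
  have h2 : HasDerivAt (deriv S₁) (1 * P r + r * k r) r := by
    refine ((hasDerivAt_id r).mul (hP r hr)).congr_of_eventuallyEq ?_
    filter_upwards [Ioi_mem_nhds hr] with y hy using h1 y hy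
  rw [h2.deriv, h1 r hr]
  field_simp

theorem nonneg_of_pos {f f₁ : ℝ → ℝ} (h : ∀ r, 0 < r → 0 < f r) (he : ∀ r, 0 < r → f₁ r = f r)
    (h0 : f₁ 0 = 0) (r : ℝ) (hr : 0 ≤ r) : 0 ≤ f₁ r := by
  rcases hr.eq_or_lt with rfl | hr
  · exact h0.ge
  · rw [he r hr]; exact (h r hr).le

theorem tendsto_zero_congr {f f₁ : ℝ → ℝ} {L : ℝ} (he : ∀ r, 0 < r → f₁ r = f r)
    (h : Tendsto f (𝓝[>] 0) (𝓝 L)) : Tendsto f₁ (𝓝[>] 0) (𝓝 L) := by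
  refine h.congr' ?_
  filter_upwards [self_mem_nhdsWithin] with r hr using (he r hr).symm

theorem tendsto_atTop_congr {f f₁ : ℝ → ℝ} {L : ℝ} (he : ∀ r, 0 < r → f₁ r = f r)
    (h : Tendsto f atTop (𝓝 L)) : Tendsto f₁ atTop (𝓝 L) := by
  refine h.congr' ?_
  filter_upwards [eventually_gt_atTop 0] with r hr using (he r hr).symm

theorem AdmF.integrableOn_sq_div {η f f' : ℝ → ℝ} (hη : IsCutoff η) (hf : AdmF η f f') (ε : ℝ) :
    IntegrableOn (fun r => ε * (f r ^ 2 / r)) (Ioc 0 1) := by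
  have h1 : IntegrableOn (fun r => ((f r - η r) / r) ^ 2 * r) (Ioc 0 1) :=
    integrableOn_of_radial (InX.divsq hf) fun _ hx => hx.1
  refine Integrable.const_mul (IntegrableOn.congr_fun h1 (fun r hr => ?_) measurableSet_Ioc) ε
  have := hr.1
  simp only [hη.eq_zero r ⟨hr.1.le, hr.2⟩, sub_zero]
  field_simp

theorem InH.integrableOn_flux {m m' q : ℝ → ℝ} (hm : InH m m') (hq : ∀ᵐ r, 0 < r → m' r = q r / r) :
    IntegrableOn (fun r => q r ^ 2 / r) (Ioc 0 1) := by
  have h1 : IntegrableOn (fun r => m' r ^ 2 * r) (Ioc 0 1) :=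
    integrableOn_of_radial hm.dsq fun _ hx => hx.1
  refine Integrable.congr h1 ((ae_restrict_iff' measurableSet_Ioc).2 ?_)
  filter_upwards [hq] with r hr hr'
  have := hr'.1
  rw [hr hr'.1]
  field_simp

/-! ### Regularity of minimizers, finite `κ` -/

theorem flip_edens {κ g : ℝ} {d : ℤ} {f f' S S' m m' : ℝ → ℝ} {s : ℝ} (r : ℝ) : edens κ g d (fun r => f r + (-2) * (Iic s).indicator f r)
    (fun r => f' r + (-2) * (Iic s).indicator f' r) S S' m m' r = edens κ g d f f' S S' m m' r := by
  by_cases hr : r ≤ s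
  · simp only [edens, indicator_of_mem (mem_Iic.2 hr)]; ring
  · simp only [edens, indicator_of_notMem (show r ∉ Iic s by simpa using hr)]; ring

section finite

variable {κ g : ℝ} {d : ℤ} {η f f' S S' m m' : ℝ → ℝ} (hη : IsCutoff η)
include hη

theorem exists_isSmoothSolution (hd : d ≠ 0) (hf : AdmF η f f') (hS : AdmS d η S S') (hm : InH m m')
    (hmin : ∀ f₁ f₁' S₁ S₁' m₁ m₁', AdmF η f₁ f₁' → AdmS d η S₁ S₁' → InH m₁ m₁' →
      ∫ r, edens κ g d f f' S S' m m' r ∂radialMeasure ≤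
        ∫ r, edens κ g d f₁ f₁' S₁ S₁' m₁ m₁' r ∂radialMeasure) :
    ∃ f₁ S₁ m₁ : ℝ → ℝ, (∀ r, 0 < r → f₁ r = f r) ∧ (∀ r, 0 < r → S₁ r = S r) ∧
      (∀ r, 0 < r → m₁ r = m r) ∧ IsSmoothSolution κ g d f₁ S₁ m₁ := by
  obtain ⟨p, hfp, hp⟩ := exists_flux_f hη hf hS hm fun f₁ f₁' h => hmin _ _ _ _ _ _ h hS hm
  obtain ⟨P, hSP, hP⟩ := exists_flux_S hη hf hS hm fun S₁ S₁' h => hmin _ _ _ _ _ _ hf h hm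
  obtain ⟨q, hmq, hq, hqe⟩ := exists_flux_m hη hf hS hm fun m₁ m₁' h => hmin _ _ _ _ _ _ hf hS h
  have hsys : GLSystem 1 (κ ^ 2) (κ ^ 2 * g) d f p S P m q := ⟨hfp, hp, hSP, hP, hmq, hq⟩
  have f0 := hf.tendsto_zero hη
  have S0 := hS.tendsto_zero hη
  obtain ⟨A, -, hA⟩ := hm.prim.pow_four_le hm.dsq
  obtain ⟨f₁, S₁, m₁, hf₁, hS₁, hm₁, ef, eS, em, hf10, hm10⟩ := hsys.exists_smooth hd f0 S0
    (hf.integrableOn_sq_div hη 1) hA (hm.integrableOn_flux hqe)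
  have hpos : ∀ r, 0 < r → 0 < f r := by
    refine pos_of_flip (V := fun r => (d - S r) ^ 2 / r ^ 2 - κ ^ 2 * (1 - f r ^ 2 - m r ^ 2)) ?_
      (hf.tendsto_atTop hη) ⟨p, hfp, hp⟩ fun s hs hs0 => ?_
    · have := hsys.cont_S
      have := hsys.cont_f
      have := hsys.cont_m
      exact (ContinuousOn.div (by fun_prop) (by fun_prop) fun x hx => pow_ne_zero 2 (ne_of_gt hx)).sub
        (by fun_prop)
    -- The reflected function has the same density at every point, so it is a minimizer too and
    -- satisfies the same first order system.
    · obtain ⟨p', hp', -⟩ := exists_flux_f (κ := κ) (g := g) hη (hf.flip hη hs hs0) hS hm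
        fun f₁ f₁' h => by
          simp only [flip_edens]
          exact hmin _ _ _ _ _ _ h hS hm
      exact ⟨p', hp'⟩
  have hv : Tendsto (fun r => (S r - d) / r) atTop (𝓝 0) := by
    refine (InX.toInH hS).tendsto_atTop.congr' ?_
    filter_upwards [eventually_ge_atTop 2] with r hr
    rw [hη.eq_one r hr, mul_one]
  refine ⟨f₁, S₁, m₁, ef, eS, em, hf₁.contDiffOn, hS₁.contDiffOn, hm₁.contDiffOn, fun r hr => ?_,
    fun r hr => ?_, fun r hr => ?_, nonneg_of_pos hpos ef hf10, tendsto_zero_congr ef f0,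
    tendsto_zero_congr eS S0, hm10.hasDerivWithinAt.derivWithin (uniqueDiffOn_Ici 0 0 self_mem_Ici),
    tendsto_atTop_congr ef (hf.tendsto_atTop hη),
    tendsto_atTop_congr eS (hsys.tendsto_S (hf.tendsto_atTop hη) hv),
    tendsto_atTop_congr em hm.tendsto_atTop⟩
  · rw [(deriv_deriv_eq hfp hp ef hr).2, ef r hr, eS r hr, em r hr]; ring
  · rw [deriv_deriv_eq' hSP hP eS hr, ef r hr, eS r hr]
    have := hr.ne'
    field_simp; ring
  · rw [(deriv_deriv_eq hmq hq em hr).2, ef r hr, em r hr]; ring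

end finite

/-! ### Regularity of minimizers, `κ = ∞` -/

theorem flip_edensInf {g : ℝ} {d : ℤ} {η f f' m m' : ℝ → ℝ} {s : ℝ} (r : ℝ) : edensInf g d η (fun r => f r + (-2) * (Iic s).indicator f r)
    (fun r => f' r + (-2) * (Iic s).indicator f' r) m m' r = edensInf g d η f f' m m' r := by
  by_cases hr : r ≤ s
  · simp only [edensInf, indicator_of_mem (mem_Iic.2 hr)]; ring
  · simp only [edensInf, indicator_of_notMem (show r ∉ Iic s by simpa using hr)]; ring

section infinite

variable {g : ℝ} {d : ℤ} {η f f' m m' : ℝ → ℝ} (hη : IsCutoff η)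
include hη

theorem pos_of_min_inf (hf : AdmF η f f') (hm : InH m m')
    (hmin : ∀ f₁ f₁', AdmF η f₁ f₁' →
      ∫ r, edensInf g d η f f' m m' r ∂radialMeasure ≤
        ∫ r, edensInf g d η f₁ f₁' m m' r ∂radialMeasure) : ∀ r, 0 < r → 0 < f r := by
  obtain ⟨p, hfp, hp⟩ := exists_fluxInf_f hη hf hm hmin
  have cf := (hf.prim hη).continuousOn
  have cm := hm.prim.continuousOn
  refine pos_of_flip (V := fun r => ((d:ℝ) - 0) ^ 2 / r ^ 2 - 1 * (1 - f r ^ 2 - m r ^ 2)) ?_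
    (hf.tendsto_atTop hη) ⟨p, hfp, hp⟩ fun s hs hs0 => ?_
  · exact (ContinuousOn.div (by fun_prop) (by fun_prop) fun x hx => pow_ne_zero 2 (ne_of_gt hx)).sub
      (by fun_prop)
  · obtain ⟨p', hp', -⟩ := exists_fluxInf_f (g := g) (d := d) hη (hf.flip hη hs hs0) hm
      fun f₁ f₁' h => by
        simp only [flip_edensInf]
        exact hmin _ _ h
    exact ⟨p', hp'⟩

theorem exists_isSmoothSolutionInf (hd : d ≠ 0) (hf : AdmF η f f') (hm : InH m m')
    (hmin : ∀ f₁ f₁' m₁ m₁', AdmF η f₁ f₁' → InH m₁ m₁' →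
      ∫ r, edensInf g d η f f' m m' r ∂radialMeasure ≤
        ∫ r, edensInf g d η f₁ f₁' m₁ m₁' r ∂radialMeasure) :
    ∃ f₁ m₁ : ℝ → ℝ, (∀ r, 0 < r → f₁ r = f r) ∧
      (∀ r, 0 < r → m₁ r = m r) ∧ IsSmoothSolutionInf g d f₁ m₁ := by
  obtain ⟨p, hfp, hp⟩ := exists_fluxInf_f hη hf hm fun f₁ f₁' h => hmin _ _ _ _ h hm
  obtain ⟨q, hmq, hq, hqe⟩ := exists_fluxInf_m hη hf hm fun m₁ m₁' h => hmin _ _ _ _ hf h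
  have hsys : GLSystem 0 1 g d f p (fun _ => 0) (fun _ => 0) m q :=
    ⟨hfp, hp, fun r _ => by simpa using hasDerivAt_const r (0:ℝ),
      fun r _ => by simpa using hasDerivAt_const r (0:ℝ), hmq, hq⟩
  have f0 := hf.tendsto_zero hη
  obtain ⟨A, -, hA⟩ := hm.prim.pow_four_le hm.dsq
  obtain ⟨f₁, S₁, m₁, hf₁, hS₁, hm₁, ef, eS, em, hf10, hm10⟩ := hsys.exists_smooth hd f0
    tendsto_const_nhds (hf.integrableOn_sq_div hη 0) hA (hm.integrableOn_flux hqe)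
  have hpos := pos_of_min_inf hη hf hm fun f₁ f₁' h => hmin _ _ _ _ h hm
  refine ⟨f₁, m₁, ef, em, hf₁.contDiffOn, hm₁.contDiffOn, fun r hr => ?_,
    fun r hr => ?_, nonneg_of_pos hpos ef hf10, tendsto_zero_congr ef f0,
    hm10.hasDerivWithinAt.derivWithin (uniqueDiffOn_Ici 0 0 self_mem_Ici),
    tendsto_atTop_congr ef (hf.tendsto_atTop hη), tendsto_atTop_congr em hm.tendsto_atTop⟩
  · rw [(deriv_deriv_eq hfp hp ef hr).2, ef r hr, em r hr]; ring
  · rw [(deriv_deriv_eq hmq hq em hr).2, ef r hr, em r hr]; ring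

end infinite

/-! ### Weak compactness and lower semicontinuity -/

/-- Sequential Banach–Alaoglu in the dual, carried back by the Riesz isomorphism. -/
theorem exists_weak_limit {E : Type*} [NormedAddCommGroup E] [InnerProductSpace ℝ E] [CompleteSpace E]
    [TopologicalSpace.SeparableSpace E] (x : ℕ → E) {C : ℝ} (hC : ∀ n, ‖x n‖ ≤ C) :
    ∃ y : E, ∃ φ : ℕ → ℕ, StrictMono φ ∧
      ∀ z, Tendsto (fun n => inner ℝ (x (φ n)) z) atTop (𝓝 (inner ℝ y z)) := by
  have hc := WeakDual.isSeqCompact_closedBall ℝ E 0 C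
  obtain ⟨a, -, φ, hφ, ha⟩ := hc (x := fun n =>
    WeakDual.toStrongDual.symm (InnerProductSpace.toDual ℝ E (x n))) (fun n => by
      simpa using hC n)
  refine ⟨(InnerProductSpace.toDual ℝ E).symm (WeakDual.toStrongDual a), φ, hφ, fun z => ?_⟩
  have h1 := ((WeakDual.eval_continuous z).tendsto a).comp ha
  rw [InnerProductSpace.toDual_symm_apply]
  exact h1

theorem exists_weak_limit_memLp (w : ℕ → ℝ → ℝ) (hw : ∀ n, MemLp (w n) 2 radialMeasure) {C : ℝ}
    (hC : ∀ n, ∫ r, w n r ^ 2 ∂radialMeasure ≤ C) :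
    ∃ z, MemLp z 2 radialMeasure ∧ ∃ φ : ℕ → ℕ, StrictMono φ ∧ ∀ y, MemLp y 2 radialMeasure →
      Tendsto (fun n => ∫ r, w (φ n) r * y r ∂radialMeasure) atTop
        (𝓝 (∫ r, z r * y r ∂radialMeasure)) := by
  have : Fact ((2:ENNReal) ≠ ⊤) := ⟨ENNReal.ofNat_ne_top⟩
  have : SFinite radialMeasure := by unfold radialMeasure; infer_instance
  have hin : ∀ a b : ℝ → ℝ, ∀ (ha : MemLp a 2 radialMeasure) (hb : MemLp b 2 radialMeasure),
      inner ℝ (ha.toLp a) (hb.toLp b) = ∫ r, a r * b r ∂radialMeasure := by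
    intro a b ha hb
    rw [L2.inner_def]
    refine integral_congr_ae ?_
    filter_upwards [ha.coeFn_toLp, hb.coeFn_toLp] with r h1 h2
    rw [h1, h2]; simp [mul_comm]
  obtain ⟨y, φ, hφ, h⟩ := exists_weak_limit (fun n => (hw n).toLp (w n)) (C := √C) (fun n => by
    rw [@norm_eq_sqrt_real_inner, hin]
    refine Real.sqrt_le_sqrt ?_
    simpa only [← sq] using hC n)
  refine ⟨y, Lp.memLp y, φ, hφ, fun b hb => ?_⟩
  have := h (hb.toLp b)
  simp only [hin] at this
  convert this using 2
  rw [← hin _ _ (Lp.memLp y) hb, Lp.toLp_coeFn]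

theorem memLp_indicator_Ioc {c : ℝ → ℝ} (hc : ContinuousOn c (Ioi 0)) {a b : ℝ} (ha : 0 < a) :
    MemLp ((Ioc a b).indicator c) 2 radialMeasure := by
  have hm := (aesm_of_continuousOn hc).indicator (measurableSet_Ioc (a := a) (b := b))
  obtain ⟨C, hC⟩ := (isCompact_Icc (a := a) (b := b)).exists_bound_of_continuousOn
    (hc.mono fun x hx => lt_of_lt_of_le ha hx.1)
  refine (memLp_two_radial hm).2 (((integrable_indicator_radial a b).const_mul (C ^ 2)).mono' (hm.pow 2)
    (Eventually.of_forall fun r => ?_))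
  rw [Real.norm_eq_abs, abs_of_nonneg (sq_nonneg _)]
  by_cases hr : r ∈ Ioc a b
  · rw [indicator_of_mem hr, indicator_of_mem hr, mul_one]
    exact sq_le_sq.2 ((hC r (Ioc_subset_Icc_self hr)).trans (le_abs_self C))
  · rw [indicator_of_notMem hr, indicator_of_notMem hr]; simp

/-- Compactness: derivatives converge weakly, the functions converge pointwise. -/
theorem exists_subseq_isPrim {ρ : ℝ → ℝ} (hρ : ContinuousOn ρ (Ioi 0)) (hρ0 : ∀ r, 0 < r → ρ r ≠ 0)
    (u w : ℕ → ℝ → ℝ) (hu : ∀ n, IsPrim (u n) (w n))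
    (hw : ∀ n, MemLp (fun r => w n r / ρ r) 2 radialMeasure) {C D : ℝ}
    (hC : ∀ n, ∫ r, (w n r / ρ r) ^ 2 ∂radialMeasure ≤ C) (hD : ∀ n, |u n 1| ≤ D) :
    ∃ v z, MemLp z 2 radialMeasure ∧ IsPrim v (fun r => ρ r * z r) ∧ ∃ φ : ℕ → ℕ, StrictMono φ ∧
      (∀ r, 0 < r → Tendsto (fun n => u (φ n) r) atTop (𝓝 (v r))) ∧
      ∀ y, MemLp y 2 radialMeasure → Tendsto (fun n => ∫ r, (w (φ n) r / ρ r) * y r ∂radialMeasure)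
        atTop (𝓝 (∫ r, z r * y r ∂radialMeasure)) := by
  obtain ⟨z, hz, φ, hφ, h1⟩ := exists_weak_limit_memLp _ hw hC
  obtain ⟨c, -, ψ, hψ, h2⟩ := (isCompact_Icc (a := -D) (b := D)).isSeqCompact
    (x := fun n => u (φ n) 1) (fun n => abs_le.1 (hD (φ n)))
  have hzl : LocallyIntegrableOn (fun r => ρ r * z r) (Ioi 0) := by
    have := LocallyIntegrableOn.mul_cont (locallyIntegrableOn_of_sq hz.1 hz.integrable_sq) hρ
    simpa only [mul_comm] using this
  -- An increment over `[a, b]` is a pairing in `L²(r dr)` with a fixed function, so weak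
  -- convergence of the derivatives gives convergence of increments.
  have key : ∀ a b, 0 < a → a ≤ b → ∀ x : ℝ → ℝ, ∫ t in a..b, ρ t * x t =
      ∫ r, x r * (Ioc a b).indicator (fun t => ρ t / t) r ∂radialMeasure := by
    intro a b ha hab x
    rw [integral_radial, intervalIntegral.integral_of_le hab, ← integral_indicator measurableSet_Ioc,
      ← integral_indicator measurableSet_Ioi]
    congr 1; ext r
    by_cases hr : r ∈ Ioc a b
    · have hr0 : 0 < r := ha.trans hr.1
      rw [indicator_of_mem hr, indicator_of_mem (mem_Ioi.2 hr0), indicator_of_mem hr]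
      field_simp
    · rw [indicator_of_notMem hr]
      by_cases hr0 : r ∈ Ioi (0:ℝ)
      · rw [indicator_of_mem hr0, indicator_of_notMem hr]; simp
      · rw [indicator_of_notMem hr0]
  have hlim : ∀ a b, 0 < a → 0 < b →
      Tendsto (fun n => ∫ t in a..b, w (φ n) t) atTop (𝓝 (∫ t in a..b, ρ t * z t)) := by
    have hle : ∀ a b, 0 < a → a ≤ b →
        Tendsto (fun n => ∫ t in a..b, w (φ n) t) atTop (𝓝 (∫ t in a..b, ρ t * z t)) := by
      intro a b ha hab
      rw [key a b ha hab]
      refine (h1 _ (memLp_indicator_Ioc (hρ.div continuousOn_id fun x hx => ne_of_gt hx) ha)).congr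
        fun n => ?_
      have := key a b ha hab (fun r => w (φ n) r / ρ r)
      refine Eq.trans ?_ (this.symm.trans ?_)
      · rfl
      · refine intervalIntegral.integral_congr fun t ht => ?_
        have := hρ0 t (uIcc_subset_Ioi ha (ha.trans_le hab) ht)
        field_simp
    intro a b ha hb
    rcases le_total a b with h | h
    · exact hle a b ha h
    · have := (hle b a hb h).neg
      simp only [← intervalIntegral.integral_symm] at this
      exact this
  refine ⟨fun r => c + ∫ t in (1:ℝ)..r, ρ t * z t, z, hz,
    IsPrim.of_locallyIntegrableOn hzl c 1 one_pos, φ ∘ ψ, hφ.comp hψ, fun r hr => ?_, fun y hy =>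
      (h1 y hy).comp hψ.tendsto_atTop⟩
  have h3 := h2.add ((hlim 1 r one_pos hr).comp hψ.tendsto_atTop)
  refine h3.congr fun n => ?_
  exact ((hu _).eq_add one_pos hr).symm

/-- Fatou's lemma with convergent upper bounds `c n`. These will be the energies minus lower bounds
for the derivative terms. -/
theorem integrable_of_tendsto_of_le {h : ℕ → ℝ → ℝ} {k : ℝ → ℝ} {c : ℕ → ℝ} {L : ℝ}
    (hi : ∀ n, Integrable (h n) radialMeasure) (h0 : ∀ n r, 0 < r → 0 ≤ h n r)
    (hk : ∀ r, 0 < r → Tendsto (fun n => h n r) atTop (𝓝 (k r)))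
    (hc : ∀ n, ∫ r, h n r ∂radialMeasure ≤ c n) (hL : Tendsto c atTop (𝓝 L)) :
    Integrable k radialMeasure ∧ ∫ r, k r ∂radialMeasure ≤ L := by
  have hkm : AEStronglyMeasurable k radialMeasure :=
    aestronglyMeasurable_of_tendsto_ae atTop (fun n => (hi n).1) (ae_radial_of_forall hk)
  have hk0 : 0 ≤ᵐ[radialMeasure] k := ae_radial_of_forall fun r hr =>
    ge_of_tendsto' (hk r hr) fun n => h0 n r hr
  have h1 : ∫⁻ r, ENNReal.ofReal (k r) ∂radialMeasure ≤ ENNReal.ofReal L := by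
    calc ∫⁻ r, ENNReal.ofReal (k r) ∂radialMeasure
        = ∫⁻ r, liminf (fun n => ENNReal.ofReal (h n r)) atTop ∂radialMeasure := by
          refine lintegral_congr_ae (ae_radial_of_forall fun r hr => ?_)
          exact ((ENNReal.continuous_ofReal.tendsto _).comp (hk r hr)).liminf_eq.symm
      _ ≤ liminf (fun n => ∫⁻ r, ENNReal.ofReal (h n r) ∂radialMeasure) atTop :=
          lintegral_liminf_le' fun n => (hi n).1.aemeasurable.ennreal_ofReal
      _ ≤ liminf (fun n => ENNReal.ofReal (c n)) atTop := by
          refine liminf_le_liminf (Eventually.of_forall fun n => ?_)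
          rw [← ofReal_integral_eq_lintegral_ofReal (hi n)
            (ae_radial_of_forall fun r hr => h0 n r hr)]
          exact ENNReal.ofReal_le_ofReal (hc n)
      _ = ENNReal.ofReal L := ((ENNReal.continuous_ofReal.tendsto _).comp hL).liminf_eq
  have hki : Integrable k radialMeasure :=
    (lintegral_ofReal_ne_top_iff_integrable hkm hk0).1 (ne_top_of_le_ne_top ENNReal.ofReal_ne_top h1)
  refine ⟨hki, ?_⟩
  rw [← ofReal_integral_eq_lintegral_ofReal hki hk0] at h1
  have hLn : 0 ≤ L := ge_of_tendsto' hL fun n =>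
    (integral_nonneg_of_ae (ae_radial_of_forall fun r hr => h0 n r hr)).trans (hc n)
  exact (ENNReal.ofReal_le_ofReal_iff hLn).1 h1

/-- Replaces lower semicontinuity of the norm: the left side is affine in `w`, so it passes to a
weak limit, and at `w = z` it equals `∫ z²`. -/
theorem two_mul_integral_sub_le {w z : ℝ → ℝ} (hw : MemLp w 2 radialMeasure)
    (hz : MemLp z 2 radialMeasure) : 2 * (∫ r, w r * z r ∂radialMeasure) -
      ∫ r, z r ^ 2 ∂radialMeasure ≤ ∫ r, w r ^ 2 ∂radialMeasure := by
  have hwz : Integrable (fun r => w r * z r) radialMeasure := hw.integrable_mul hz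
  rw [← integral_const_mul, ← integral_sub (hwz.const_mul 2) hz.integrable_sq]
  refine integral_mono ((hwz.const_mul 2).sub hz.integrable_sq) hw.integrable_sq fun r => ?_
  simp only
  nlinarith [sq_nonneg (w r - z r)]

/-! ### Uniform bounds along sequences of bounded energy -/

/-- Averaging over `[1, 2]` the inequality `u(1)² ≤ 2 u(r)² + 2 (u(1) - u(r))²`, whose last square
is at most `A`. -/
theorem IsPrim.sq_one_le {u w b : ℝ → ℝ} (h : IsPrim u w) {A B : ℝ}
    (hw : Integrable (fun r => w r ^ 2) radialMeasure) (hA : ∫ r, w r ^ 2 ∂radialMeasure ≤ A)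
    (hb : Integrable b radialMeasure) (hb0 : ∀ r, 0 < r → 0 ≤ b r)
    (hu : ∀ r, 0 < r → u r ^ 2 ≤ B + b r) :
    u 1 ^ 2 ≤ 2 * A + 2 * B + 2 * ∫ r, b r ∂radialMeasure := by
  have h1 : ∀ r ∈ Icc (1:ℝ) 2, (u 1 ^ 2 - 2 * A - 2 * B) ≤ 2 * (b r * r) := by
    intro r hr
    have hr0 : 0 < r := by linarith [hr.1]
    have h2 := h.sq_sub_le hw one_pos hr.1
    have hA0 : 0 ≤ A := (integral_nonneg fun r => sq_nonneg _).trans hA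
    have h3 : (∫ r, w r ^ 2 ∂radialMeasure) * ((r - 1) / 1) ≤ A * 1 := by
      refine mul_le_mul hA ?_ ?_ hA0
      · linarith [hr.2]
      · linarith [hr.1]
    have h4 := hu r hr0
    have h5 : b r ≤ b r * r := le_mul_of_one_le_right (hb0 r hr0) hr.1
    nlinarith [sq_nonneg (u 1 - 2 * u r)]
  have hi := intervalIntegrable_of_radial hb zero_le_one one_le_two
  have h6 := intervalIntegral.integral_mono_on (one_le_two (α := ℝ))
    (intervalIntegrable_const (c := u 1 ^ 2 - 2 * A - 2 * B)) (hi.const_mul 2) h1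
  rw [intervalIntegral.integral_const, intervalIntegral.integral_const_mul] at h6
  have h7 := setIntegral_interval_le_radial hb hb0 zero_le_one one_le_two
  simp only [smul_eq_mul] at h6
  linarith

/-- A uniform lower bound at infinity. -/
theorem IsPrim.half_le {f w b : ℝ → ℝ} (h : IsPrim f w) {A B : ℝ}
    (hw : Integrable (fun r => w r ^ 2) radialMeasure) (hA : ∫ r, w r ^ 2 ∂radialMeasure ≤ A)
    (hb : Integrable b radialMeasure) (hb0 : ∀ r, 0 < r → 0 ≤ b r)
    (hB : ∫ r, b r ∂radialMeasure ≤ B)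
    (hfb : ∀ r, 0 < r → |f r| ≤ 3 / 4 → 49 / 1024 ≤ b r) (hf1 : Tendsto f atTop (𝓝 1)) :
    ∀ r, 16 * A + 21 * B + 1 ≤ r → 1 / 2 ≤ f r := by
  have hA0 : 0 ≤ A := (integral_nonneg fun r => sq_nonneg _).trans hA
  have hB0 : 0 ≤ B := (integral_nonneg_of_ae (ae_radial_of_forall hb0)).trans hB
  -- If `|f s| < 1/2`, then `A / s ≤ 1/16` keeps `|f| ≤ 3/4` on `[s, s + 1]`, which costs `∫ b r ≥
  -- 49 s / 1024`. This exceeds `B` because `21 · 49 > 1024`.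
  have habs : ∀ s, 16 * A + 21 * B + 1 ≤ s → 1 / 2 ≤ |f s| := by
    intro s hs
    have hs0 : 0 < s := by linarith
    by_contra hlt
    rw [not_le] at hlt
    have h1 : ∀ r ∈ Icc s (s + 1), 49 / 1024 * s ≤ b r * r := by
      intro r hr
      have hr0 : 0 < r := by linarith [hr.1]
      have h2 := h.sq_sub_le hw hs0 hr.1
      have h3 : (∫ r, w r ^ 2 ∂radialMeasure) * ((r - s) / s) ≤ 1 / 16 := by
        have : (∫ r, w r ^ 2 ∂radialMeasure) * ((r - s) / s) ≤ A * (1 / s) := by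
          refine mul_le_mul hA ?_ ?_ hA0
          · exact div_le_div_of_nonneg_right (by linarith [hr.2]) hs0.le
          · exact div_nonneg (by linarith [hr.1]) hs0.le
        refine this.trans ?_
        rw [mul_one_div, div_le_iff₀ hs0]; linarith
      have h4 : |f r - f s| ≤ 1 / 4 := abs_le_of_sq_le_sq (by linarith) (by norm_num)
      have h5 : |f r| ≤ 3 / 4 := by
        have := abs_sub_abs_le_abs_sub (f r) (f s)
        linarith
      have h6 := hfb r hr0 h5
      nlinarith [hr.1]
    have hi := intervalIntegrable_of_radial hb hs0.le (by linarith : s ≤ s + 1)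
    have h6 := intervalIntegral.integral_mono_on (by linarith : s ≤ s + 1)
      (intervalIntegrable_const (c := 49 / 1024 * s)) hi h1
    rw [intervalIntegral.integral_const] at h6
    have h7 := setIntegral_interval_le_radial hb hb0 hs0.le (by linarith : s ≤ s + 1)
    simp only [smul_eq_mul] at h6
    linarith
  intro r hr
  have hr0 : 0 < r := by linarith
  by_contra hlt
  rw [not_le] at hlt
  have hneg : f r ≤ 0 := by
    have := habs r hr
    rcases le_abs.1 this with h' | h' <;> linarith
  obtain ⟨R, hR, hR'⟩ := ((hf1.eventually (lt_mem_nhds (zero_lt_one' ℝ))).and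
    (eventually_ge_atTop r)).exists
  obtain ⟨s, hs, hs0⟩ := intermediate_value_Icc hR'
    (h.continuousOn.mono fun x hx => hr0.trans_le hx.1) ⟨hneg, hR.le⟩
  have := habs s (hr.trans hs.1)
  rw [hs0, abs_zero] at this
  linarith

/-! ### Finite energy implies membership in the affine classes -/

theorem InX.congr {u v w z : ℝ → ℝ} (h : InX u w) (hu : ∀ r, 0 < r → u r = v r)
    (hw : ∀ r, 0 < r → w r = z r) : InX v z := by
  refine ⟨⟨(h.prim.congr_deriv (Eventually.of_forall hw)).congr_fun hu, ?_, ?_⟩, ?_⟩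
  · exact h.sq.congr (ae_radial_of_forall fun r hr => by simp only [hu r hr])
  · exact h.dsq.congr (ae_radial_of_forall fun r hr => by simp only [hw r hr])
  · exact h.divsq.congr (ae_radial_of_forall fun r hr => by simp only [hu r hr])

/-- Far out, `f ≥ 1/2` gives `(f - 1)² ≤ (1 - f²)² ≤ 2 (1 - f² - m²)² + 2 m⁴`. Near the origin `η =
0`, and `c` bounds `(f / r)²`; for `r ≥ δ` dividing by `r` costs only a constant. -/
theorem admF_of_bounds {η f z m m' c : ℝ → ℝ} (hη : IsCutoff η) (hf : IsPrim f z)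
    (hz : MemLp z 2 radialMeasure) (hm : InH m m')
    (hq : Integrable (fun r => (1 - f r ^ 2 - m r ^ 2) ^ 2) radialMeasure) {R δ : ℝ}
    (hR : ∀ r, R ≤ r → 1 / 2 ≤ f r) (hδ : 0 < δ) (hδ1 : δ ≤ 1) (hc : Integrable c radialMeasure)
    (hc0 : ∀ r, 0 < r → 0 ≤ c r) (hfc : ∀ r, 0 < r → r < δ → (f r / r) ^ 2 ≤ c r) : AdmF η f z := by
  have hp := hf.sub hη.isPrim
  have hsq : Integrable (fun r => (f r - η r) ^ 2) radialMeasure := by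
    refine ((((integrable_indicator_radial 0 (max R 2)).const_mul 6).add (hq.const_mul 2)).add
      (hm.memLp_sq.integrable_sq.const_mul 2)).mono' (hp.aesm.pow 2) (ae_radial_of_forall fun r hr => ?_)
    rw [Real.norm_eq_abs, abs_of_nonneg (sq_nonneg _)]
    simp only [Pi.add_apply]
    by_cases h : r ∈ Ioc 0 (max R 2)
    · rw [indicator_of_mem h]
      have h1 := hη.mem_Icc r hr.le
      nlinarith [sq_nonneg (m r), sq_nonneg (m r ^ 2), sq_nonneg (f r + η r),
        sq_nonneg (1 - f r ^ 2 - m r ^ 2 + 1), h1.1, h1.2]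
    · rw [indicator_of_notMem h, mul_zero, zero_add]
      have h2 : max R 2 < r := by by_contra h'; exact h ⟨hr, not_lt.1 h'⟩
      have h3 := hR r ((le_max_left _ _).trans h2.le)
      rw [hη.eq_one r (mem_Ici.2 ((le_max_right R 2).trans h2.le))]
      have h4 : (f r - 1) ^ 2 ≤ (1 - f r ^ 2) ^ 2 := by
        have : (1 - f r ^ 2) ^ 2 = (f r - 1) ^ 2 * (1 + f r) ^ 2 := by ring
        rw [this]
        exact le_mul_of_one_le_right (sq_nonneg _) (by nlinarith)
      nlinarith [sq_nonneg ((1 - f r ^ 2 - m r ^ 2) - m r ^ 2)]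
  refine ⟨⟨hp, hsq, (hz.sub hη.memLp_deriv).integrable_sq⟩, ?_⟩
  refine (hc.add (hsq.const_mul (1 / δ ^ 2))).mono' (hp.aesm_div.pow 2) (ae_radial_of_forall fun r hr => ?_)
  rw [Real.norm_eq_abs, abs_of_nonneg (sq_nonneg _)]
  simp only [Pi.add_apply]
  rcases lt_or_ge r δ with h | h
  · rw [hη.eq_zero r ⟨hr.le, h.le.trans hδ1⟩, sub_zero]
    have : 0 ≤ 1 / δ ^ 2 * f r ^ 2 := by positivity
    linarith [hfc r hr h]
  · have h1 : ((f r - η r) / r) ^ 2 ≤ 1 / δ ^ 2 * (f r - η r) ^ 2 := by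
      rw [div_pow, div_eq_inv_mul, ← one_div]
      have : 1 / r ^ 2 ≤ 1 / δ ^ 2 := one_div_le_one_div_of_le (by positivity) (by gcongr)
      gcongr
    linarith [hc0 r hr]

theorem integrable_indicator_Ioc {h : ℝ → ℝ} (hc : ContinuousOn h (Ioi 0)) {a b : ℝ} (ha : 0 < a) :
    Integrable ((Ioc a b).indicator h) radialMeasure := by
  obtain ⟨D, hD⟩ := (isCompact_Icc (a := a) (b := b)).exists_bound_of_continuousOn
    (hc.mono fun x hx => lt_of_lt_of_le ha hx.1)
  refine ((integrable_indicator_radial a b).const_mul D).mono'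
    ((aesm_of_continuousOn hc).indicator measurableSet_Ioc) (Eventually.of_forall fun r => ?_)
  by_cases hr : r ∈ Ioc a b
  · rw [indicator_of_mem hr, indicator_of_mem hr, mul_one]
    exact hD r (Ioc_subset_Icc_self hr)
  · rw [indicator_of_notMem hr, indicator_of_notMem hr]; simp

theorem integral_indicator_Ioc {h : ℝ → ℝ} {a b : ℝ} (ha : 0 ≤ a) (hab : a ≤ b) :
    ∫ r, (Ioc a b).indicator h r ∂radialMeasure = ∫ r in a..b, h r * r := by
  rw [integral_radial, intervalIntegral.integral_of_le hab, ← integral_indicator measurableSet_Ioc,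
    ← integral_indicator measurableSet_Ioi]
  congr 1; ext r
  by_cases hr : r ∈ Ioc a b
  · rw [indicator_of_mem hr, indicator_of_mem (mem_Ioi.2 (ha.trans_lt hr.1)), indicator_of_mem hr]
  · rw [indicator_of_notMem hr]
    by_cases hr0 : r ∈ Ioi (0:ℝ)
    · rw [indicator_of_mem hr0, indicator_of_notMem hr, zero_mul]
    · rw [indicator_of_notMem hr0]

theorem integrable_of_interval_bound {h : ℝ → ℝ} (hc : ContinuousOn h (Ioi 0))
    (h0 : ∀ r, 0 < r → 0 ≤ h r) {C : ℝ}
    (hC : ∀ a b, 0 < a → a ≤ b → ∫ r in a..b, h r * r ≤ C) : Integrable h radialMeasure := by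
  have hn : ∀ n : ℕ, (0:ℝ) < 1 / (n + 1) := fun n => by positivity
  refine (integrable_of_tendsto_of_le (L := C) (h := fun n : ℕ =>
    (Ioc ((1:ℝ) / (n + 1)) (n + 1)).indicator h) (c := fun _ => C)
    (fun n => integrable_indicator_Ioc hc (hn n)) (fun n r hr => ?_)
    (fun r hr => ?_) (fun n => ?_) tendsto_const_nhds).1
  · exact indicator_apply_nonneg fun _ => h0 r hr
  · refine tendsto_const_nhds.congr' ?_
    have h1 : ∀ᶠ n : ℕ in atTop, (1:ℝ) / (n + 1) < r :=
      tendsto_one_div_add_atTop_nhds_zero_nat.eventually (gt_mem_nhds hr)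
    have h2 : ∀ᶠ n : ℕ in atTop, r ≤ (n:ℝ) :=
      tendsto_natCast_atTop_atTop.eventually (eventually_ge_atTop r)
    filter_upwards [h1, h2] with n h3 h4
    rw [indicator_of_mem]
    exact ⟨h3, by linarith⟩
  · have hn1 : (1:ℝ) / (n + 1) ≤ n + 1 := by
      rw [div_le_iff₀ (by positivity)]
      have : (0:ℝ) ≤ n := Nat.cast_nonneg n
      nlinarith
    rw [integral_indicator_Ioc (hn n).le hn1]
    exact hC _ _ (hn n) hn1

/-- For `v = (S - dη) / r` put `y = (S' - dη') / r = v' + v / r`, which lies in `L²(r dr)`. Then `(v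
/ r)² r + 2 v v' ≤ y² r`; integrating, with `v` bounded, gives the Hardy bound for `v / r` and hence
`v' ∈ L²(r dr)`. Far out, `f ≥ 1/2` gives `v² ≤ 4 (d - S)² f² / r²`. -/
theorem admS_of_bounds {d : ℤ} {η f S z : ℝ → ℝ} (hη : IsCutoff η)
    (hS : IsPrim S fun r => r * z r)
    (hz : MemLp z 2 radialMeasure) {B : ℝ} (hB : ∀ r, 0 < r → |S r| ≤ B * r)
    (hq : Integrable (fun r => (d - S r) ^ 2 * f r ^ 2 / r ^ 2) radialMeasure) {R : ℝ}
    (hR : ∀ r, R ≤ r → 1 / 2 ≤ f r) : AdmS d η S fun r => r * z r := by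
  have hinv : IsPrim (fun r => r⁻¹) (fun r => -(r ^ 2)⁻¹) := by
    refine IsPrim.of_hasDerivAt (fun r hr => hasDerivAt_inv hr.ne') ?_
    exact ((continuousOn_id.pow 2).inv₀ fun x hx => pow_ne_zero 2 (ne_of_gt hx)).neg
  have hp : IsPrim (fun r => (S r - d * η r) / r)
      (fun r => (r * z r - d * deriv η r) / r - (S r - d * η r) / r ^ 2) := by
    have := (hS.sub (hη.isPrim.const_mul d)).mul hinv
    convert this using 2
    all_goals simp only [div_eq_mul_inv]
    ring
  have hbd : ∀ r, 0 < r → |(S r - d * η r) / r| ≤ B + |(d:ℝ)| := by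
    intro r hr
    rw [abs_div, abs_of_pos hr, div_le_iff₀ hr]
    have h1 : |η r| ≤ r := by
      rcases le_or_gt r 1 with h | h
      · rw [hη.eq_zero r ⟨hr.le, h⟩, abs_zero]; exact hr.le
      · exact (hη.abs_le hr).trans h.le
    calc _ ≤ |S r| + |d * η r| := abs_sub _ _
      _ ≤ B * r + |(d:ℝ)| * r := by rw [abs_mul]; gcongr; exact hB r hr
      _ = _ := by ring
  set v : ℝ → ℝ := fun r => (S r - d * η r) / r with hv
  have hy : MemLp (fun r => (r * z r - d * deriv η r) / r) 2 radialMeasure := by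
    have h3 : MemLp (fun r => deriv η r / r) 2 radialMeasure := by
      refine memLp_of_compact one_pos (b := 2) (hη.continuousOn_deriv.div continuousOn_id
        fun x hx => ne_of_gt hx) (fun r h0 hr => ?_) (fun r hr => ?_)
      · rw [hη.deriv_eq_zero h0 (Or.inl hr), zero_div]
      · rw [hη.deriv_eq_zero (by linarith) (Or.inr hr), zero_div]
    refine (memLp_congr_ae (ae_radial_of_forall fun r hr => ?_)).1 (hz.sub (h3.const_mul d))
    simp only [Pi.sub_apply]; field_simp
  set y : ℝ → ℝ := fun r => (r * z r - d * deriv η r) / r with hydef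
  have hdiv : Integrable (fun r => (v r / r) ^ 2) radialMeasure := by
    have hcv := hp.continuousOn
    refine integrable_of_interval_bound ((hcv.div continuousOn_id fun x hx => ne_of_gt hx).pow 2)
      (fun r _ => sq_nonneg _) (C := ∫ r, y r ^ 2 ∂radialMeasure + (B + |(d:ℝ)|) ^ 2) fun a b ha hab => ?_
    have hb := ha.trans_le hab
    have h1 := (hp.mul hp).2 a b ha hb
    have hsub := uIcc_subset_Ioi ha hb
    have i1 : IntervalIntegrable (fun r => (v r / r) ^ 2 * r) volume a b := by
      refine ContinuousOn.intervalIntegrable ?_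
      refine (((hcv.div continuousOn_id fun x hx => ne_of_gt hx).pow 2).mul continuousOn_id).mono hsub
    have i2 : IntervalIntegrable (fun r => y r ^ 2 * r) volume a b :=
      intervalIntegrable_of_radial hy.integrable_sq ha.le hab
    have i3 := (hp.mul hp).intervalIntegrable ha hb
    have h2 := intervalIntegral.integral_mono_on hab ((i3.add i1)) i2 (fun r hr => by
      have hr0 : 0 < r := ha.trans_le hr.1
      have e : (v r / r) ^ 2 * r = (v r / r) * v r := by field_simp
      have e2 : (r * z r - d * deriv η r) / r - (S r - d * η r) / r ^ 2 = y r - v r / r := by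
        simp only [hydef, hv]; field_simp
      simp only [e2, e]
      have e3 : v r = (v r / r) * r := by field_simp
      rw [e3]
      have e4 : v r / r * r / r = v r / r := by field_simp
      rw [e4]
      nlinarith [mul_nonneg hr0.le (sq_nonneg (y r - v r / r))])
    rw [intervalIntegral.integral_add i3 i1, h1] at h2
    have h3 := setIntegral_interval_le_radial hy.integrable_sq (fun r _ => sq_nonneg _) ha.le hab
    have h4 : v a * v a ≤ (B + |(d:ℝ)|) ^ 2 := by
      rw [← sq]; exact sq_le_sq.2 ((hbd a ha).trans (le_abs_self _))
    have h5 : 0 ≤ v b * v b := mul_self_nonneg _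
    linarith
  have hvL : MemLp (fun r => v r / r) 2 radialMeasure := (memLp_two_radial hp.aesm_div).2 hdiv
  refine ⟨⟨hp, ?_, ?_⟩, hdiv⟩
  · refine ((hq.const_mul 4).add ((integrable_indicator_radial 0 (max R 2)).const_mul
      ((B + |(d:ℝ)|) ^ 2))).mono' (hp.aesm.pow 2) (ae_radial_of_forall fun r hr => ?_)
    rw [Real.norm_eq_abs, abs_of_nonneg (sq_nonneg _)]
    simp only [Pi.add_apply]
    by_cases h : r ∈ Ioc 0 (max R 2)
    · rw [indicator_of_mem h, mul_one]
      have h1 : v r ^ 2 ≤ (B + |(d:ℝ)|) ^ 2 := sq_le_sq.2 ((hbd r hr).trans (le_abs_self _))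
      have : 0 ≤ 4 * ((d - S r) ^ 2 * f r ^ 2 / r ^ 2) := by positivity
      linarith
    · rw [indicator_of_notMem h, mul_zero, add_zero]
      have h2 : max R 2 < r := by by_contra h'; exact h ⟨hr, not_lt.1 h'⟩
      have h3 := hR r ((le_max_left _ _).trans h2.le)
      simp only [hη.eq_one r (mem_Ici.2 ((le_max_right R 2).trans h2.le)), mul_one]
      rw [div_pow, ← mul_div_assoc]
      refine div_le_div_of_nonneg_right ?_ (by positivity)
      have : 1 / 4 ≤ f r ^ 2 := by nlinarith
      nlinarith [sq_nonneg (S r - d)]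
  · refine ((memLp_congr_ae (ae_radial_of_forall fun r hr => ?_)).1 (hy.sub hvL)).integrable_sq
    simp only [Pi.sub_apply, hydef, hv]
    field_simp

/-! ### Existence of minimizers -/

/-- Compactness of sequences of bounded energy. -/
theorem exists_limit_of_bounds {η : ℝ → ℝ} {f f' m m' : ℕ → ℝ → ℝ} (hη : IsCutoff η)
    (hf : ∀ n, AdmF η (f n) (f' n)) (hm : ∀ n, InH (m n) (m' n)) {A B : ℝ}
    (hfA : ∀ n, ∫ r, f' n r ^ 2 ∂radialMeasure ≤ A) (hmA : ∀ n, ∫ r, m' n r ^ 2 ∂radialMeasure ≤ A)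
    (hmB : ∀ n, ∫ r, m n r ^ 2 ∂radialMeasure ≤ B)
    (hqB : ∀ n, ∫ r, (1 - f n r ^ 2 - m n r ^ 2) ^ 2 ∂radialMeasure ≤ B) :
    ∃ k z l y, IsPrim k z ∧ MemLp z 2 radialMeasure ∧ IsPrim l y ∧ MemLp y 2 radialMeasure ∧
      ∃ R : ℝ, (∀ r, R ≤ r → 1 / 2 ≤ k r) ∧ ∃ φ : ℕ → ℕ, StrictMono φ ∧
      (∀ r, 0 < r → Tendsto (fun n => f (φ n) r) atTop (𝓝 (k r))) ∧
      (∀ r, 0 < r → Tendsto (fun n => m (φ n) r) atTop (𝓝 (l r))) ∧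
      Tendsto (fun n => ∫ r, f' (φ n) r * z r ∂radialMeasure) atTop
        (𝓝 (∫ r, z r ^ 2 ∂radialMeasure)) ∧
      Tendsto (fun n => ∫ r, m' (φ n) r * y r ∂radialMeasure) atTop
        (𝓝 (∫ r, y r ^ 2 ∂radialMeasure)) := by
  have hfI := fun n => (hf n).memLp_deriv hη
  have hqI := fun n => ((hf n).memLp_one_sub hη (hm n)).integrable_sq
  have hbI : ∀ n, Integrable (fun r => (1 - f n r ^ 2 - m n r ^ 2) ^ 2 + m n r ^ 2) radialMeasure :=
    fun n => (hqI n).add (hm n).sq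
  have hbB : ∀ n, ∫ r, ((1 - f n r ^ 2 - m n r ^ 2) ^ 2 + m n r ^ 2) ∂radialMeasure ≤ B + B := by
    intro n
    rw [integral_add (hqI n) (hm n).sq]
    exact add_le_add (hqB n) (hmB n)
  have hb0 : ∀ n r, 0 < r → 0 ≤ (1 - f n r ^ 2 - m n r ^ 2) ^ 2 + m n r ^ 2 :=
    fun n r _ => add_nonneg (sq_nonneg _) (sq_nonneg _)
  have hf1 : ∀ n, |f n 1| ≤ √(2 * A + 2 * 2 + 2 * (B + B)) := fun n => Real.abs_le_sqrt (by
    have := ((hf n).prim hη).sq_one_le (B := 2) (hfI n).integrable_sq (hfA n) (hbI n) (hb0 n)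
      (fun r _ => by nlinarith [sq_nonneg (1 - f n r ^ 2 - m n r ^ 2 + 1), sq_nonneg (m n r)])
    linarith [hbB n])
  have hm1 : ∀ n, |m n 1| ≤ √(2 * A + 2 * 0 + 2 * B) := fun n => Real.abs_le_sqrt (by
    have := (hm n).prim.sq_one_le (B := 0) (hm n).dsq (hmA n) (hm n).sq
      (fun r _ => sq_nonneg _) (fun r _ => by linarith)
    linarith [hmB n])
  -- If `f² ≤ 9/16`, then either `m²` or `1 - f² - m²` is at least `7/32`, whence the cost `49/1024
  -- = (7/32)²`.
  have hR : ∀ n r, 16 * A + 21 * (B + B) + 1 ≤ r → 1 / 2 ≤ f n r := fun n =>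
    ((hf n).prim hη).half_le (hfI n).integrable_sq (hfA n) (hbI n) (hb0 n) (hbB n) (fun r _ h => by
      have h1 : f n r ^ 2 ≤ 9 / 16 := by
        have := sq_le_sq.2 (h.trans (le_abs_self (3 / 4 : ℝ))); linarith
      nlinarith [sq_nonneg (m n r), sq_nonneg (m n r ^ 2 - 7 / 32), sq_nonneg (m n r ^ 2 - 7 / 16)])
      ((hf n).tendsto_atTop hη)
  obtain ⟨k, z, hz, hk, φ, hφ, hkl, hzw⟩ := exists_subseq_isPrim (ρ := fun _ => 1) continuousOn_const
    (fun _ _ => one_ne_zero) f f' (fun n => (hf n).prim hη) (by simpa only [div_one] using hfI)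
    (by simpa only [div_one] using hfA) hf1
  obtain ⟨l, y, hy, hl, ψ, hψ, hll, hyw⟩ := exists_subseq_isPrim (ρ := fun _ => 1) continuousOn_const
    (fun _ _ => one_ne_zero) (fun n => m (φ n)) (fun n => m' (φ n)) (fun n => (hm _).prim)
    (by simpa only [div_one] using fun n => (hm (φ n)).memLp_deriv)
    (by simpa only [div_one] using fun n => hmA (φ n)) (fun n => hm1 _)
  simp only [one_mul, div_one] at hk hzw hl hyw
  refine ⟨k, z, l, y, hk, hz, hl, hy, max 1 (16 * A + 21 * (B + B) + 1), fun r hr => ?_, φ ∘ ψ,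
    hφ.comp hψ, fun r hr => (hkl r hr).comp hψ.tendsto_atTop, hll, ?_, ?_⟩
  · exact ge_of_tendsto' (hkl r (one_pos.trans_le ((le_max_left _ _).trans hr)))
      fun n => hR _ r ((le_max_right _ _).trans hr)
  · simp only [sq]; exact (hzw z hz).comp hψ.tendsto_atTop
  · simp only [sq]; exact hyw y hy

/-- Since `S` vanishes at `0`, Cauchy–Schwarz gives `S² ≤ A r² / 2`; the factor `A + 1` avoids a
square root. -/
theorem AdmS.abs_le {d : ℤ} {η S S' : ℝ → ℝ} (hη : IsCutoff η) (hS : AdmS d η S S') {A : ℝ}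
    (hA : ∫ r, (S' r / r) ^ 2 ∂radialMeasure ≤ A) {r : ℝ} (hr : 0 < r) : |S r| ≤ (A + 1) * r := by
  have hA0 : 0 ≤ A := (integral_nonneg fun r => sq_nonneg _).trans hA
  have h1 : (S r - 0) ^ 2 ≤ A * (r ^ 2 / 2) := by
    refine le_of_tendsto ((tendsto_const_nhds.sub (hS.tendsto_zero hη)).pow 2) ?_
    filter_upwards [Ioo_mem_nhdsGT hr] with a ha
    refine ((hS.prim hη).sq_sub_le_sq (hS.memLp_deriv hη).integrable_sq ha.1 ha.2.le).trans ?_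
    refine mul_le_mul hA ?_ ?_ hA0
    · nlinarith [sq_nonneg a]
    · have := ha.1; have := ha.2; nlinarith
  refine abs_le_of_sq_le_sq ?_ (by positivity)
  rw [sub_zero] at h1
  nlinarith [mul_nonneg hA0 (sq_nonneg r), mul_nonneg (mul_nonneg hA0 hA0) (sq_nonneg r), sq_nonneg r]

theorem exists_isMin {κ g : ℝ} {d : ℤ} {η : ℝ → ℝ} (hη : IsCutoff η) (hκ : κ ≠ 0) (hg : 0 < g)
    (hd : d ≠ 0) : ∃ f f' S S' m m', AdmF η f f' ∧ AdmS d η S S' ∧ InH m m' ∧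
      ∀ f₁ f₁' S₁ S₁' m₁ m₁', AdmF η f₁ f₁' → AdmS d η S₁ S₁' → InH m₁ m₁' →
        ∫ r, edens κ g d f f' S S' m m' r ∂radialMeasure ≤
          ∫ r, edens κ g d f₁ f₁' S₁ S₁' m₁ m₁' r ∂radialMeasure := by
  have hκ2 : 0 < κ ^ 2 := by positivity
  set V : Set ℝ := {J | ∃ f f' S S' m m', AdmF η f f' ∧ AdmS d η S S' ∧ InH m m' ∧
    ∫ r, edens κ g d f f' S S' m m' r ∂radialMeasure = J} with hV
  have hpos : ∀ f f' S S' m m' r, 0 ≤ edens κ g d f f' S S' m m' r := by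
    intro f f' S S' m m' r; unfold edens; positivity
  have hbdd : BddBelow V := ⟨0, by
    rintro _ ⟨f, f', S, S', m, m', -, -, -, rfl⟩
    exact integral_nonneg fun r => hpos _ _ _ _ _ _ r⟩
  obtain ⟨J, hJa, hJ, hJV⟩ := exists_seq_tendsto_sInf
    (⟨_, _, _, _, _, _, _, AdmF.self, AdmS.self, InH.zero, rfl⟩ : V.Nonempty) hbdd
  choose f f' S S' m m' hf hS hm hJe using hJV
  have hint := fun n => integrable_edens (κ := κ) (g := g) hη (hf n) (hS n) (hm n)
  have hle : ∀ n, ∀ b : ℝ → ℝ, Integrable b radialMeasure →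
      (∀ r, b r ≤ edens κ g d (f n) (f' n) (S n) (S' n) (m n) (m' n) r) →
      ∫ r, b r ∂radialMeasure ≤ J 0 := fun n b hb h =>
    (integral_mono hb (hint n) h).trans ((hJe n).le.trans (hJa (Nat.zero_le n)))
  have hfI := fun n => ((hf n).memLp_deriv hη).integrable_sq
  have hSI := fun n => ((hS n).memLp_deriv hη).integrable_sq
  have hqI := fun n => ((hf n).memLp_one_sub hη (hm n)).integrable_sq
  have t4 : ∀ n r, 0 ≤ κ ^ 2 * g * m n r ^ 2 := fun n r => by positivity
  have t5 : ∀ n r, 0 ≤ (d - S n r) ^ 2 * f n r ^ 2 / r ^ 2 := fun n r => by positivity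
  have t6 : ∀ n r, 0 ≤ κ ^ 2 / 2 * (1 - f n r ^ 2 - m n r ^ 2) ^ 2 := fun n r => by positivity
  have hfA : ∀ n, ∫ r, f' n r ^ 2 ∂radialMeasure ≤ J 0 := fun n => hle n _ (hfI n) fun r => by
    unfold edens
    linarith [sq_nonneg (S' n r / r), sq_nonneg (m' n r), t4 n r, t5 n r, t6 n r]
  have hSA : ∀ n, ∫ r, (S' n r / r) ^ 2 ∂radialMeasure ≤ J 0 := fun n => hle n _ (hSI n) fun r => by
    unfold edens
    linarith [sq_nonneg (f' n r), sq_nonneg (m' n r), t4 n r, t5 n r, t6 n r]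
  have hmA : ∀ n, ∫ r, m' n r ^ 2 ∂radialMeasure ≤ J 0 := fun n => hle n _ (hm n).dsq fun r => by
    unfold edens
    linarith [sq_nonneg (f' n r), sq_nonneg (S' n r / r), t4 n r, t5 n r, t6 n r]
  have hJ0 : 0 ≤ J 0 := (integral_nonneg fun r => sq_nonneg _).trans (hfA 0)
  have hmB : ∀ n, ∫ r, m n r ^ 2 ∂radialMeasure ≤ J 0 / (κ ^ 2 * g) := fun n => by
    rw [le_div_iff₀' (by positivity), ← integral_const_mul]
    refine hle n _ ((hm n).sq.const_mul _) fun r => ?_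
    unfold edens
    linarith [sq_nonneg (f' n r), sq_nonneg (S' n r / r), sq_nonneg (m' n r), t5 n r, t6 n r]
  have hqB : ∀ n, ∫ r, (1 - f n r ^ 2 - m n r ^ 2) ^ 2 ∂radialMeasure ≤ J 0 / (κ ^ 2 / 2) := fun n => by
    rw [le_div_iff₀' (by positivity), ← integral_const_mul]
    refine hle n _ ((hqI n).const_mul _) fun r => ?_
    unfold edens
    linarith [sq_nonneg (f' n r), sq_nonneg (S' n r / r), sq_nonneg (m' n r), t5 n r, t4 n r]
  obtain ⟨k, z, l, y, hk, hz, hl, hy, R, hR, φ, hφ, hkl, hll, hzw, hyw⟩ :=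
    exists_limit_of_bounds hη hf hm hfA hmA (fun n => (hmB n).trans (le_max_left _ _))
      (fun n => (hqB n).trans (le_max_right _ _))
  have hSb := fun n r (hr : 0 < r) => (hS n).abs_le hη (hSA n) hr
  obtain ⟨T, x, hx, hT, ψ, hψ, hTl, hxw⟩ := exists_subseq_isPrim (ρ := fun r => r) continuousOn_id
    (fun r hr => hr.ne') (fun n => S (φ n)) (fun n => S' (φ n)) (fun n => (hS _).prim hη)
    (fun n => (hS (φ n)).memLp_deriv hη) (fun n => hSA (φ n)) (D := (J 0 + 1) * 1)
    (fun n => hSb _ 1 one_pos)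
  have hTb : ∀ r, 0 < r → |T r| ≤ (J 0 + 1) * r := fun r hr =>
    le_of_tendsto' (hTl r hr).abs fun n => hSb _ r hr
  set χ : ℕ → ℕ := fun n => φ (ψ n) with hχ
  have hkl' : ∀ r, 0 < r → Tendsto (fun n => f (χ n) r) atTop (𝓝 (k r)) :=
    fun r hr => (hkl r hr).comp hψ.tendsto_atTop
  have hll' : ∀ r, 0 < r → Tendsto (fun n => m (χ n) r) atTop (𝓝 (l r)) :=
    fun r hr => (hll r hr).comp hψ.tendsto_atTop
  have hJ' : Tendsto (fun n => J (χ n)) atTop (𝓝 (sInf V)) :=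
    hJ.comp (hφ.comp hψ).tendsto_atTop
  -- All terms without derivatives. They are nonnegative and converge pointwise, so Fatou applies to
  -- them.
  set pot : (ℝ → ℝ) → (ℝ → ℝ) → (ℝ → ℝ) → ℝ → ℝ := fun f S m r => κ ^ 2 * g * m r ^ 2
    + (d - S r) ^ 2 * f r ^ 2 / r ^ 2 + κ ^ 2 / 2 * (1 - f r ^ 2 - m r ^ 2) ^ 2 with hpot
  have hpotI : ∀ n, Integrable (pot (f n) (S n) (m n)) radialMeasure := fun n => by
    refine ((((hint n).sub (hfI n)).sub (hSI n)).sub (hm n).dsq).congr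
      (Eventually.of_forall fun r => ?_)
    simp only [Pi.sub_apply, hpot]; unfold edens; ring
  have hsplit : ∀ f f' S S' m m', Integrable (fun r => f' r ^ 2) radialMeasure →
      Integrable (fun r => (S' r / r) ^ 2) radialMeasure → Integrable (fun r => m' r ^ 2) radialMeasure →
      Integrable (pot f S m) radialMeasure →
      ∫ r, edens κ g d f f' S S' m m' r ∂radialMeasure = ∫ r, f' r ^ 2 ∂radialMeasure +
        ∫ r, (S' r / r) ^ 2 ∂radialMeasure + ∫ r, m' r ^ 2 ∂radialMeasure +
          ∫ r, pot f S m r ∂radialMeasure := by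
    intro f f' S S' m m' h1 h2 h3 h4
    have h12 : Integrable (fun r => f' r ^ 2 + (S' r / r) ^ 2) radialMeasure := h1.add h2
    have h123 : Integrable (fun r => f' r ^ 2 + (S' r / r) ^ 2 + m' r ^ 2) radialMeasure := h12.add h3
    rw [← integral_add h1 h2, ← integral_add h12 h3, ← integral_add h123 h4]
    refine integral_congr_ae (Eventually.of_forall fun r => ?_)
    simp only [hpot]; unfold edens; ring
  have hxw' := hxw x hx
  -- In the limit each bracket equals the integral of the squared limit derivative, so the
  -- conclusion is that the limit has energy at most `sInf V`.
  have hlimit := integrable_of_tendsto_of_le (h := fun n => pot (f (χ n)) (S (χ n)) (m (χ n)))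
    (k := pot k T l) (c := fun n => J (χ n)
      - (2 * ∫ r, f' (χ n) r * z r ∂radialMeasure - ∫ r, z r ^ 2 ∂radialMeasure)
      - (2 * ∫ r, (S' (χ n) r / r) * x r ∂radialMeasure - ∫ r, x r ^ 2 ∂radialMeasure)
      - (2 * ∫ r, m' (χ n) r * y r ∂radialMeasure - ∫ r, y r ^ 2 ∂radialMeasure))
    (L := sInf V - (2 * ∫ r, z r ^ 2 ∂radialMeasure - ∫ r, z r ^ 2 ∂radialMeasure)
      - (2 * ∫ r, x r * x r ∂radialMeasure - ∫ r, x r ^ 2 ∂radialMeasure)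
      - (2 * ∫ r, y r ^ 2 ∂radialMeasure - ∫ r, y r ^ 2 ∂radialMeasure))
    (fun n => hpotI _) (fun n r _ => add_nonneg (add_nonneg (t4 _ r) (t5 _ r)) (t6 _ r))
    (fun r hr => ?_) (fun n => ?_) ?_
  rotate_left
  · have a := hkl' r hr
    have b := hll' r hr
    have c := hTl r hr
    exact ((tendsto_const_nhds.mul (b.pow 2)).add ((((tendsto_const_nhds.sub c).pow 2).mul
      (a.pow 2)).div_const _)).add (tendsto_const_nhds.mul
        (((tendsto_const_nhds.sub (a.pow 2)).sub (b.pow 2)).pow 2))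
  · have e := hsplit _ _ _ _ _ _ (hfI (χ n)) (hSI (χ n)) (hm (χ n)).dsq (hpotI (χ n))
    rw [hJe] at e
    have e1 := two_mul_integral_sub_le ((hf (χ n)).memLp_deriv hη) hz
    have e2 := two_mul_integral_sub_le ((hS (χ n)).memLp_deriv hη) hx
    have e3 := two_mul_integral_sub_le (hm (χ n)).memLp_deriv hy
    linarith
  · exact ((hJ'.sub (((hzw.comp hψ.tendsto_atTop).const_mul 2).sub_const _)).sub
      ((hxw'.const_mul 2).sub_const _)).sub (((hyw.comp hψ.tendsto_atTop).const_mul 2).sub_const _)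
  obtain ⟨hpI, hpL⟩ := hlimit
  simp only [← sq] at hpL
  have p4 : ∀ r, 0 ≤ κ ^ 2 * g * l r ^ 2 := fun r => by positivity
  have p5 : ∀ r, 0 ≤ (d - T r) ^ 2 * k r ^ 2 / r ^ 2 := fun r => by positivity
  have p6 : ∀ r, 0 ≤ κ ^ 2 / 2 * (1 - k r ^ 2 - l r ^ 2) ^ 2 := fun r => by positivity
  have hck := hk.continuousOn
  have hcT := hT.continuousOn
  have hcl := hl.continuousOn
  have hlI : Integrable (fun r => l r ^ 2) radialMeasure := by
    refine (hpI.const_mul (1 / (κ ^ 2 * g))).mono' (aesm_of_continuousOn (hcl.pow 2))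
      (Eventually.of_forall fun r => ?_)
    rw [Real.norm_eq_abs, abs_of_nonneg (sq_nonneg _), one_div_mul_eq_div, le_div_iff₀' (by positivity)]
    simp only [hpot]
    linarith [p5 r, p6 r]
  have hqI' : Integrable (fun r => (1 - k r ^ 2 - l r ^ 2) ^ 2) radialMeasure := by
    refine (hpI.const_mul (1 / (κ ^ 2 / 2))).mono' (aesm_of_continuousOn
      (((continuousOn_const.sub (hck.pow 2)).sub (hcl.pow 2)).pow 2)) (Eventually.of_forall fun r => ?_)
    rw [Real.norm_eq_abs, abs_of_nonneg (sq_nonneg _), one_div_mul_eq_div, le_div_iff₀' (by positivity)]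
    simp only [hpot]
    linarith [p4 r, p5 r]
  have hcI : Integrable (fun r => (d - T r) ^ 2 * k r ^ 2 / r ^ 2) radialMeasure := by
    refine hpI.mono' (aesm_of_continuousOn ((((continuousOn_const.sub hcT).pow 2).mul (hck.pow 2)).div
      (continuousOn_id.pow 2) fun r hr => pow_ne_zero 2 (ne_of_gt hr))) (Eventually.of_forall fun r => ?_)
    rw [Real.norm_eq_abs, abs_of_nonneg (p5 r)]
    simp only [hpot]
    linarith [p4 r, p6 r]
  have hlH : InH l y := ⟨hl, hlI, hy.integrable_sq⟩
  have hd1 : (1:ℝ) ≤ |(d:ℝ)| := by exact_mod_cast Int.one_le_abs hd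
  have hkF : AdmF η k z := by
    -- For `r < δ` the bound `|T| ≤ (J 0 + 1) r < 1/2` and `|d| ≥ 1` give `|d - T| ≥ 1/2`, so four
    -- times the coupling term dominates `(k / r)²`.
    refine admF_of_bounds hη hk hz hlH hqI' hR (δ := 1 / (2 * (J 0 + 1))) (by positivity) ?_
      (hcI.const_mul 4) (fun r _ => mul_nonneg zero_le_four (p5 r)) fun r hr hrδ => ?_
    · rw [div_le_one (by positivity)]; linarith
    · rw [lt_div_iff₀ (by positivity)] at hrδ
      have h1 : 1 / 2 ≤ |(d:ℝ) - T r| := by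
        have := abs_sub_abs_le_abs_sub (d:ℝ) (T r)
        have := hTb r hr
        linarith
      have h2 : 1 / 4 ≤ (d - T r) ^ 2 := by
        rw [← sq_abs]; nlinarith
      rw [div_pow, ← mul_div_assoc]
      refine div_le_div_of_nonneg_right ?_ (sq_nonneg r)
      nlinarith [sq_nonneg (k r)]
  have hTS : AdmS d η T fun r => r * x r := admS_of_bounds hη hT hx hTb hcI hR
  refine ⟨k, z, T, _, l, y, hkF, hTS, hlH, fun f₁ f₁' S₁ S₁' m₁ m₁' h1 h2 h3 => ?_⟩
  refine le_trans ?_ (csInf_le hbdd ⟨_, _, _, _, _, _, h1, h2, h3, rfl⟩)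
  rw [hsplit _ _ _ _ _ _ hz.integrable_sq (hTS.memLp_deriv hη).integrable_sq hy.integrable_sq hpI]
  have : ∫ r, (r * x r / r) ^ 2 ∂radialMeasure = ∫ r, x r ^ 2 ∂radialMeasure :=
    integral_congr_ae (ae_radial_of_forall fun r hr => by simp only [mul_div_cancel_left₀ _ hr.ne'])
  rw [this]
  linarith

/-- Here `D = d² / r²`, `a = f²`, `s = m²`. With `x = 1 - a - s` one has `D (a - e) ≥ D (a - 1) = -D
x - D s`. If `D ≤ g / 2`, the last term is absorbed by `g s / 2` and `x² / 4 - D x + D²` is a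
square. If `D ≥ g / 2`, the crude bound `D (a - 1) ≥ -D` suffices, as `D ≤ 2 D² / g`. -/
theorem potential_lower_bound {g D e : ℝ} (hg : 0 < g) (hD : 0 ≤ D) (he1 : e ≤ 1)
    (a s : ℝ) (ha : 0 ≤ a) (hs : 0 ≤ s) : g / 2 * s + 1 / 4 * (1 - a - s) ^ 2 ≤
      g * s + D * (a - e) + 1 / 2 * (1 - a - s) ^ 2 + D ^ 2 * (1 + 2 / g) := by
  have h0 : D * (a - 1) ≤ D * (a - e) := mul_le_mul_of_nonneg_left (by linarith) hD
  have h1 : D ^ 2 * (1 + 2 / g) = D ^ 2 + D * (2 * D / g) := by ring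
  rcases le_total D (g / 2) with h | h
  · have h2 : 0 ≤ D * (2 * D / g) := by positivity
    nlinarith [sq_nonneg ((1 - a - s) / 2 - D), mul_nonneg (sub_nonneg.2 h) hs]
  · have h2 : 1 ≤ 2 * D / g := by rw [le_div_iff₀ hg]; linarith
    nlinarith [mul_le_mul_of_nonneg_left h2 hD, sq_nonneg (1 - a - s), mul_nonneg hD ha,
      mul_nonneg hg.le hs, sq_nonneg D]

/-- Existence of minimizers for `κ = ∞`; if `b` holds, the competitors are restricted to `m = 0`. -/
theorem exists_isMinInf {g : ℝ} {d : ℤ} {η : ℝ → ℝ} (hη : IsCutoff η) (hg : 0 < g)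
    (hd : d ≠ 0) (b : Prop) : ∃ f f' m m', AdmF η f f' ∧ InH m m' ∧ (b → ∀ r, 0 < r → m r = 0) ∧
      ∀ f₁ f₁' m₁ m₁', AdmF η f₁ f₁' → InH m₁ m₁' → (b → ∀ r, 0 < r → m₁ r = 0) →
        ∫ r, edensInf g d η f f' m m' r ∂radialMeasure ≤
          ∫ r, edensInf g d η f₁ f₁' m₁ m₁' r ∂radialMeasure := by
  -- The error `D² (1 + 2 / g)` of `potential_lower_bound`, needed only beyond `1`: on `(0, 1]` the
  -- cut-off vanishes and the term with `d²` is nonnegative.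
  set ℓ : ℝ → ℝ := (Ioi (1:ℝ)).indicator fun r => ((d:ℝ) ^ 4 * (1 + 2 / g)) / r ^ 4 with hℓ
  have hℓI : Integrable ℓ radialMeasure := integrable_inv_four _
  have hd1 : (1:ℝ) ≤ (d:ℝ) ^ 2 := by
    rw [← sq_abs]
    have : (1:ℝ) ≤ |(d:ℝ)| := by exact_mod_cast Int.one_le_abs hd
    nlinarith
  set pot : (ℝ → ℝ) → (ℝ → ℝ) → ℝ → ℝ := fun f m r => g * m r ^ 2
    + (d:ℝ) ^ 2 / r ^ 2 * (f r ^ 2 - η r ^ 2) + 1 / 2 * (1 - f r ^ 2 - m r ^ 2) ^ 2 + ℓ r with hpot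
  set c : (ℝ → ℝ) → ℝ → ℝ := fun f => (Ioc (0:ℝ) 1).indicator fun r => (f r / r) ^ 2 with hc
  have hc0 : ∀ f r, 0 ≤ c f r := fun f r => indicator_nonneg (fun r _ => sq_nonneg _) r
  have hlow : ∀ f m r, 0 < r →
      g / 2 * m r ^ 2 + 1 / 4 * (1 - f r ^ 2 - m r ^ 2) ^ 2 + c f r ≤ pot f m r := by
    intro f m r hr
    simp only [hpot, hℓ, hc]
    rcases le_or_gt r 1 with h | h
    · rw [indicator_of_mem (mem_Ioc.2 ⟨hr, h⟩), indicator_of_notMem (notMem_Ioi.2 h),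
        hη.eq_zero r ⟨hr.le, h⟩]
      have : (f r / r) ^ 2 ≤ (d:ℝ) ^ 2 / r ^ 2 * (f r ^ 2 - 0 ^ 2) := by
        have e : (d:ℝ) ^ 2 / r ^ 2 * (f r ^ 2 - 0 ^ 2) = (d:ℝ) ^ 2 * (f r / r) ^ 2 := by ring
        rw [e]
        exact le_mul_of_one_le_left (sq_nonneg _) hd1
      nlinarith [mul_nonneg hg.le (sq_nonneg (m r)), sq_nonneg (1 - f r ^ 2 - m r ^ 2)]
    · rw [indicator_of_notMem (fun h' => not_le.2 h h'.2), indicator_of_mem (mem_Ioi.2 h)]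
      have h1 := hη.mem_Icc r hr.le
      have := potential_lower_bound hg (D := (d:ℝ) ^ 2 / r ^ 2) (e := η r ^ 2) (by positivity)
        (pow_le_one₀ h1.1 h1.2) (f r ^ 2) (m r ^ 2) (sq_nonneg _) (sq_nonneg _)
      have e : ((d:ℝ) ^ 2 / r ^ 2) ^ 2 * (1 + 2 / g) = (d:ℝ) ^ 4 * (1 + 2 / g) / r ^ 4 := by ring
      rw [e] at this
      linarith
  have p1 : ∀ (m : ℝ → ℝ) r, 0 ≤ g / 2 * m r ^ 2 := fun m r => by positivity
  have p2 : ∀ (f m : ℝ → ℝ) r, 0 ≤ 1 / 4 * (1 - f r ^ 2 - m r ^ 2) ^ 2 := fun f m r => by positivity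
  have hsplit : ∀ f f' m m', Integrable (fun r => f' r ^ 2) radialMeasure →
      Integrable (fun r => m' r ^ 2) radialMeasure → Integrable (pot f m) radialMeasure →
      ∫ r, edensInf g d η f f' m m' r ∂radialMeasure = ∫ r, f' r ^ 2 ∂radialMeasure +
        ∫ r, m' r ^ 2 ∂radialMeasure + ∫ r, pot f m r ∂radialMeasure - ∫ r, ℓ r ∂radialMeasure := by
    intro f f' m m' h1 h3 h4
    have h13 : Integrable (fun r => f' r ^ 2 + m' r ^ 2) radialMeasure := h1.add h3
    have h134 : Integrable (fun r => f' r ^ 2 + m' r ^ 2 + pot f m r) radialMeasure := h13.add h4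
    rw [← integral_add h1 h3, ← integral_add h13 h4, ← integral_sub h134 hℓI]
    refine integral_congr_ae (Eventually.of_forall fun r => ?_)
    simp only [hpot]; unfold edensInf; ring
  have hpotI : ∀ {f f' m m'}, AdmF η f f' → InH m m' → Integrable (pot f m) radialMeasure := by
    intro f f' m m' hf hm
    refine ((((integrable_edensInf (g := g) (d := d) hη hf hm).sub
      (hf.memLp_deriv hη).integrable_sq).sub hm.dsq).add hℓI).congr (Eventually.of_forall fun r => ?_)
    simp only [Pi.sub_apply, Pi.add_apply, hpot]; unfold edensInf; ring
  set V : Set ℝ := {J | ∃ f f' m m', AdmF η f f' ∧ InH m m' ∧ (b → ∀ r, 0 < r → m r = 0) ∧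
    ∫ r, edensInf g d η f f' m m' r ∂radialMeasure = J} with hV
  have hpot0 : ∀ f m r, 0 < r → 0 ≤ pot f m r := fun f m r hr => by
    linarith [hlow f m r hr, hc0 f r, p1 m r, p2 f m r]
  have hbdd : BddBelow V := ⟨-∫ r, ℓ r ∂radialMeasure, by
    rintro _ ⟨f, f', m, m', hf, hm, -, rfl⟩
    rw [hsplit _ _ _ _ (hf.memLp_deriv hη).integrable_sq hm.dsq (hpotI hf hm)]
    have h1 : 0 ≤ ∫ r, f' r ^ 2 ∂radialMeasure := integral_nonneg fun r => sq_nonneg _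
    have h2 : 0 ≤ ∫ r, m' r ^ 2 ∂radialMeasure := integral_nonneg fun r => sq_nonneg _
    have h3 : 0 ≤ ∫ r, pot f m r ∂radialMeasure :=
      integral_nonneg_of_ae (ae_radial_of_forall fun r hr => hpot0 f m r hr)
    linarith⟩
  obtain ⟨J, hJa, hJ, hJV⟩ := exists_seq_tendsto_sInf
    (⟨_, _, _, _, _, AdmF.self, InH.zero, fun _ _ _ => rfl, rfl⟩ : V.Nonempty) hbdd
  choose f f' m m' hf hm hmb hJe using hJV
  have hfI := fun n => ((hf n).memLp_deriv hη).integrable_sq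
  have hqI := fun n => ((hf n).memLp_one_sub hη (hm n)).integrable_sq
  have hpI := fun n => hpotI (hf n) (hm n)
  have hJs : ∀ n, ∫ r, f' n r ^ 2 ∂radialMeasure + ∫ r, m' n r ^ 2 ∂radialMeasure +
      ∫ r, pot (f n) (m n) r ∂radialMeasure = J n + ∫ r, ℓ r ∂radialMeasure := fun n => by
    rw [← hJe n, hsplit _ _ _ _ (hfI n) (hm n).dsq (hpI n)]; ring
  have hJle : ∀ n, J n ≤ J 0 := fun n => hJa (Nat.zero_le n)
  have n1 : ∀ n, 0 ≤ ∫ r, f' n r ^ 2 ∂radialMeasure := fun n => integral_nonneg fun r => sq_nonneg _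
  have n2 : ∀ n, 0 ≤ ∫ r, m' n r ^ 2 ∂radialMeasure := fun n => integral_nonneg fun r => sq_nonneg _
  have n3 : ∀ n, 0 ≤ ∫ r, pot (f n) (m n) r ∂radialMeasure := fun n =>
    integral_nonneg_of_ae (ae_radial_of_forall fun r hr => hpot0 _ _ r hr)
  set A : ℝ := J 0 + ∫ r, ℓ r ∂radialMeasure with hA
  have hpA : ∀ n, ∫ r, pot (f n) (m n) r ∂radialMeasure ≤ A := fun n => by
    linarith [hJs n, hJle n, n1 n, n2 n]
  have hmB : ∀ n, ∫ r, m n r ^ 2 ∂radialMeasure ≤ A / (g / 2) := fun n => by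
    rw [le_div_iff₀' (by positivity), ← integral_const_mul]
    refine (integral_mono_ae ((hm n).sq.const_mul _) (hpI n) (ae_radial_of_forall fun r hr => ?_)).trans
      (hpA n)
    linarith [hlow (f n) (m n) r hr, hc0 (f n) r, p2 (f n) (m n) r]
  have hqB : ∀ n, ∫ r, (1 - f n r ^ 2 - m n r ^ 2) ^ 2 ∂radialMeasure ≤ A / (1 / 4) := fun n => by
    rw [le_div_iff₀' (by positivity), ← integral_const_mul]
    refine (integral_mono_ae ((hqI n).const_mul _) (hpI n) (ae_radial_of_forall fun r hr => ?_)).trans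
      (hpA n)
    linarith [hlow (f n) (m n) r hr, hc0 (f n) r, p1 (m n) r]
  obtain ⟨k, z, l, y, hk, hz, hl, hy, R, hR, φ, hφ, hkl, hll, hzw, hyw⟩ :=
    exists_limit_of_bounds hη hf hm (A := A) (fun n => by linarith [hJs n, hJle n, n2 n, n3 n])
      (fun n => by linarith [hJs n, hJle n, n1 n, n3 n])
      (fun n => (hmB n).trans (le_max_left _ _)) (fun n => (hqB n).trans (le_max_right _ _))
  have hlimit := integrable_of_tendsto_of_le (h := fun n => pot (f (φ n)) (m (φ n)))
    (k := pot k l) (c := fun n => J (φ n) + ∫ r, ℓ r ∂radialMeasure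
      - (2 * ∫ r, f' (φ n) r * z r ∂radialMeasure - ∫ r, z r ^ 2 ∂radialMeasure)
      - (2 * ∫ r, m' (φ n) r * y r ∂radialMeasure - ∫ r, y r ^ 2 ∂radialMeasure))
    (L := sInf V + ∫ r, ℓ r ∂radialMeasure
      - (2 * ∫ r, z r ^ 2 ∂radialMeasure - ∫ r, z r ^ 2 ∂radialMeasure)
      - (2 * ∫ r, y r ^ 2 ∂radialMeasure - ∫ r, y r ^ 2 ∂radialMeasure))
    (fun n => hpI _) (fun n r hr => hpot0 _ _ r hr)
    (fun r hr => ?_) (fun n => ?_) ?_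
  rotate_left
  · have a := (hkl r hr).pow 2
    have b := (hll r hr).pow 2
    exact (((tendsto_const_nhds.mul b).add (tendsto_const_nhds.mul (a.sub_const _))).add
      (tendsto_const_nhds.mul (((tendsto_const_nhds.sub a).sub b).pow 2))).add_const _
  · have e1 := two_mul_integral_sub_le ((hf (φ n)).memLp_deriv hη) hz
    have e3 := two_mul_integral_sub_le (hm (φ n)).memLp_deriv hy
    linarith [hJs (φ n)]
  · exact (((hJ.comp hφ.tendsto_atTop).add_const _).sub ((hzw.const_mul 2).sub_const _)).sub
      ((hyw.const_mul 2).sub_const _)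
  obtain ⟨hkI, hkL⟩ := hlimit
  have hck := hk.continuousOn
  have hcl := hl.continuousOn
  have hlI : Integrable (fun r => l r ^ 2) radialMeasure := by
    refine (hkI.const_mul (1 / (g / 2))).mono' (aesm_of_continuousOn (hcl.pow 2))
      (ae_radial_of_forall fun r hr => ?_)
    rw [Real.norm_eq_abs, abs_of_nonneg (sq_nonneg _), one_div_mul_eq_div, le_div_iff₀' (by positivity)]
    linarith [hlow k l r hr, hc0 k r, p2 k l r]
  have hqI' : Integrable (fun r => (1 - k r ^ 2 - l r ^ 2) ^ 2) radialMeasure := by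
    refine (hkI.const_mul (1 / (1 / 4))).mono' (aesm_of_continuousOn
      (((continuousOn_const.sub (hck.pow 2)).sub (hcl.pow 2)).pow 2)) (ae_radial_of_forall fun r hr => ?_)
    rw [Real.norm_eq_abs, abs_of_nonneg (sq_nonneg _), one_div_mul_eq_div, le_div_iff₀' (by positivity)]
    linarith [hlow k l r hr, hc0 k r, p1 l r]
  have hlH : InH l y := ⟨hl, hlI, hy.integrable_sq⟩
  have hkF : AdmF η k z := by
    refine admF_of_bounds hη hk hz hlH hqI' hR one_pos le_rfl hkI (fun r hr => hpot0 k l r hr)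
      fun r hr hr1 => ?_
    have h1 : c k r = (k r / r) ^ 2 := indicator_of_mem (mem_Ioc.2 ⟨hr, hr1.le⟩) _
    linarith [hlow k l r hr, p1 l r, p2 k l r]
  refine ⟨k, z, l, y, hkF, hlH, fun hb r hr => ?_, fun f₁ f₁' m₁ m₁' h1 h3 h4 => ?_⟩
  · refine tendsto_nhds_unique (hll r hr) ?_
    simp only [hmb _ hb r hr, tendsto_const_nhds]
  · refine le_trans ?_ (csInf_le hbdd ⟨_, _, _, _, h1, h3, h4, rfl⟩)
    rw [hsplit _ _ _ _ hz.integrable_sq hy.integrable_sq hkI]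
    linarith

/-! ### The profile at `κ = ∞` -/

/-- For a nonnegative integrand a bound along some sequence of upper limits is enough; boundary
terms are controlled only along a sequence. -/
theorem integrable_indicator_of_frequently {h : ℝ → ℝ} {a : ℝ} (ha : 0 < a) (hc : ContinuousOn h (Ioi 0))
    (h0 : ∀ r, 0 < r → 0 ≤ h r) {C : ℝ} (hC : ∃ᶠ b in atTop, ∫ r in a..b, h r * r ≤ C) :
    Integrable ((Ioi a).indicator h) radialMeasure := by
  obtain ⟨T, hT, hTC⟩ := exists_seq_forall_of_frequently (hC.and_eventually (eventually_ge_atTop a))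
  refine (integrable_of_tendsto_of_le (L := C) (h := fun n => (Ioc a (T n)).indicator h)
    (c := fun _ => C) (fun n => integrable_indicator_Ioc hc ha) (fun n r hr => ?_)
    (fun r hr => ?_) (fun n => ?_) tendsto_const_nhds).1
  · exact indicator_apply_nonneg fun _ => h0 r hr
  · refine tendsto_const_nhds.congr' ?_
    filter_upwards [hT.eventually (eventually_ge_atTop r)] with n hn
    by_cases hra : a < r
    · rw [indicator_of_mem (mem_Ioi.2 hra), indicator_of_mem (mem_Ioc.2 ⟨hra, hn⟩)]
    · rw [indicator_of_notMem (notMem_Ioi.2 (not_lt.1 hra)), indicator_of_notMem (fun h' => hra h'.1)]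
  · rw [integral_indicator_Ioc ha.le (hTC n).2]
    exact (hTC n).1

theorem exists_isProfile {d : ℤ} (hd : d ≠ 0) : ∃ F, IsProfile d F := by
  obtain ⟨η, hη⟩ := exists_isCutoff
  -- Minimization with `m = 0` imposed. The value `g = 1` is arbitrary, and variations of `f` alone
  -- respect the constraint.
  obtain ⟨f, f', m, m', hf, hm, hm0, hmin⟩ := exists_isMinInf hη one_pos hd True
  have hm0 := hm0 trivial
  have hmin' : ∀ f₁ f₁', AdmF η f₁ f₁' → ∫ r, edensInf 1 d η f f' m m' r ∂radialMeasure ≤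
      ∫ r, edensInf 1 d η f₁ f₁' m m' r ∂radialMeasure := fun f₁ f₁' h => hmin _ _ _ _ h hm fun _ => hm0
  obtain ⟨p, hfp, hp⟩ := exists_fluxInf_f hη hf hm hmin'
  have hsys : GLSystem 0 1 0 d f p (fun _ => 0) (fun _ => 0) (fun _ => 0) (fun _ => 0) :=
    ⟨hfp, fun r hr => by simpa only [hm0 r hr] using hp r hr,
      fun r _ => by simpa using hasDerivAt_const r (0:ℝ),
      fun r _ => by simpa using hasDerivAt_const r (0:ℝ),
      fun r _ => by simpa using hasDerivAt_const r (0:ℝ),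
      fun r _ => by simpa using hasDerivAt_const r (0:ℝ)⟩
  obtain ⟨F, -, -, hF, -, -, eF, -⟩ := hsys.exists_smooth hd (hf.tendsto_zero hη)
    tendsto_const_nhds (hf.integrableOn_sq_div hη 0) (A := 0) (by simp) (by simp)
  have hpos := pos_of_min_inf hη hf hm hmin'
  refine ⟨F, (contDiff_infty.1 hF 2).contDiffOn, fun r hr => by rw [eF r hr]; exact hpos r hr, fun r hr => ?_,
    tendsto_zero_congr eF (hf.tendsto_zero hη), tendsto_atTop_congr eF (hf.tendsto_atTop hη)⟩
  rw [(deriv_deriv_eq hfp hp eF hr).2, eF r hr, hm0 r hr]; ring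

namespace IsProfile

variable {d : ℤ} {F : ℝ → ℝ} (hF : IsProfile d F)
include hF

theorem hasDerivAt {r : ℝ} (hr : 0 < r) : HasDerivAt F (deriv F r) r :=
  ((hF.contDiffOn.differentiableOn two_ne_zero).differentiableAt (Ioi_mem_nhds hr)).hasDerivAt

theorem continuousOn_deriv : ContinuousOn (deriv F) (Ioi 0) :=
  hF.contDiffOn.continuousOn_deriv_of_isOpen isOpen_Ioi one_le_two

theorem hasDerivAt_flux {r : ℝ} (hr : 0 < r) : HasDerivAt (fun r => r * deriv F r)
    (r * (((d:ℝ) ^ 2 / r ^ 2 - (1 - F r ^ 2)) * F r)) r := by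
  have h1 : ContDiffOn ℝ 1 (deriv F) (Ioi 0) := by
    refine ((contDiffOn_succ_iff_deriv_of_isOpen (n := 1) isOpen_Ioi).1 ?_).2.2
    exact hF.contDiffOn
  have h2 := ((h1.differentiableOn one_ne_zero).differentiableAt (Ioi_mem_nhds hr)).hasDerivAt
  have h3 : HasDerivAt (fun r => r * deriv F r) _ r := (hasDerivAt_id' r).mul h2
  refine h3.congr_deriv ?_
  have := hF.eqn r hr
  have e : deriv (deriv F) r = -1 / r * deriv F r + (d:ℝ) ^ 2 / r ^ 2 * F r - (1 - F r ^ 2) * F r := by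
    linear_combination -this
  rw [e]; field_simp; ring

theorem exists_smooth (hd : d ≠ 0) : ∃ G : ℝ → ℝ, ContDiff ℝ ∞ G ∧ (∀ r, 0 < r → G r = F r) ∧ G 0 = 0 := by
  have hsys : GLSystem 0 1 0 d F (fun r => r * deriv F r) (fun _ => 0) (fun _ => 0) (fun _ => 0)
      (fun _ => 0) :=
    ⟨fun r hr => by simpa only [mul_div_cancel_left₀ _ hr.ne'] using hF.hasDerivAt hr,
      fun r hr => by simpa using hF.hasDerivAt_flux hr,
      fun r _ => by simpa using hasDerivAt_const r (0:ℝ),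
      fun r _ => by simpa using hasDerivAt_const r (0:ℝ),
      fun r _ => by simpa using hasDerivAt_const r (0:ℝ),
      fun r _ => by simpa using hasDerivAt_const r (0:ℝ)⟩
  obtain ⟨G, -, -, hG, -, -, eG, -, -, hG0, -⟩ := hsys.exists_smooth hd hF.zero
    tendsto_const_nhds (by simp) (A := 0) (by simp) (by simp)
  exact ⟨G, hG, eG, hG0⟩

/-- Along a sequence tending to infinity the boundary terms in the energy identity are bounded. -/
theorem frequently_flux_lt : ∃ᶠ T in atTop, T * deriv F T * (F T - 1) < 1 := by
  by_contra hcon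
  rw [not_frequently] at hcon
  obtain ⟨a, ha⟩ := eventually_atTop.1 (hcon.and (eventually_gt_atTop 0))
  have ha0 : ∀ r, a ≤ r → 0 < r := fun r hr => (ha r hr).2
  -- Otherwise `((F - 1)²)' ≥ 2 / r` from some radius on, and `(F - 1)²` would grow at least like a
  -- logarithm.
  have hmono : ∀ y, a ≤ y → (F a - 1) ^ 2 - Real.log a ≤ (F y - 1) ^ 2 - Real.log y := fun y hy =>
    le_of_hasDerivAt_nonneg (F := fun r => (F r - 1) ^ 2 - Real.log r)
      (F' := fun r => 2 * (F r - 1) * deriv F r - r⁻¹) (fun r hr => by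
        have h3 : HasDerivAt (fun r => (F r - 1) ^ 2 - Real.log r) _ r :=
          (((hF.hasDerivAt (ha0 r hr)).sub_const 1).pow 2).sub (Real.hasDerivAt_log (ha0 r hr).ne')
        exact h3.congr_deriv (by norm_num)) (fun r hr => by
        have h1 := not_lt.1 (ha r hr).1
        have h0 := ha0 r hr
        have e : 2 * (F r - 1) * deriv F r - r⁻¹ = (2 * (r * deriv F r * (F r - 1)) - 1) * r⁻¹ := by
          field_simp
        rw [e]
        exact mul_nonneg (by linarith) (inv_nonneg.2 h0.le)) le_rfl hy
  have h1 : Tendsto (fun y => (F y - 1) ^ 2) atTop (𝓝 ((1 - 1) ^ 2)) := (hF.infty.sub_const 1).pow 2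
  have h2 : ∀ᶠ y in atTop, (F y - 1) ^ 2 < 1 := h1.eventually (gt_mem_nhds (by norm_num))
  obtain ⟨y, ⟨hy1, hy2⟩, hy3⟩ := ((h2.and (eventually_ge_atTop a)).and
    (Real.tendsto_log_atTop.eventually (eventually_ge_atTop (1 - ((F a - 1) ^ 2 - Real.log a))))).exists
  linarith [hmono y hy2]

/-- The equation is multiplied by `F - 1`. With `D = d² / r²`, the correction `-2 d⁴ / r²`
contributes `4 D² r` to the derivative of `r F' (F - 1)` and pays for the cross term `D F (1 - F)`.
Where `1/2 < F < 2`, this uses `F² ≤ 4` and a quarter of `(1 - F)²`; as `F (1 + F) ≥ 3/4`, half of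
`(1 - F)²` is left. -/
theorem exists_integrable_tail : ∃ R, 2 ≤ R ∧ Integrable ((Ioi R).indicator fun r =>
    deriv F r ^ 2 + 1 / 2 * (1 - F r) ^ 2) radialMeasure := by
  have h1 : ∀ᶠ r in atTop, 1 / 2 < F r := hF.infty.eventually (lt_mem_nhds (by norm_num))
  have h2 : ∀ᶠ r in atTop, F r < 2 := hF.infty.eventually (gt_mem_nhds (by norm_num))
  obtain ⟨R, hR⟩ := eventually_atTop.1 ((h1.and h2).and (eventually_ge_atTop 2))
  have hR2 := (hR R le_rfl).2
  have hR0 : ∀ r, R ≤ r → 0 < r := fun r hr => by linarith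
  refine ⟨R, hR2, ?_⟩
  have cF : ContinuousOn F (Ioi 0) := hF.contDiffOn.continuousOn
  have cF' := hF.continuousOn_deriv
  set Q' : ℝ → ℝ := fun r => r * (((d:ℝ) ^ 2 / r ^ 2 - (1 - F r ^ 2)) * F r) * (F r - 1) +
    r * deriv F r * deriv F r + 4 * (d:ℝ) ^ 4 / r ^ 3 with hQ'
  have hQ : ∀ r, 0 < r → HasDerivAt (fun r => r * deriv F r * (F r - 1) - 2 * (d:ℝ) ^ 4 / r ^ 2)
      (Q' r) r := fun r hr => by
    have h3 : HasDerivAt (fun r => r * deriv F r * (F r - 1) - 2 * (d:ℝ) ^ 4 / r ^ 2) _ r :=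
      ((hF.hasDerivAt_flux hr).mul ((hF.hasDerivAt hr).sub_const 1)).sub
        ((hasDerivAt_const r (2 * (d:ℝ) ^ 4)).div (hasDerivAt_pow 2 r) (pow_ne_zero 2 hr.ne'))
    refine h3.congr_deriv ?_
    simp only [hQ']
    field_simp
    norm_num
    ring
  have cQ' : ContinuousOn Q' (Ioi 0) := by
    have c1 : ContinuousOn (fun r : ℝ => (d:ℝ) ^ 2 / r ^ 2) (Ioi 0) :=
      ContinuousOn.div (by fun_prop) (by fun_prop) fun x hx => pow_ne_zero 2 (ne_of_gt hx)
    have c2 : ContinuousOn (fun r : ℝ => 4 * (d:ℝ) ^ 4 / r ^ 3) (Ioi 0) :=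
      ContinuousOn.div (by fun_prop) (by fun_prop) fun x hx => pow_ne_zero 3 (ne_of_gt hx)
    fun_prop
  refine integrable_indicator_of_frequently (a := R) (C := 1 - (R * deriv F R * (F R - 1)
    - 2 * (d:ℝ) ^ 4 / R ^ 2)) (hR0 R le_rfl) (by fun_prop) (fun r _ => by positivity)
    (hF.frequently_flux_lt.and_eventually (eventually_ge_atTop R) |>.mono fun T hT => ?_)
  obtain ⟨hT1, hT2⟩ := hT
  have hsub := uIcc_subset_Ioi (hR0 R le_rfl) (hR0 T hT2)
  have h3 := intervalIntegral.integral_eq_sub_of_hasDerivAt (fun r hr => hQ r (hsub hr))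
    (cQ'.mono hsub).intervalIntegrable
  have h4 : ∫ r in R..T, (deriv F r ^ 2 + 1 / 2 * (1 - F r) ^ 2) * r ≤ ∫ r in R..T, Q' r := by
    have c3 : ContinuousOn (fun r => (deriv F r ^ 2 + 1 / 2 * (1 - F r) ^ 2) * r) (Ioi 0) := by fun_prop
    refine intervalIntegral.integral_mono_on hT2 (c3.mono hsub).intervalIntegrable
      (cQ'.mono hsub).intervalIntegrable fun r hr => ?_
    have hr0 := hR0 r hr.1
    obtain ⟨⟨h5, h6⟩, -⟩ := hR r hr.1
    set D : ℝ := (d:ℝ) ^ 2 / r ^ 2 with hD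
    have e : Q' r = (deriv F r ^ 2 + (F r * (1 + F r) * (1 - F r) ^ 2 - D * F r * (1 - F r)
        + 4 * D ^ 2)) * r := by
      simp only [hQ', hD]; field_simp; ring
    rw [e]
    refine mul_le_mul_of_nonneg_right ?_ hr0.le
    nlinarith [sq_nonneg ((1 - F r) / 2 - D * F r), mul_nonneg (sq_nonneg D) (by nlinarith : 0 ≤ 4 - F r ^ 2),
      mul_nonneg (sq_nonneg (1 - F r)) (by nlinarith : 0 ≤ F r * (1 + F r) - 3 / 4)]
  have h5 : 0 ≤ 2 * (d:ℝ) ^ 4 / T ^ 2 := by positivity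
  linarith

/-- Near the origin smoothness and `F(0) = 0` give `F = O(r)`; at infinity the energy identity
supplies the tail. Hence profile and cut-off define the same affine class. -/
theorem admF (hd : d ≠ 0) {η : ℝ → ℝ} (hη : IsCutoff η) : AdmF η F (deriv F) := by
  obtain ⟨G, hG, eG, hG0⟩ := hF.exists_smooth hd
  obtain ⟨R, hR, hI⟩ := hF.exists_integrable_tail
  have eG' : ∀ r, 0 < r → deriv G r = deriv F r := fun r hr =>
    Filter.EventuallyEq.deriv_eq (by filter_upwards [Ioi_mem_nhds hr] with x hx using eG x hx)
  have cF : ContinuousOn F (Ioi 0) := hF.contDiffOn.continuousOn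
  have cF' := hF.continuousOn_deriv
  obtain ⟨C, hC⟩ := (isCompact_Icc (a := 0) (b := R)).exists_bound_of_continuousOn
    (hG.continuous_deriv (by simp)).continuousOn
  obtain ⟨K, hK⟩ := (isCompact_Icc (a := 0) (b := R)).exists_bound_of_continuousOn
    hG.continuous.continuousOn
  have hFr : ∀ r, 0 < r → r ≤ R → |F r| ≤ C * r := by
    intro r hr hrR
    have := (convex_Icc 0 R).norm_image_sub_le_of_norm_deriv_le (f := G) (C := C)
      (fun x _ => (hG.differentiable (by simp)) x) hC (left_mem_Icc.2 (hr.le.trans hrR)) ⟨hr.le, hrR⟩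
    rwa [hG0, sub_zero, sub_zero, eG r hr, Real.norm_eq_abs, Real.norm_eq_abs, abs_of_pos hr] at this
  have hprim : IsPrim F (deriv F) := IsPrim.of_hasDerivAt (fun r hr => hF.hasDerivAt hr) cF'
  have hp := hprim.sub hη.isPrim
  have hbound : ∀ {h : ℝ → ℝ} {M : ℝ}, AEStronglyMeasurable h radialMeasure →
      (∀ r, 0 < r → r ≤ R → |h r| ≤ M) →
      (∀ r, R < r → h r ^ 2 ≤ 2 * (deriv F r ^ 2 + 1 / 2 * (1 - F r) ^ 2)) →
      Integrable (fun r => h r ^ 2) radialMeasure := by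
    intro h M hm h1 h2
    refine (((integrable_indicator_radial 0 R).const_mul (M ^ 2)).add (hI.const_mul 2)).mono'
      (hm.pow 2) (ae_radial_of_forall fun r hr => ?_)
    rw [Real.norm_eq_abs, abs_of_nonneg (sq_nonneg _), Pi.add_apply]
    rcases le_or_gt r R with h' | h'
    · rw [indicator_of_mem (mem_Ioc.2 ⟨hr, h'⟩), indicator_of_notMem (notMem_Ioi.2 h'), mul_one,
        mul_zero, add_zero]
      exact sq_le_sq.2 ((h1 r hr h').trans (le_abs_self M))
    · rw [indicator_of_notMem (fun h'' => not_le.2 h' h''.2), indicator_of_mem (mem_Ioi.2 h'),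
        mul_zero, zero_add]
      exact h2 r h'
  have hsq : ∀ r, R < r → (F r - η r) ^ 2 ≤ 2 * (deriv F r ^ 2 + 1 / 2 * (1 - F r) ^ 2) := fun r hr => by
    rw [hη.eq_one r (mem_Ici.2 (hR.trans hr.le))]
    nlinarith [sq_nonneg (deriv F r)]
  have hu : ∀ r, 0 < r → r ≤ R → |F r - η r| ≤ K + 1 := fun r hr hrR =>
    (abs_sub _ _).trans (add_le_add (by rw [← eG r hr]; exact hK r ⟨hr.le, hrR⟩) (hη.abs_le hr))
  refine ⟨⟨hp, hbound hp.aesm hu hsq, ?_⟩, hbound (M := max C (K + 1)) hp.aesm_div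
    (fun r hr hrR => ?_) fun r hr => ?_⟩
  · have h1 : Integrable (fun r => deriv F r ^ 2) radialMeasure :=
      hbound (aesm_of_continuousOn cF') (fun r hr hrR => by
        rw [← eG' r hr]; exact hC r ⟨hr.le, hrR⟩) fun r _ => by nlinarith [sq_nonneg (deriv F r), sq_nonneg (1 - F r)]
    exact (((memLp_two_radial (aesm_of_continuousOn cF')).2 h1).sub hη.memLp_deriv).integrable_sq
  · rw [abs_div, abs_of_pos hr]
    rcases le_or_gt r 1 with h | h
    · rw [hη.eq_zero r ⟨hr.le, h⟩, sub_zero, div_le_iff₀ hr]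
      exact (hFr r hr hrR).trans (mul_le_mul_of_nonneg_right (le_max_left _ _) hr.le)
    · exact (div_le_self (abs_nonneg _) h.le).trans ((hu r hr hrR).trans (le_max_right _ _))
  · refine le_trans ?_ (hsq r hr)
    rw [div_pow]
    exact div_le_self (sq_nonneg _) (one_le_pow₀ (by linarith))

end IsProfile

/-! ### Translation to the variables of the affine spaces -/

theorem exists_admF {η F F' u : ℝ → ℝ} (hF : AdmF η F F') (hu : u ∈ radialX) :
    ∃ f f', AdmF η f f' ∧ ∀ᵐ r, 0 < r → fOf F u r = f r := by
  obtain ⟨v, w, hv, -, e⟩ := exists_inX hu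
  refine ⟨_, _, hF.add hv, ?_⟩
  filter_upwards [e] with r hr h0
  rw [fOf, hr h0]

theorem AdmF.sub_mem {η F F' f f' : ℝ → ℝ} (hF : AdmF η F F') (hf : AdmF η f f') :
    (fun r => f r - F r) ∈ radialX :=
  ((hf.add (hF.const_mul (-1))).congr (fun r _ => by ring) fun _ _ => rfl :
    InX (fun r => f r - F r) _).mem

theorem fOf_sub (F f : ℝ → ℝ) : fOf F (fun r => f r - F r) = f := by
  ext r; simp [fOf]

theorem exists_admS {d : ℤ} {η v : ℝ → ℝ} (hv : v ∈ radialX) :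
    ∃ S S', AdmS d η S S' ∧ ∀ᵐ r, 0 < r → SOf d η v r = S r := by
  obtain ⟨u, w, hu, -, e⟩ := exists_inX hv
  refine ⟨fun r => d * η r + r * u r, fun r => d * deriv η r + (u r + r * w r),
    hu.congr (fun r hr => ?_) (fun r hr => ?_), ?_⟩
  · field_simp; ring
  · field_simp; ring
  · filter_upwards [e] with r hr h0
    rw [SOf, hr h0]

theorem SOf_div {d : ℤ} {η S : ℝ → ℝ} {r : ℝ} (hr : 0 < r) :
    SOf d η (fun r => (S r - d * η r) / r) r = S r := by
  simp only [SOf]; field_simp; ring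

theorem reducedEnergy_eq {κ g : ℝ} {d : ℤ} {η u v m f f' S S' m₁ m' : ℝ → ℝ} (hη : IsCutoff η)
    (hf : AdmF η f f') (hS : AdmS d η S S') (hm : InH m₁ m')
    (ef : ∀ᵐ r, 0 < r → fOf η u r = f r) (eS : ∀ᵐ r, 0 < r → SOf d η v r = S r)
    (em : ∀ᵐ r, 0 < r → m r = m₁ r) :
    reducedEnergy κ g d η (u, v, m) = 1 / 2 * (∫ r, edens κ g d f f' S S' m₁ m' r ∂radialMeasure) -
      energy κ g d η (fun r => d * η r) 0 := by
  simp only [reducedEnergy, energy]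
  rw [integral_congr_ae (density_ae_eq (hf.prim hη) (hS.prim hη) hm.prim ef eS em)]

theorem edensInf_eq (g : ℝ) (d : ℤ) (F η f f' m m' : ℝ → ℝ) (r : ℝ) : edensInf g d F f f' m m' r =
    edensInf g d η f f' m m' r - (d:ℝ) ^ 2 / r ^ 2 * (F r ^ 2 - η r ^ 2) := by
  unfold edensInf; ring

/-- The energies renormalized by `F` and by `η` differ by a finite constant, so they have the same
minimizers. -/
theorem integral_edensInf_eq {g : ℝ} {d : ℤ} {F F' η f f' m m' : ℝ → ℝ} (hη : IsCutoff η)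
    (hF : AdmF η F F') (hf : AdmF η f f') (hm : InH m m') :
    Integrable (edensInf g d F f f' m m') radialMeasure ∧
      ∫ r, edensInf g d F f f' m m' r ∂radialMeasure = ∫ r, edensInf g d η f f' m m' r ∂radialMeasure -
        ∫ r, (d:ℝ) ^ 2 / r ^ 2 * (F r ^ 2 - η r ^ 2) ∂radialMeasure := by
  have h1 := integrable_edensInf (g := g) (d := d) hη hf hm
  have h2 := integrable_sq_sub_sq (d := d) hη hF
  rw [← integral_sub h1 h2]
  simp only [← edensInf_eq, and_true]
  exact (h1.sub h2).congr (Eventually.of_forall fun r => (edensInf_eq g d F η f f' m m' r).symm)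

theorem reducedEnergyInf_eq {g : ℝ} {d : ℤ} {η F F' u m f f' m₁ m' : ℝ → ℝ} (hη : IsCutoff η)
    (hF : AdmF η F F') (hf : AdmF η f f') (hm : InH m₁ m')
    (ef : ∀ᵐ r, 0 < r → fOf F u r = f r) (em : ∀ᵐ r, 0 < r → m r = m₁ r) :
    reducedEnergyInf g d F (u, m) = 1 / 2 * (∫ r, edensInf g d η f f' m₁ m' r ∂radialMeasure) -
      (1 / 2 * (∫ r, (d:ℝ) ^ 2 / r ^ 2 * (F r ^ 2 - η r ^ 2) ∂radialMeasure) +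
        energyInf g d F F 0) := by
  simp only [reducedEnergyInf, energyInf]
  rw [integral_congr_ae (densityInf_ae_eq (hf.prim hη) hm.prim ef em), (integral_edensInf_eq hη hF hf hm).2]
  ring

theorem ae_eq_radial {u v w : ℝ → ℝ} (h : ∀ r, 0 < r → v r = w r) (e : ∀ᵐ r, 0 < r → u r = w r) :
    v =ᵐ[radialMeasure] u :=
  ae_radial_iff.2 (by filter_upwards [e] with r hr h0; rw [hr h0, h r h0])

/-! ### Assembly of the two cases -/

theorem exists_min_and_smooth {κ g : ℝ} {d : ℤ} {η : ℝ → ℝ} (hg : 0 < g) (hd : d ≠ 0) (hκ : κ ≠ 0)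
    (hη : IsCutoff η) :
    (∀ u ∈ radialX, ∀ v ∈ radialX, ∀ m ∈ radialH,
        Integrable (density κ g d (fOf η u) (SOf d η v) m) radialMeasure) ∧
      (∃ p ∈ radialX ×ˢ (radialX ×ˢ radialH),
        IsMinOn (reducedEnergy κ g d η) (radialX ×ˢ (radialX ×ˢ radialH)) p) ∧
      (∀ u ∈ radialX, ∀ v ∈ radialX, ∀ m ∈ radialH,
        IsMinOn (reducedEnergy κ g d η) (radialX ×ˢ (radialX ×ˢ radialH)) (u, v, m) →
        ∃ f S n : ℝ → ℝ, f =ᵐ[radialMeasure] fOf η u ∧ S =ᵐ[radialMeasure] SOf d η v ∧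
          n =ᵐ[radialMeasure] m ∧ IsSmoothSolution κ g d f S n) := by
  refine ⟨fun u hu v hv m hm => ?_, ?_, fun u hu v hv m hm hmin => ?_⟩
  · obtain ⟨f, f', hf, ef⟩ := exists_admF AdmF.self hu
    obtain ⟨S, S', hS, eS⟩ := exists_admS (d := d) (η := η) hv
    obtain ⟨n, n', hn, -, en⟩ := exists_inH hm
    exact (integrable_edens hη hf hS hn).congr
      (density_ae_eq (hf.prim hη) (hS.prim hη) hn.prim ef eS en).symm
  · obtain ⟨f, f', S, S', m, m', hf, hS, hm, hmin⟩ := exists_isMin hη hκ hg hd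
    refine ⟨(fun r => f r - η r, fun r => (S r - d * η r) / r, m),
      ⟨AdmF.self.sub_mem hf, InX.mem hS, hm.mem⟩, ?_⟩
    rintro ⟨u, v, n⟩ ⟨hu, hv, hn⟩
    obtain ⟨f₁, f₁', hf₁, ef⟩ := exists_admF AdmF.self hu
    obtain ⟨S₁, S₁', hS₁, eS⟩ := exists_admS (d := d) (η := η) hv
    obtain ⟨n₁, n₁', hn₁, -, en⟩ := exists_inH hn
    simp only [mem_ofPred_eq]
    rw [reducedEnergy_eq hη hf hS hm (by simp [fOf_sub]) (Eventually.of_forall fun r hr => SOf_div hr)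
      (Eventually.of_forall fun _ _ => rfl), reducedEnergy_eq hη hf₁ hS₁ hn₁ ef eS en]
    linarith [hmin _ _ _ _ _ _ hf₁ hS₁ hn₁]
  · obtain ⟨f, f', hf, ef⟩ := exists_admF AdmF.self hu
    obtain ⟨S, S', hS, eS⟩ := exists_admS (d := d) (η := η) hv
    obtain ⟨n, n', hn, -, en⟩ := exists_inH hm
    obtain ⟨f₀, S₀, n₀, hf₀, hS₀, hn₀, hsol⟩ := exists_isSmoothSolution (κ := κ) (g := g) hη hd hf hS hn
      fun f₁ f₁' S₁ S₁' m₁ m₁' h1 h2 h3 => by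
        have h := hmin (a := (fun r => f₁ r - η r, fun r => (S₁ r - d * η r) / r, m₁))
          ⟨AdmF.self.sub_mem h1, InX.mem h2, h3.mem⟩
        simp only [mem_ofPred_eq] at h
        rw [reducedEnergy_eq hη hf hS hn ef eS en, reducedEnergy_eq hη h1 h2 h3 (by simp [fOf_sub])
          (Eventually.of_forall fun r hr => SOf_div hr) (Eventually.of_forall fun _ _ => rfl)] at h
        linarith
    exact ⟨f₀, S₀, n₀, ae_eq_radial hf₀ ef, ae_eq_radial hS₀ eS, ae_eq_radial hn₀ en, hsol⟩

theorem exists_min_and_smooth_inf {g : ℝ} {d : ℤ} {F : ℝ → ℝ} (hg : 0 < g) (hd : d ≠ 0) (hF : IsProfile d F) :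
    (∀ u ∈ radialX, ∀ m ∈ radialH,
        Integrable (densityInf g d F (fOf F u) m) radialMeasure) ∧
      (∃ p ∈ radialX ×ˢ radialH,
        IsMinOn (reducedEnergyInf g d F) (radialX ×ˢ radialH) p) ∧
      (∀ u ∈ radialX, ∀ m ∈ radialH,
        IsMinOn (reducedEnergyInf g d F) (radialX ×ˢ radialH) (u, m) →
        ∃ f n : ℝ → ℝ, f =ᵐ[radialMeasure] fOf F u ∧ n =ᵐ[radialMeasure] m ∧
          IsSmoothSolutionInf g d f n) := by
  -- An auxiliary cut-off: the analysis is done in `η + X`, which equals `F + X`.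
  obtain ⟨η, hη⟩ := exists_isCutoff
  have hFη := hF.admF hd hη
  refine ⟨fun u hu m hm => ?_, ?_, fun u hu m hm hmin => ?_⟩
  · obtain ⟨f, f', hf, ef⟩ := exists_admF hFη hu
    obtain ⟨n, n', hn, -, en⟩ := exists_inH hm
    exact (integral_edensInf_eq hη hFη hf hn).1.congr (densityInf_ae_eq (hf.prim hη) hn.prim ef en).symm
  · obtain ⟨f, f', m, m', hf, hm, -, hmin⟩ := exists_isMinInf hη hg hd False
    refine ⟨(fun r => f r - F r, m), ⟨hFη.sub_mem hf, hm.mem⟩, ?_⟩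
    rintro ⟨u, n⟩ ⟨hu, hn⟩
    obtain ⟨f₁, f₁', hf₁, ef⟩ := exists_admF hFη hu
    obtain ⟨n₁, n₁', hn₁, -, en⟩ := exists_inH hn
    simp only [mem_ofPred_eq]
    rw [reducedEnergyInf_eq hη hFη hf hm (by simp [fOf_sub])
      (Eventually.of_forall fun _ _ => rfl), reducedEnergyInf_eq hη hFη hf₁ hn₁ ef en]
    linarith [hmin _ _ _ _ hf₁ hn₁ False.elim]
  · obtain ⟨f, f', hf, ef⟩ := exists_admF hFη hu
    obtain ⟨n, n', hn, -, en⟩ := exists_inH hm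
    obtain ⟨f₀, n₀, hf₀, hn₀, hsol⟩ := exists_isSmoothSolutionInf (g := g) hη hd hf hn
      fun f₁ f₁' m₁ m₁' h1 h3 => by
        have h := hmin (a := (fun r => f₁ r - F r, m₁)) ⟨hFη.sub_mem h1, h3.mem⟩
        simp only [mem_ofPred_eq] at h
        rw [reducedEnergyInf_eq hη hFη hf hn ef en, reducedEnergyInf_eq hη hFη h1 h3 (by simp [fOf_sub])
          (Eventually.of_forall fun _ _ => rfl)] at h
        linarith
    exact ⟨f₀, n₀, ae_eq_radial hf₀ ef, ae_eq_radial hn₀ en, hsol⟩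

end GLVortex

theorem theorem2p2 (g : ℝ) (hg : 0 < g) (d : ℤ) (hd : d ≠ 0) :
    -- finite `κ`
    (∀ κ : ℝ, κ ≠ 0 → ∀ η : ℝ → ℝ, IsCutoff η →
      -- the reduced energy is well defined on `X × X × H`
      (∀ u ∈ radialX, ∀ v ∈ radialX, ∀ m ∈ radialH,
        Integrable (density κ g d (fOf η u) (SOf d η v) m) radialMeasure) ∧
      -- it attains its minimum
      (∃ p ∈ radialX ×ˢ (radialX ×ˢ radialH),
        IsMinOn (reducedEnergy κ g d η) (radialX ×ˢ (radialX ×ˢ radialH)) p) ∧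
      -- minimizers give smooth solutions
      (∀ u ∈ radialX, ∀ v ∈ radialX, ∀ m ∈ radialH,
        IsMinOn (reducedEnergy κ g d η) (radialX ×ˢ (radialX ×ˢ radialH)) (u, v, m) →
        ∃ f S n : ℝ → ℝ, f =ᵐ[radialMeasure] fOf η u ∧ S =ᵐ[radialMeasure] SOf d η v ∧
          n =ᵐ[radialMeasure] m ∧ IsSmoothSolution κ g d f S n)) ∧
    -- `κ = ∞`
    (∃ F : ℝ → ℝ, IsProfile d F) ∧
    (∀ F : ℝ → ℝ, IsProfile d F →
      (∀ u ∈ radialX, ∀ m ∈ radialH,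
        Integrable (densityInf g d F (fOf F u) m) radialMeasure) ∧
      (∃ p ∈ radialX ×ˢ radialH,
        IsMinOn (reducedEnergyInf g d F) (radialX ×ˢ radialH) p) ∧
      (∀ u ∈ radialX, ∀ m ∈ radialH,
        IsMinOn (reducedEnergyInf g d F) (radialX ×ˢ radialH) (u, m) →
        ∃ f n : ℝ → ℝ, f =ᵐ[radialMeasure] fOf F u ∧ n =ᵐ[radialMeasure] m ∧
          IsSmoothSolutionInf g d f n)) := by
  exact ⟨fun κ hκ η hη => exists_min_and_smooth hg hd hκ hη, exists_isProfile hd,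
    fun F hF => exists_min_and_smooth_inf hg hd hF⟩
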